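/- **Setting.** Fix integers $n,N\ge 1$ and $k>n+1$, and a Dirichlet character $\chi$ modulo $N$. Let $Sp_n(\mathbb Z)$ be the group of integral symplectic $2n\times 2n$ matrices $\begin{pmatrix}A&B\\C&D\end{pmatrix}$, let $\Gamma_\infty$ be the subgroup with $C=0$, $\Gamma_\infty^+$ the subgroup with $C=0$ and $\det A=1$, $\Gamma(N)$ the subgroup of matrices congruent to $I$ modulo $N$, and $\Gamma_0(N)$ the subgroup with $C\equiv 0\pmod N$; for $\delta=\begin{pmatrix}A&B\\C&D\end{pmatrix}\in\Gamma_0(N)$ put $\chi(\delta)=\chi(\det D)$. Let $\mathfrak h_n=\{X+iY: X,Y\in\mathbb R^{n\times n}\text{ symmetric},\ Y>0\}$, and for $f:\mathfrak h_n\to\mathbb C$ and $\gamma=\begin{pmatrix}A&B\\C&D\end{pmatrix}\in Sp_n(\mathbb Z)$ let $(f|\gamma)(\tau)=\det(C\tau+D)^{-k}f((A\tau+B)(C\tau+D)^{-1})$; in particular $1(\tau)|\gamma=\det(C\tau+D)^{-k}$. Let $\gamma_\pm=\mathrm{diag}(G_\pm,G_\pm)$ with $G_\pm=\mathrm{diag}(-1,1,\dots,1)$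 of size $n\times n$. Let $\mathbb E^*(\tau)=\sum_{\delta^*}1(\tau)|\delta^*$, where $\delta^*\in\Gamma(N)$ varies so that $\Gamma_\infty^+\Gamma(N)=\bigcup_{\delta^*}\Gamma_\infty^+\delta^*$ (disjoint). For $\gamma\in Sp_n(\mathbb Z)$ let $$\mathbb E'_\gamma=\sum_\beta\overline\chi(\beta)\,\mathbb E^*|\gamma\beta+\sum_\beta\overline\chi(\gamma_\pm\beta)\,\mathbb E^*|\gamma_\pm\gamma\beta ,$$ where $\beta$ runs over representatives of $\Gamma(N)\backslash\Gamma_0(N)$, let $$\Gamma_\gamma^+=\{\delta\in\Gamma_0(N):\ \Gamma_\infty^+\Gamma(N)\gamma\delta=\Gamma_\infty^+\Gamma(N)\gamma\},$$ and let $\mathbb E_\gamma=\frac{1}{2[\Gamma_\gamma^+:\Gamma(N)]}\,\mathbb E'_\gamma$. Let $\mathcal M_k^{(n)}(N,\chi)$ be the space of holomorphic $f:\mathfrak h_n\to\mathbb C$ with $f((A\tau+B)(C\tau+D)^{-1})=\chi(\det D)\det(C\tau+D)^kf(\tau)$ for all $\begin{pmatrix}A&B\\C&D\end{pmatrix}\in\Gamma_0(N)$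 and, if $n=1$, with $f|\gamma$ bounded as $\operatorname{Im}\tau\to\infty$ for every $\gamma\in SL_2(\mathbb Z)$. Let $\mathrm{Eis}_k^{(n)}(N,\chi)$, the space of Eisenstein series, be the space of those $f\in\mathcal M_k^{(n)}(N,\chi)$ that are linear combinations of the functions $\mathbb E^*|\gamma$, $\gamma\in Sp_n(\mathbb Z)$. A coprime symmetric pair $(M\ N')$ consists of integral $n\times n$ matrices $M,N'$ with $M\,{}^tN'$ symmetric and $(M\ N')$ of rank $n$ modulo every prime. **Proposition 3.1.** The series defining $\mathbb E^*$ converges absolutely at every $\tau\in\mathfrak h_n$, and the following hold. (a) For $\gamma\in Sp_n(\mathbb Z)$, $\mathbb E_\gamma\ne0$ if and only if (1) $\chi(-1)=(-1)^k$, (2) $\chi$ is trivial on $\Gamma_\gamma^+$, and (3) $N>2$ or $k$ is even. (b) Let $\gamma=\begin{pmatrix}A&B\\C&D\end{pmatrix}\in Sp_n(\mathbb Z)$ with $\mathbb E_\gamma\neq0$. Then $$\mathbb E_\gamma(\tau)=\sum_\delta\overline\chi(\delta)\,1(\tau)|\gamma\delta$$ whenever $\delta\in\Gamma_0(N)$ varies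 so that $\Gamma_\infty^+\gamma\Gamma_0(N)=\bigcup_\delta\Gamma_\infty^+\gamma\delta$ (disjoint). Equivalently, $$\mathbb E_\gamma(\tau)=\sum_{(M\ N')}\overline\chi(M,N')\det(M\tau+N')^{-k}$$ whenever $(M\ N')$ are coprime symmetric pairs varying so that $SL_n(\mathbb Z)(C\ D)\Gamma_0(N)=\bigcup_{(M\ N')}SL_n(\mathbb Z)(M\ N')$ (disjoint), where $\chi(M,N')=\chi(\delta)$ for any $\delta\in\Gamma_0(N)$ with $(M\ N')\in SL_n(\mathbb Z)(C\ D)\delta$; this value does not depend on the choice of $\delta$. Both series converge absolutely for every $\tau\in\mathfrak h_n$. (c) For every set of representatives $\{\gamma_\sigma\}$ of $\Gamma_\infty\backslash Sp_n(\mathbb Z)/\Gamma_0(N)$, the nonzero $\mathbb E_{\gamma_\sigma}$ form a basis of $\mathrm{Eis}_k^{(n)}(N,\chi)$. -/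

import Mathlib

open scoped Pointwise Matrix ComplexConjugate

namespace SiegelEis

/-- `Sp_n(ℤ)`: integral `2n × 2n` symplectic matrices. -/
abbrev Sp (n : ℕ) : Type := Matrix.symplecticGroup (Fin n) ℤ

section Blocks

variable {n : ℕ}

/-- The blocks of `γ = (A B; C D)`. -/
def blkA (γ : Sp n) : Matrix (Fin n) (Fin n) ℤ := (γ : Matrix (Fin n ⊕ Fin n) (Fin n ⊕ Fin n) ℤ).toBlocks₁₁

def blkB (γ : Sp n) : Matrix (Fin n) (Fin n) ℤ := (γ : Matrix (Fin n ⊕ Fin n) (Fin n ⊕ Fin n) ℤ).toBlocks₁₂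

def blkC (γ : Sp n) : Matrix (Fin n) (Fin n) ℤ := (γ : Matrix (Fin n ⊕ Fin n) (Fin n ⊕ Fin n) ℤ).toBlocks₂₁

def blkD (γ : Sp n) : Matrix (Fin n) (Fin n) ℤ := (γ : Matrix (Fin n ⊕ Fin n) (Fin n ⊕ Fin n) ℤ).toBlocks₂₂

theorem coe_eq_fromBlocks (γ : Sp n) :
    (γ : Matrix (Fin n ⊕ Fin n) (Fin n ⊕ Fin n) ℤ) =
      Matrix.fromBlocks (blkA γ) (blkB γ) (blkC γ) (blkD γ) :=
  (Matrix.fromBlocks_toBlocks _).symm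

theorem block_relations (γ : Sp n) :
    (blkA γ)ᵀ * blkC γ = (blkC γ)ᵀ * blkA γ ∧ (blkB γ)ᵀ * blkD γ = (blkD γ)ᵀ * blkB γ ∧
      (blkA γ)ᵀ * blkD γ - (blkC γ)ᵀ * blkB γ = 1 := by
  have h := γ.2
  rw [coe_eq_fromBlocks γ] at h
  exact SymplecticGroup.fromBlocks_mem_iff.1 h

theorem coe_mul_eq (γ δ : Sp n) :
    ((γ * δ : Sp n) : Matrix (Fin n ⊕ Fin n) (Fin n ⊕ Fin n) ℤ) =
      Matrix.fromBlocks (blkA γ * blkA δ + blkB γ * blkC δ) (blkA γ * blkB δ + blkB γ * blkD δ)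
        (blkC γ * blkA δ + blkD γ * blkC δ) (blkC γ * blkB δ + blkD γ * blkD δ) := by
  rw [Submonoid.coe_mul, coe_eq_fromBlocks γ, coe_eq_fromBlocks δ, Matrix.fromBlocks_multiply]

theorem coe_inv_eq (γ : Sp n) :
    ((γ⁻¹ : Sp n) : Matrix (Fin n ⊕ Fin n) (Fin n ⊕ Fin n) ℤ) =
      Matrix.fromBlocks (blkD γ)ᵀ (-(blkB γ)ᵀ) (-(blkC γ)ᵀ) (blkA γ)ᵀ := by
  rw [SymplecticGroup.coe_inv, coe_eq_fromBlocks γ]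
  simp [Matrix.J, Matrix.fromBlocks_transpose, Matrix.fromBlocks_multiply, Matrix.fromBlocks_neg]

theorem blkA_mul (γ δ : Sp n) : blkA (γ * δ) = blkA γ * blkA δ + blkB γ * blkC δ := by
  rw [blkA, coe_mul_eq, Matrix.toBlocks_fromBlocks₁₁]

theorem blkC_mul (γ δ : Sp n) : blkC (γ * δ) = blkC γ * blkA δ + blkD γ * blkC δ := by
  rw [blkC, coe_mul_eq, Matrix.toBlocks_fromBlocks₂₁]

theorem blkA_inv (γ : Sp n) : blkA γ⁻¹ = (blkD γ)ᵀ := by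
  rw [blkA, coe_inv_eq, Matrix.toBlocks_fromBlocks₁₁]

theorem blkC_inv (γ : Sp n) : blkC γ⁻¹ = -(blkC γ)ᵀ := by
  rw [blkC, coe_inv_eq, Matrix.toBlocks_fromBlocks₂₁]

theorem blkA_one : blkA (1 : Sp n) = 1 := by
  ext i j
  simp [blkA, Matrix.toBlocks₁₁, Matrix.one_apply]

theorem blkC_one : blkC (1 : Sp n) = 0 := by
  ext i j
  simp [blkC, Matrix.toBlocks₂₁]

end Blocks

section Subgroups

/-- `Γ_∞`: the elements with lower left block `0`. -/
def GammaInf (n : ℕ) : Subgroup (Sp n) where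
  carrier := {γ | blkC γ = 0}
  mul_mem' := by
    intro a b ha hb
    simp only [Set.mem_ofPred_eq] at *
    simp [blkC_mul, ha, hb]
  one_mem' := blkC_one
  inv_mem' := by
    intro a ha
    simp only [Set.mem_ofPred_eq] at *
    simp [blkC_inv, ha]

/-- `Γ_∞⁺`: the elements `(A B; 0 D)` with `det A = 1`. -/
def GammaInfPlus (n : ℕ) : Subgroup (Sp n) where
  carrier := {γ | blkC γ = 0 ∧ (blkA γ).det = 1}
  mul_mem' := by
    rintro a b ⟨ha, ha'⟩ ⟨hb, hb'⟩
    exact ⟨by simp [blkC_mul, ha, hb], by simp [blkA_mul, hb, ha', hb']⟩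
  one_mem' := ⟨blkC_one, by simp [blkA_one]⟩
  inv_mem' := by
    rintro a ⟨ha, ha'⟩
    refine ⟨by simp [blkC_inv, ha], ?_⟩
    have h := congrArg Matrix.det (block_relations a).2.2
    rw [ha] at h
    simpa [blkA_inv, ha'] using h

/-- `Γ(N)`: the elements congruent to the identity modulo `N`. -/
def GammaFull (n N : ℕ) : Subgroup (Sp n) where
  carrier := {γ | (γ : Matrix (Fin n ⊕ Fin n) (Fin n ⊕ Fin n) ℤ).map (Int.castRingHom (ZMod N)) = 1}
  mul_mem' := by
    intro a b ha hb
    simp only [Set.mem_ofPred_eq] at *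
    rw [Submonoid.coe_mul, Matrix.map_mul, ha, hb, one_mul]
  one_mem' := by
    simp only [Set.mem_ofPred_eq, Submonoid.coe_one]
    exact Matrix.map_one _ (map_zero _) (map_one _)
  inv_mem' := by
    intro a ha
    simp only [Set.mem_ofPred_eq] at *
    have h : ((a * a⁻¹ : Sp n) : Matrix (Fin n ⊕ Fin n) (Fin n ⊕ Fin n) ℤ) = 1 := by
      rw [mul_inv_cancel]; rfl
    have h2 := congrArg (fun M => M.map (Int.castRingHom (ZMod N))) h
    simp only [Submonoid.coe_mul, Matrix.map_mul, ha, one_mul] at h2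
    rw [h2]
    exact Matrix.map_one _ (map_zero _) (map_one _)

/-- `Γ_0(N)`: the elements whose lower left block is congruent to `0` modulo `N`. -/
def Gamma0 (n N : ℕ) : Subgroup (Sp n) where
  carrier := {γ | ∀ i j, (N : ℤ) ∣ blkC γ i j}
  mul_mem' := by
    intro a b ha hb i j
    rw [blkC_mul, Matrix.add_apply, Matrix.mul_apply, Matrix.mul_apply]
    exact dvd_add (Finset.dvd_sum fun l _ => Dvd.dvd.mul_right (ha i l) _)
      (Finset.dvd_sum fun l _ => Dvd.dvd.mul_left (hb l j) _)
  one_mem' := by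
    intro i j
    simp [blkC_one]
  inv_mem' := by
    intro a ha i j
    rw [blkC_inv, Matrix.neg_apply, Matrix.transpose_apply]
    exact (dvd_neg).2 (ha j i)

/-- `Γ_γ⁺`: the stabilizer in `Γ_0(N)` of the set `Γ_∞⁺ Γ(N) γ` under right multiplication. -/
def GammaStab {n : ℕ} (N : ℕ) (γ : Sp n) : Subgroup (Sp n) where
  carrier := {δ | δ ∈ Gamma0 n N ∧
    (GammaInfPlus n : Set (Sp n)) * (GammaFull n N : Set (Sp n)) * {γ * δ} =
      (GammaInfPlus n : Set (Sp n)) * (GammaFull n N : Set (Sp n)) * {γ}}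
  mul_mem' := by
    rintro a b ⟨ha, ha'⟩ ⟨hb, hb'⟩
    refine ⟨mul_mem ha hb, ?_⟩
    rw [← hb', ← mul_assoc γ a b, ← Set.singleton_mul_singleton, ← mul_assoc, ha', mul_assoc,
      Set.singleton_mul_singleton]
  one_mem' := ⟨one_mem _, by rw [mul_one]⟩
  inv_mem' := by
    rintro a ⟨ha, ha'⟩
    refine ⟨inv_mem ha, ?_⟩
    have h := congrArg (fun X => X * ({a⁻¹} : Set (Sp n))) ha'
    simp only [mul_assoc, Set.singleton_mul_singleton, mul_inv_cancel, mul_one] at h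
    simp only [mul_assoc]
    exact h.symm

/-- `G_± = diag(-1, 1, …, 1)`. -/
def Gpm (n : ℕ) : Matrix (Fin n) (Fin n) ℤ :=
  Matrix.diagonal fun i => if (i : ℕ) = 0 then -1 else 1

/-- `γ_± = diag(G_±, G_±)`. -/
def gammaPM (n : ℕ) : Sp n :=
  ⟨Matrix.fromBlocks (Gpm n) 0 0 (Gpm n), by
    rw [SymplecticGroup.fromBlocks_mem_iff]
    refine ⟨by simp, by simp, ?_⟩
    rw [Gpm, Matrix.diagonal_transpose, Matrix.diagonal_mul_diagonal]
    simp only [Matrix.mul_zero, sub_zero]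
    rw [← Matrix.diagonal_one]
    congr 1
    funext i
    by_cases h : (i : ℕ) = 0 <;> simp [h]⟩

/-- The character `χ` on `Γ_0(N)`: `χ(A B; C D) = χ(det D)`. -/
noncomputable def chiG {n N : ℕ} (χ : DirichletCharacter ℂ N) (δ : Sp n) : ℂ :=
  χ (((blkD δ).det : ℤ) : ZMod N)

end Subgroups

section UpperHalfSpace

open scoped ComplexOrder

/-- The Siegel upper half-space as a set of matrices: symmetric `τ = X + iY` with `Y > 0`. -/
def siegelSet (n : ℕ) : Set (Matrix (Fin n) (Fin n) ℂ) :=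
  {τ | τ.IsSymm ∧ (τ.map Complex.im).PosDef}

/-- The Siegel upper half-space `𝔥_n`. -/
abbrev SiegelH (n : ℕ) : Type := siegelSet n

variable {n : ℕ}

/-- Complexification of an integral matrix. -/
def toC (M : Matrix (Fin n) (Fin n) ℤ) : Matrix (Fin n) (Fin n) ℂ := M.map (Int.castRingHom ℂ)

/-- `Aτ + B`. -/
def numer (γ : Sp n) (τ : Matrix (Fin n) (Fin n) ℂ) : Matrix (Fin n) (Fin n) ℂ :=
  toC (blkA γ) * τ + toC (blkB γ)

/-- `Cτ + D`. -/
def denom (γ : Sp n) (τ : Matrix (Fin n) (Fin n) ℂ) : Matrix (Fin n) (Fin n) ℂ :=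
  toC (blkC γ) * τ + toC (blkD γ)

theorem toC_mul (M M' : Matrix (Fin n) (Fin n) ℤ) : toC (M * M') = toC M * toC M' :=
  Matrix.map_mul

theorem toC_transpose (M : Matrix (Fin n) (Fin n) ℤ) : toC Mᵀ = (toC M)ᵀ := rfl

theorem toC_conjTranspose (M : Matrix (Fin n) (Fin n) ℤ) : (toC M)ᴴ = (toC M)ᵀ := by
  ext i j
  simp [toC]

theorem toC_relations (γ : Sp n) :
    (toC (blkA γ))ᵀ * toC (blkC γ) = (toC (blkC γ))ᵀ * toC (blkA γ) ∧
    (toC (blkB γ))ᵀ * toC (blkD γ) = (toC (blkD γ))ᵀ * toC (blkB γ) ∧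
    (toC (blkA γ))ᵀ * toC (blkD γ) - (toC (blkC γ))ᵀ * toC (blkB γ) = 1 ∧
    (toC (blkD γ))ᵀ * toC (blkA γ) - (toC (blkB γ))ᵀ * toC (blkC γ) = 1 := by
  obtain ⟨h1, h2, h3⟩ := block_relations γ
  have h3' : (toC (blkA γ))ᵀ * toC (blkD γ) - (toC (blkC γ))ᵀ * toC (blkB γ) = 1 := by
    have := congrArg toC h3
    rw [← toC_transpose, ← toC_transpose, ← toC_mul, ← toC_mul]
    ext i j
    have h4 := congrArg (fun M => M i j) this
    simpa [toC, Matrix.map_apply, Matrix.one_apply, apply_ite] using h4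
  refine ⟨?_, ?_, h3', ?_⟩
  · have := congrArg toC h1
    rwa [toC_mul, toC_mul] at this
  · have := congrArg toC h2
    rwa [toC_mul, toC_mul] at this
  · have := congrArg Matrix.transpose h3'
    simpa [Matrix.transpose_sub, Matrix.transpose_mul] using this

/-- The imaginary part, complexified. -/
theorem sub_conjTranspose_eq {τ : Matrix (Fin n) (Fin n) ℂ} (h : τ.IsSymm) :
    τ - τᴴ = (2 * Complex.I) • (τ.map Complex.im).map Complex.ofReal := by
  ext i j
  have hs : τ j i = τ i j := h.apply i j
  simp only [Matrix.sub_apply, Matrix.conjTranspose_apply, Matrix.smul_apply, Matrix.map_apply, hs,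
    smul_eq_mul]
  apply Complex.ext <;> simp
  ring

theorem posDef_ofReal_iff (Y : Matrix (Fin n) (Fin n) ℝ) :
    (Y.map Complex.ofReal).PosDef ↔ Y.PosDef := by
  rw [Matrix.posDef_iff_dotProduct_mulVec, Matrix.posDef_iff_dotProduct_mulVec]
  constructor
  · rintro ⟨h1, h2⟩
    refine ⟨?_, ?_⟩
    · ext i j
      have := congrArg (fun M => M i j) h1
      simpa using this
    · intro x hx
      have hx' : (fun i => (x i : ℂ)) ≠ 0 := by
        intro h0
        apply hx
        funext i
        simpa using congrFun h0 i
      have := h2 hx'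
      have e : star (fun i => (x i : ℂ)) ⬝ᵥ (Y.map Complex.ofReal *ᵥ fun i => (x i : ℂ)) =
          ((star x ⬝ᵥ (Y *ᵥ x) : ℝ) : ℂ) := by
        simp [dotProduct, Matrix.mulVec]
      rw [e] at this
      exact_mod_cast this
  · rintro ⟨h1, h2⟩
    have hs : ∀ i j, Y j i = Y i j := fun i j => by
      have := congrArg (fun M => M i j) h1
      simpa using this
    refine ⟨?_, ?_⟩
    · ext i j
      simp [hs]
    · intro x hx
      set a : Fin n → ℝ := fun i => (x i).re with ha
      set b : Fin n → ℝ := fun i => (x i).im with hb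
      have e : star x ⬝ᵥ (Y.map Complex.ofReal *ᵥ x) =
          ((a ⬝ᵥ (Y *ᵥ a) + b ⬝ᵥ (Y *ᵥ b) : ℝ) : ℂ) := by
        have hsw : ∑ i, ∑ j, a i * (Y i j * b j) = ∑ i, ∑ j, b i * (Y i j * a j) := by
          rw [Finset.sum_comm]
          refine Finset.sum_congr rfl fun i _ => Finset.sum_congr rfl fun j _ => ?_
          rw [hs i j]; ring
        apply Complex.ext
        · simp only [dotProduct, Matrix.mulVec, Finset.mul_sum, Complex.re_sum, Complex.ofReal_re,
            ← Finset.sum_add_distrib]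
          refine Finset.sum_congr rfl fun i _ => Finset.sum_congr rfl fun j _ => ?_
          simp [ha, hb]
        · simp only [dotProduct, Matrix.mulVec, Finset.mul_sum, Complex.im_sum, Complex.ofReal_im]
          rw [← sub_eq_zero] at hsw
          rw [← hsw]
          simp only [← Finset.sum_sub_distrib]
          refine Finset.sum_congr rfl fun i _ => Finset.sum_congr rfl fun j _ => ?_
          simp [ha, hb]
          ring
      rw [e]
      have hnn : ∀ v : Fin n → ℝ, 0 ≤ v ⬝ᵥ (Y *ᵥ v) := fun v => by
        by_cases hv : v = 0
        · simp [hv]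
        · simpa using (h2 hv).le
      have hpos : 0 < a ⬝ᵥ (Y *ᵥ a) + b ⬝ᵥ (Y *ᵥ b) := by
        by_cases h0 : a = 0
        · have hb0 : b ≠ 0 := by
            intro hb0
            apply hx
            funext i
            exact Complex.ext (congrFun h0 i) (congrFun hb0 i)
          have h3 : 0 < b ⬝ᵥ (Y *ᵥ b) := by simpa using h2 hb0
          linarith [hnn a]
        · have h3 : 0 < a ⬝ᵥ (Y *ᵥ a) := by simpa using h2 h0
          linarith [hnn b]
      exact_mod_cast hpos

theorem symm_identity (γ : Sp n) {τ : Matrix (Fin n) (Fin n) ℂ} (h : τ.IsSymm) :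
    (numer γ τ)ᵀ * denom γ τ = (denom γ τ)ᵀ * numer γ τ := by
  obtain ⟨h1, h2, h3, h4⟩ := toC_relations γ
  have hs : τᵀ = τ := h
  rw [← sub_eq_zero]
  simp only [numer, denom, Matrix.transpose_add, Matrix.transpose_mul, hs]
  set A := toC (blkA γ); set B := toC (blkB γ); set C := toC (blkC γ); set D := toC (blkD γ)
  calc _ = τ * (Aᵀ * C - Cᵀ * A) * τ + τ * (Aᵀ * D - Cᵀ * B) - (Dᵀ * A - Bᵀ * C) * τ
        + (Bᵀ * D - Dᵀ * B) := by noncomm_ring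
    _ = 0 := by rw [h1, h2, h3, h4]; simp

theorem herm_identity (γ : Sp n) {τ : Matrix (Fin n) (Fin n) ℂ} :
    (denom γ τ)ᴴ * numer γ τ - (numer γ τ)ᴴ * denom γ τ = τ - τᴴ := by
  obtain ⟨h1, h2, h3, h4⟩ := toC_relations γ
  simp only [numer, denom, Matrix.conjTranspose_add, Matrix.conjTranspose_mul, toC_conjTranspose]
  set A := toC (blkA γ); set B := toC (blkB γ); set C := toC (blkC γ); set D := toC (blkD γ)
  calc _ = (Dᵀ * A - Bᵀ * C) * τ - τᴴ * (Aᵀ * D - Cᵀ * B) - τᴴ * (Aᵀ * C - Cᵀ * A) * τ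
        - (Bᵀ * D - Dᵀ * B) := by noncomm_ring
    _ = τ - τᴴ := by rw [h1, h2, h3, h4]; simp

theorem denom_isUnit (γ : Sp n) (τ : SiegelH n) : IsUnit (denom γ τ.1) := by
  obtain ⟨τ, hs, hp⟩ := τ
  rw [← Matrix.mulVec_injective_iff_isUnit]
  intro v w hvw
  have h0 : denom γ τ *ᵥ (v - w) = 0 := by
    rw [Matrix.mulVec_sub, sub_eq_zero]; exact hvw
  by_contra hne
  have hne' : v - w ≠ 0 := sub_ne_zero.2 hne
  have hpos := ((posDef_ofReal_iff _).2 hp).dotProduct_mulVec_pos hne'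
  have e := congrArg (fun M => star (v - w) ⬝ᵥ (M *ᵥ (v - w))) (herm_identity γ (τ := τ))
  simp only [sub_conjTranspose_eq hs, Matrix.sub_mulVec, ← Matrix.mulVec_mulVec, h0,
    Matrix.mulVec_zero, sub_zero, Matrix.smul_mulVec, dotProduct_smul] at e
  rw [Matrix.dotProduct_mulVec, ← Matrix.star_mulVec, h0] at e
  simp only [star_zero, zero_dotProduct, smul_eq_mul] at e
  rcases mul_eq_zero.1 e.symm with h | h
  · simp at h
  · exact hpos.ne' h

theorem moebius_mem (γ : Sp n) (τ : SiegelH n) :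
    numer γ τ.1 * (denom γ τ.1)⁻¹ ∈ siegelSet n := by
  have hu := denom_isUnit γ τ
  obtain ⟨τ, hs, hp⟩ := τ
  simp only at *
  set P := numer γ τ with hP
  set Q := denom γ τ with hQ
  have hd : IsUnit Q.det := (Matrix.isUnit_iff_isUnit_det Q).1 hu
  have hdT : IsUnit Qᵀ.det := by rwa [Matrix.det_transpose]
  have hsym : (P * Q⁻¹).IsSymm := by
    have h := symm_identity γ hs
    rw [← hP, ← hQ] at h
    rw [Matrix.IsSymm, Matrix.transpose_mul, Matrix.transpose_nonsing_inv]
    calc Qᵀ⁻¹ * Pᵀ = Qᵀ⁻¹ * (Pᵀ * Q) * Q⁻¹ := by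
          rw [Matrix.mul_assoc, Matrix.mul_assoc, Matrix.mul_nonsing_inv Q hd, Matrix.mul_one]
      _ = P * Q⁻¹ := by
          rw [h, ← Matrix.mul_assoc, Matrix.nonsing_inv_mul Qᵀ hdT, Matrix.one_mul]
  refine ⟨hsym, ?_⟩
  rw [← posDef_ofReal_iff] at hp ⊢
  have h := herm_identity γ (τ := τ)
  rw [← hP, ← hQ] at h
  have e1 : Qᴴ * (P * Q⁻¹ - (P * Q⁻¹)ᴴ) * Q = τ - τᴴ := by
    rw [← h, Matrix.conjTranspose_mul, Matrix.mul_sub, Matrix.sub_mul]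
    congr 1
    · rw [Matrix.mul_assoc, Matrix.mul_assoc, Matrix.nonsing_inv_mul Q hd, Matrix.mul_one]
    · rw [← Matrix.mul_assoc, ← Matrix.conjTranspose_mul, Matrix.nonsing_inv_mul Q hd]
      simp
  rw [sub_conjTranspose_eq hsym, sub_conjTranspose_eq hs, Matrix.mul_smul, Matrix.smul_mul] at e1
  have e2 := smul_right_injective _ (show (2 * Complex.I : ℂ) ≠ 0 by simp) e1
  have e3 : ((P * Q⁻¹).map Complex.im).map Complex.ofReal =
      (Q⁻¹)ᴴ * ((τ.map Complex.im).map Complex.ofReal) * Q⁻¹ := by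
    rw [← e2]
    have hQQ : (Q⁻¹)ᴴ * Qᴴ = 1 := by
      rw [← Matrix.conjTranspose_mul, Matrix.mul_nonsing_inv Q hd, Matrix.conjTranspose_one]
    simp only [Matrix.mul_assoc, Matrix.mul_nonsing_inv Q hd, Matrix.mul_one]
    rw [← Matrix.mul_assoc, hQQ, Matrix.one_mul]
  rw [e3]
  refine hp.conjTranspose_mul_mul_same ?_
  rw [Matrix.mulVec_injective_iff_isUnit]
  exact (Matrix.isUnit_nonsing_inv_iff).2 hu

/-- The action `τ ↦ (Aτ + B)(Cτ + D)⁻¹` on `𝔥_n`. -/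
noncomputable def moebius (γ : Sp n) (τ : SiegelH n) : SiegelH n :=
  ⟨numer γ τ.1 * (denom γ τ.1)⁻¹, moebius_mem γ τ⟩

/-- `(f|γ)(τ) = det(Cτ+D)^{-k} f((Aτ+B)(Cτ+D)⁻¹)`. -/
noncomputable def slash (k : ℕ) (f : SiegelH n → ℂ) (γ : Sp n) : SiegelH n → ℂ :=
  fun τ => (denom γ τ.1).det ^ (-(k : ℤ)) * f (moebius γ τ)

/-- `1(τ)|γ = det(Cτ+D)^{-k}`. -/
noncomputable def oneSlash (k : ℕ) (γ : Sp n) : SiegelH n → ℂ :=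
  slash k (fun _ => 1) γ

end UpperHalfSpace

section ModularForms

/-- Holomorphic in all variables: holomorphic on the space of symmetric complex matrices. The
derivative is taken within `𝔥_n`, an open subset of that space. -/
def IsHolomorphic {n : ℕ} (f : SiegelH n → ℂ) : Prop :=
  ∃ F : (Fin n → Fin n → ℂ) → ℂ,
    DifferentiableOn ℂ F {Z | Matrix.of Z ∈ siegelSet n} ∧
      ∀ τ : SiegelH n, F (Matrix.of.symm τ.1) = f τ

/-- `M_k^{(n)}(N, χ)`: Siegel modular forms of degree `n`, weight `k`, level `N` and character `χ`;
for `n = 1` boundedness at all cusps is required as well. -/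
def modularForms (n N k : ℕ) (χ : DirichletCharacter ℂ N) : Submodule ℂ (SiegelH n → ℂ) where
  carrier := {f | IsHolomorphic f ∧
    (∀ γ ∈ Gamma0 n N, ∀ τ : SiegelH n,
      f (moebius γ τ) = chiG χ γ * (denom γ τ.1).det ^ k * f τ) ∧
    (n = 1 → ∀ γ : Sp n, ∃ b c : ℝ, ∀ τ : SiegelH n,
      (∀ i, b ≤ (τ.1 i i).im) → ‖slash k f γ τ‖ ≤ c)}
  add_mem' := by
    rintro f g ⟨⟨F, hF, hF'⟩, hf2, hf3⟩ ⟨⟨G, hG, hG'⟩, hg2, hg3⟩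
    refine ⟨⟨F + G, hF.add hG, fun τ => by simp [hF', hG']⟩, ?_, ?_⟩
    · intro γ hγ τ
      simp only [Pi.add_apply, hf2 γ hγ τ, hg2 γ hγ τ]
      ring
    · intro h1 γ
      obtain ⟨b, c, h⟩ := hf3 h1 γ
      obtain ⟨b', c', h'⟩ := hg3 h1 γ
      refine ⟨max b b', c + c', fun τ hτ => ?_⟩
      have e : slash k (f + g) γ τ = slash k f γ τ + slash k g γ τ := by
        simp [slash, mul_add]
      rw [e]
      exact (norm_add_le _ _).trans (add_le_add (h τ fun i => (le_max_left _ _).trans (hτ i))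
        (h' τ fun i => (le_max_right _ _).trans (hτ i)))
  zero_mem' := by
    refine ⟨⟨0, differentiableOn_const 0, fun τ => rfl⟩, by simp, ?_⟩
    intro _ γ
    exact ⟨0, 0, fun τ _ => by simp [slash]⟩
  smul_mem' := by
    rintro a f ⟨⟨F, hF, hF'⟩, hf2, hf3⟩
    refine ⟨⟨a • F, hF.const_smul a, fun τ => by simp [hF']⟩, ?_, ?_⟩
    · intro γ hγ τ
      simp only [Pi.smul_apply, hf2 γ hγ τ, smul_eq_mul]
      ring
    · intro h1 γ
      obtain ⟨b, c, h⟩ := hf3 h1 γ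
      refine ⟨b, ‖a‖ * c, fun τ hτ => ?_⟩
      have e : slash k (a • f) γ τ = a * slash k f γ τ := by
        simp only [slash, Pi.smul_apply, smul_eq_mul]
        ring
      rw [e, norm_mul]
      exact mul_le_mul_of_nonneg_left (h τ hτ) (norm_nonneg a)

end ModularForms

section Eisenstein

/-- The cosets over which `δ*` varies: elements of `Γ(N)` modulo left multiplication by
`Γ_∞⁺ ∩ Γ(N)`; representatives are exactly the `δ* ∈ Γ(N)` with
`Γ_∞⁺ Γ(N) = ⋃ Γ_∞⁺ δ*` disjointly. -/
abbrev StarIndex (n N : ℕ) : Type :=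
  Quotient (QuotientGroup.rightRel ((GammaInfPlus n).subgroupOf (GammaFull n N)))

/-- A representative `δ* ∈ Γ(N)` of its coset. -/
noncomputable def starRep {n N : ℕ} (c : StarIndex n N) : Sp n := (c.out : GammaFull n N)

/-- `𝔼*(τ) = ∑_{δ*} 1(τ)|δ*`; the summand depends only on the coset `Γ_∞⁺ δ*`. -/
noncomputable def Estar (n N k : ℕ) : SiegelH n → ℂ :=
  fun τ => ∑' c : StarIndex n N, oneSlash k (starRep c) τ

/-- The (finite) set `Γ(N) \ Γ_0(N)` over which `β` varies. -/
abbrev BetaIndex (n N : ℕ) : Type :=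
  Quotient (QuotientGroup.rightRel ((GammaFull n N).subgroupOf (Gamma0 n N)))

/-- A representative `β ∈ Γ_0(N)` of its coset. -/
noncomputable def betaRep {n N : ℕ} (c : BetaIndex n N) : Sp n := (c.out : Gamma0 n N)

/-- `𝔼'_γ = ∑_β χ̄(β) 𝔼*|γβ + ∑_β χ̄(γ_± β) 𝔼*|γ_± γ β`, where `β` runs over representatives of
`Γ(N) \ Γ_0(N)` (the summands do not depend on the choice of representatives). -/
noncomputable def Eprime {n N : ℕ} (k : ℕ) (χ : DirichletCharacter ℂ N) (γ : Sp n) :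
    SiegelH n → ℂ :=
  fun τ =>
    (∑ᶠ c : BetaIndex n N,
      conj (chiG χ (betaRep c)) * slash k (Estar n N k) (γ * betaRep c) τ) +
    ∑ᶠ c : BetaIndex n N,
      conj (chiG χ (gammaPM n * betaRep c)) *
        slash k (Estar n N k) (gammaPM n * γ * betaRep c) τ

/-- `𝔼_γ = (2 [Γ_γ⁺ : Γ(N)])⁻¹ 𝔼'_γ`. -/
noncomputable def E {n N : ℕ} (k : ℕ) (χ : DirichletCharacter ℂ N) (γ : Sp n) : SiegelH n → ℂ :=
  (2 * ((GammaFull n N).relIndex (GammaStab N γ) : ℂ))⁻¹ • Eprime k χ γ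

/-- `Eis_k^{(n)}(N, χ)`: the modular forms in `M_k^{(n)}(N, χ)` that are linear combinations of the
`Γ(N)`-Eisenstein series `𝔼*|γ`, `γ ∈ Sp_n(ℤ)`. -/
noncomputable def Eis (n N k : ℕ) (χ : DirichletCharacter ℂ N) : Submodule ℂ (SiegelH n → ℂ) :=
  modularForms n N k χ ⊓
    Submodule.span ℂ (Set.range fun γ : Sp n => slash k (Estar n N k) γ)

end Eisenstein

section Representatives

variable {n : ℕ}

/-- `Γ_∞⁺ γ Γ_0(N) = ⋃_{δ ∈ S} Γ_∞⁺ γ δ` (disjoint), with `S ⊆ Γ_0(N)`. -/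
def IsOrbitReps (N : ℕ) (γ : Sp n) (S : Set (Sp n)) : Prop :=
  S ⊆ Gamma0 n N ∧
  DoubleCoset.doubleCoset γ (GammaInfPlus n : Set (Sp n)) (Gamma0 n N : Set (Sp n)) =
    ⋃ δ ∈ S, (GammaInfPlus n : Set (Sp n)) * {γ * δ} ∧
  S.PairwiseDisjoint fun δ => (GammaInfPlus n : Set (Sp n)) * {γ * δ}

/-- A pair `(M N)` of integral `n × n` matrices, as an `n × 2n` matrix. -/
abbrev IntPair (n : ℕ) : Type := Matrix (Fin n) (Fin n ⊕ Fin n) ℤ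

/-- Coprime symmetric pair: `M Nᵀ` is symmetric and `(M N)` has rank `n` modulo every prime. -/
def IsCoprimeSymmetric (p : IntPair n) : Prop :=
  (p.toCols₁ * p.toCols₂ᵀ).IsSymm ∧
    ∀ q : ℕ, q.Prime → (p.map (Int.castRingHom (ZMod q))).rank = n

/-- The bottom rows `(C D)` of `γ`. -/
def lowerPair (γ : Sp n) : IntPair n := Matrix.fromCols (blkC γ) (blkD γ)

/-- `SL_n(ℤ) (M N)`. -/
def slOrbit (p : IntPair n) : Set (IntPair n) :=
  {q | ∃ U : Matrix.SpecialLinearGroup (Fin n) ℤ, q = (U : Matrix (Fin n) (Fin n) ℤ) * p}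

/-- `(M N) = U (C D) δ` for some `U ∈ SL_n(ℤ)`, i.e. `(M N) ∈ SL_n(ℤ) (C D) δ`. -/
def InOrbit (γ δ : Sp n) (p : IntPair n) : Prop :=
  p ∈ slOrbit (lowerPair γ * (δ : Matrix (Fin n ⊕ Fin n) (Fin n ⊕ Fin n) ℤ))

/-- `P` is a set of coprime symmetric pairs with
`SL_n(ℤ) (C D) Γ_0(N) = ⋃_{(M N) ∈ P} SL_n(ℤ) (M N)` (disjoint). -/
def IsPairReps (N : ℕ) (γ : Sp n) (P : Set (IntPair n)) : Prop :=
  (∀ p ∈ P, IsCoprimeSymmetric p) ∧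
  {p | ∃ δ ∈ Gamma0 n N, InOrbit γ δ p} = ⋃ p ∈ P, slOrbit p ∧
  P.PairwiseDisjoint slOrbit

open Classical in
/-- `χ(M, N) = χ(δ)` for some `δ ∈ Γ_0(N)` with `(M N) ∈ SL_n(ℤ) (C D) δ`. -/
noncomputable def chiPair {N : ℕ} (χ : DirichletCharacter ℂ N) (γ : Sp n) (p : IntPair n) : ℂ :=
  if h : ∃ δ ∈ Gamma0 n N, InOrbit γ δ p then chiG χ h.choose else 0

/-- `det(Mτ + N)` for `p = (M N)`. -/
noncomputable def pairDet (p : IntPair n) (τ : SiegelH n) : ℂ :=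
  (toC p.toCols₁ * τ.1 + toC p.toCols₂).det

/-- `R` is a set of representatives for `Γ_∞ \ Sp_n(ℤ) / Γ_0(N)`. -/
def IsDoubleCosetReps (N : ℕ) (R : Set (Sp n)) : Prop :=
  ⋃ γ ∈ R, DoubleCoset.doubleCoset γ (GammaInf n : Set (Sp n)) (Gamma0 n N : Set (Sp n)) =
    Set.univ ∧
  R.PairwiseDisjoint fun γ =>
    DoubleCoset.doubleCoset γ (GammaInf n : Set (Sp n)) (Gamma0 n N : Set (Sp n))

end Representatives

end SiegelEis

/-!
All the series in question are sums `∑ a(x) det(Cτ + D)^{-k}` over the cosets `Γ_∞⁺ x` of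
`Sp_n(ℤ)`, with bounded coefficients `a`. Such sums (`cosetSum`) form a space on which the slash
operator acts by right translation of `a`, and the theorem comes down to their convergence, their
values at the cusps, and the coefficients of `𝔼_γ`.

*Convergence* at the base point `i` is an induction on the degree (`infMajorant_ne_top`). Modulo
`Γ_∞`, every `x ∈ Sp_{m+1}(ℤ)` is either in the image of some `y ∈ Sp_m(ℤ)`, or a product `z y` in
which the block `C` of `z` has rank one (`exists_split`). The automorphy factor of `x` is then at
least that of `y` times `|c τ[q] + d|`, where `τ = diag(i, y i)`, the vector `q` is primitive and
`c`, `d` are integers (`RankOneSplit.norm_jdet_ge`). The sum over `c`, `d` and `q` reduces to a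
lattice sum for the form `Im(y i)` (`tsum_quadForm_le`), and the estimate is uniform in `y`
because the covering radius of the form is bounded independently of `y`
(`exists_int_quadForm_le`). To reach other points, `det(CW + D)` is compared with `det(Cτ + D)`
through the matrix `(Cτ + D)⁻¹ C`, whose entries are bounded in terms of `Im τ` alone
(`norm_zmat_le`). This comparison gives absolute convergence everywhere
(`summable_norm_oneSlash`), holomorphy (`isHolomorphic_cosetSum`), boundedness in degree one
(`exists_norm_cosetSum_le`) and the limit `a(1) + (-1)^k a(γ_±)` at the cusp
(`tendsto_cosetSum_iyPt`).

*Vanishing* rests on one arithmetic fact (`exists_mem_Gamma0_gammaPM`): there is a `δ ∈ Γ_0(N)`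
with `det D ≡ -1` such that `γ_± γ δ ∈ Γ_∞⁺ Γ(N) γ`. After a translation that makes `D` invertible
modulo `N`, the Lagrangian `(C D)` is `D (T 1)` with `T` symmetric, and a reflection of the
quadratic form `T` modulo `N`, lifted to `GL_n(ℤ)`, provides `δ`. Hence the two halves of `𝔼'_γ`
are equal, and both vanish unless `χ(-1) = (-1)^k`; this equation already implies that `N > 2` or
`k` is even. If `χ` is not trivial on `Γ_γ⁺`, the sum over `β` vanishes by orthogonality.

If `χ(-1) = (-1)^k` and `χ` is trivial on `Γ_γ⁺`, the coefficient of `𝔼_γ` at a coset contained in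
`Γ_∞⁺ Γ(N) γ β`, `β ∈ Γ_0(N)`, is `χ̄(β)`, and the other coefficients are `0` (`coeffE_of_mem`).
This is the expansion over the orbit (`hasSum_E`), in terms of group elements or of the bottom
rows `(M N)`. It also shows that `𝔼_γ` takes the value `2` at its own cusp (`cusp_value_self`) and
`0` at the cusps of the other double cosets, whence nonvanishing and linear independence. The
`𝔼_γ` span because a modular form is its own average over `Γ(N) \ Γ_0(N)`, up to a nonzero factor,
and the average of each `𝔼*|g` is a multiple of some `𝔼_γ` (`span_E_eq_Eis`).
-/

namespace SiegelEis

/-! ### Integral matrices -/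

/-- The elementary matrix `1 + e_j ⊗ c`, where `c_j = 0`, as an element of `SL`. -/
def rowAdd {ι : Type*} [Fintype ι] [DecidableEq ι] (j : ι) (c : ι → ℤ) (hc : c j = 0) :
    Matrix.SpecialLinearGroup ι ℤ :=
  ⟨1 + Matrix.vecMulVec (Pi.single j 1) c, by
    rw [Matrix.vecMulVec_eq Unit, Matrix.det_one_add_mul_comm, Matrix.det_unique]
    simp [Matrix.mul_apply, Matrix.add_apply, Pi.single_apply, hc]⟩

theorem vecMul_rowAdd {ι : Type*} [Fintype ι] [DecidableEq ι] (j : ι) (c : ι → ℤ) (hc : c j = 0)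
    (v : ι → ℤ) :
    v ᵥ* (rowAdd j c hc : Matrix ι ι ℤ) = v + v j • c := by
  simp only [rowAdd, Matrix.vecMul_add, Matrix.vecMul_one]
  congr 1
  ext i
  simp [Matrix.vecMul, dotProduct, Matrix.vecMulVec_apply, Pi.single_apply]

theorem vecMul_coe_mul {ι : Type*} [Fintype ι] [DecidableEq ι]
    (U V : Matrix.SpecialLinearGroup ι ℤ) (v : ι → ℤ) :
    v ᵥ* ((U * V : Matrix.SpecialLinearGroup ι ℤ) : Matrix ι ι ℤ) =
      (v ᵥ* (U : Matrix ι ι ℤ)) ᵥ* (V : Matrix ι ι ℤ) := by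
  rw [Matrix.SpecialLinearGroup.coe_mul, Matrix.vecMul_vecMul]

/-- Every integral row vector is carried to a multiple of the first unit vector by `SL`. The
multiple is found as an entry of smallest nonzero absolute value in the `SL`-orbit. -/
theorem exists_SL_vecMul {m : ℕ} (y : Fin (m + 1) → ℤ) :
    ∃ (U : Matrix.SpecialLinearGroup (Fin (m + 1)) ℤ) (g : ℤ),
      y ᵥ* (U : Matrix (Fin (m + 1)) (Fin (m + 1)) ℤ) = Pi.single 0 g := by
  classical
  by_cases hy : y = 0
  · exact ⟨1, 0, by simp [hy]⟩
  have hex : ∃ k : ℕ, k ≠ 0 ∧ ∃ (U : Matrix.SpecialLinearGroup (Fin (m + 1)) ℤ) (j : Fin (m + 1)),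
      ((y ᵥ* (U : Matrix (Fin (m + 1)) (Fin (m + 1)) ℤ)) j).natAbs = k := by
    obtain ⟨j, hj⟩ := Function.ne_iff.1 hy
    exact ⟨(y j).natAbs, by simpa using hj, 1, j, by simp⟩
  obtain ⟨h0, U, j, hU⟩ := Nat.find_spec hex
  set v := y ᵥ* (U : Matrix (Fin (m + 1)) (Fin (m + 1)) ℤ) with hv
  have hvj : v j ≠ 0 := by
    intro h; rw [h] at hU; exact h0 (by simpa using hU.symm)
  have hdvd : ∀ l, v j ∣ v l := by
    intro l
    by_cases hl : l = j
    · rw [hl]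
    by_contra hnd
    have hc : (Pi.single l (-(v l / v j)) : Fin (m + 1) → ℤ) j = 0 := by
      simp [Ne.symm hl]
    have hr : (y ᵥ* ((U * rowAdd j _ hc : Matrix.SpecialLinearGroup _ ℤ) :
        Matrix (Fin (m + 1)) (Fin (m + 1)) ℤ)) l =
        v l % v j := by
      rw [vecMul_coe_mul, ← hv, vecMul_rowAdd]
      simp [Int.emod_def]
      ring
    have hlt : (v l % v j).natAbs < Nat.find hex := by
      rw [← hU]
      have h1 := Int.emod_lt_abs (v l) hvj
      have h2 := Int.emod_nonneg (v l) hvj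
      generalize v l % v j = r at h1 h2
      rw [abs_eq_max_neg] at h1
      omega
    refine Nat.find_min hex hlt ⟨?_, _, l, by rw [hr]⟩
    intro h
    exact hnd (Int.dvd_of_emod_eq_zero (by simpa using h))
  choose d hd using hdvd
  let c : Fin (m + 1) → ℤ := fun l => if l = j then 0 else -d l
  have hc : c j = 0 := by simp [c]
  have h1 : v ᵥ* (rowAdd j c hc : Matrix (Fin (m + 1)) (Fin (m + 1)) ℤ) = Pi.single j (v j) := by
    rw [vecMul_rowAdd]
    ext l
    by_cases hl : l = j
    · rw [hl]; simp [hc]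
    · have := hd l
      simp only [Pi.add_apply, Pi.smul_apply, smul_eq_mul, Pi.single_eq_of_ne hl, c, if_neg hl]
      linarith
  by_cases hj : j = 0
  · refine ⟨U * rowAdd j c hc, v j, ?_⟩
    rw [vecMul_coe_mul, ← hv, h1, hj]
  · have hc1 : (Pi.single 0 1 : Fin (m + 1) → ℤ) j = 0 := by simp [hj]
    have hc2 : (Pi.single j (-1) : Fin (m + 1) → ℤ) 0 = 0 := by simp [Ne.symm hj]
    refine ⟨U * rowAdd j c hc * rowAdd j _ hc1 * rowAdd 0 _ hc2, v j, ?_⟩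
    rw [vecMul_coe_mul, vecMul_coe_mul, vecMul_coe_mul, ← hv, h1, vecMul_rowAdd, vecMul_rowAdd]
    ext l
    by_cases hl : l = j
    · subst hl; simp [hj, Ne.symm hj]
    · by_cases hl0 : l = 0
      · subst hl0; simp [hl]
      · simp [hl, hl0]

theorem exists_SL_mulVec {m : ℕ} (y : Fin (m + 1) → ℤ) :
    ∃ (U : Matrix.SpecialLinearGroup (Fin (m + 1)) ℤ) (g : ℤ),
      (U : Matrix (Fin (m + 1)) (Fin (m + 1)) ℤ) *ᵥ y = Pi.single 0 g := by
  obtain ⟨U, g, h⟩ := exists_SL_vecMul y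
  refine ⟨U.transpose, g, ?_⟩
  rw [← h, Matrix.SpecialLinearGroup.coe_transpose, Matrix.mulVec_transpose]

/-- Reduction of integral matrices modulo `N`. -/
abbrev redMat {ι : Type*} [Fintype ι] [DecidableEq ι] (N : ℕ) :
    Matrix ι ι ℤ →+* Matrix ι ι (ZMod N) :=
  (Int.castRingHom (ZMod N)).mapMatrix

theorem redMat_apply {ι : Type*} [Fintype ι] [DecidableEq ι] (N : ℕ) (M : Matrix ι ι ℤ) (i j : ι) :
    redMat N M i j = (M i j : ZMod N) := rfl

theorem redMat_transpose {ι : Type*} [Fintype ι] [DecidableEq ι] (N : ℕ) (M : Matrix ι ι ℤ) :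
    redMat N Mᵀ = (redMat N M)ᵀ := rfl

theorem det_redMat {ι : Type*} [Fintype ι] [DecidableEq ι] (N : ℕ) (M : Matrix ι ι ℤ) :
    (redMat N M).det = ((M.det : ℤ) : ZMod N) :=
  ((Int.castRingHom (ZMod N)).map_det M).symm

theorem rowAdd_mulVec {ι : Type*} [Fintype ι] [DecidableEq ι] (j : ι) (c : ι → ℤ) (hc : c j = 0)
    (v : ι → ℤ) :
    (rowAdd j c hc : Matrix ι ι ℤ) *ᵥ v = v + Pi.single j (c ⬝ᵥ v) := by
  simp only [rowAdd, Matrix.add_mulVec, Matrix.one_mulVec]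
  congr 1
  ext i
  by_cases h : i = j
  · subst h; simp [Matrix.mulVec, dotProduct, Matrix.vecMulVec_apply]
  · simp [Matrix.mulVec, dotProduct, Matrix.vecMulVec_apply, h]

theorem det_of_column_zero {R : Type*} [CommRing R] {m : ℕ}
    (M : Matrix (Fin (m + 1)) (Fin (m + 1)) R) (h : ∀ i : Fin m, M i.succ 0 = 0) :
    M.det = M 0 0 * (M.submatrix Fin.succ Fin.succ).det := by
  rw [Matrix.det_succ_column_zero, Fin.sum_univ_succ]
  simp [h, Fin.succAbove_zero]

/-- `SL_n(ℤ) → SL_n(ℤ/N)` is surjective. -/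
theorem exists_SL_lift (N : ℕ) : ∀ (n : ℕ) (M : Matrix (Fin n) (Fin n) ℤ),
    ((M.det : ℤ) : ZMod N) = 1 →
    ∃ W : Matrix.SpecialLinearGroup (Fin n) ℤ, redMat N (W : Matrix _ _ ℤ) = redMat N M
  | 0, M, _ => ⟨1, by ext i; exact i.elim0⟩
  | 1, M, h => ⟨1, by
      ext i j
      rw [Subsingleton.elim i 0, Subsingleton.elim j 0]
      rw [Matrix.det_unique] at h
      simpa [redMat_apply] using h.symm⟩
  | m + 2, M, h => by
      obtain ⟨U, g, hU⟩ := exists_SL_mulVec (fun i => M i 0)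
      have hcol : ∀ P : Matrix (Fin (m + 2)) (Fin (m + 2)) ℤ, ∀ i,
          (P * M) i 0 = (P *ᵥ fun i => M i 0) i := fun P i => rfl
      have hg : ∃ s : ℤ, ((s * g : ℤ) : ZMod N) = 1 := by
        have h1 : ((U : Matrix (Fin (m + 2)) (Fin (m + 2)) ℤ) * M).det =
            g * (((U : Matrix (Fin (m + 2)) (Fin (m + 2)) ℤ) * M).submatrix
              Fin.succ Fin.succ).det := by
          rw [det_of_column_zero _ (fun i => by rw [hcol, hU]; simp), hcol, hU]; simp
        rw [Matrix.det_mul, Matrix.SpecialLinearGroup.det_coe, one_mul] at h1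
        refine ⟨(((U : Matrix (Fin (m + 2)) (Fin (m + 2)) ℤ) *
          M).submatrix Fin.succ Fin.succ).det, ?_⟩
        rw [mul_comm, ← h1, h]
      obtain ⟨s, hs⟩ := hg
      have h10 : (1 : Fin (m + 2)) ≠ 0 := by simp
      -- Elementary operations on the first two rows turn `(g, 0)` into `(1, 0)` modulo `N`.
      let P : Matrix.SpecialLinearGroup (Fin (m + 2)) ℤ :=
        rowAdd 1 (Pi.single 0 (-1)) (by simp) * rowAdd 0 (Pi.single 1 (1 - g)) (by simp) *
          rowAdd 1 (Pi.single 0 s) (by simp) * U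
      have hP : (P : Matrix (Fin (m + 2)) (Fin (m + 2)) ℤ) *ᵥ (fun i => M i 0) =
          Pi.single 0 (g + (1 - g) * (s * g)) + Pi.single 1 (s * g - (g + (1 - g) * (s * g))) := by
        simp only [P, Matrix.SpecialLinearGroup.coe_mul, ← Matrix.mulVec_mulVec, hU, rowAdd_mulVec]
        simp only [single_dotProduct, Pi.add_apply, Pi.single_eq_same, Pi.single_eq_of_ne h10,
          Pi.single_eq_of_ne h10.symm]
        ext i
        by_cases h0 : i = 0
        · subst h0; simp
        · by_cases h1 : i = 1
          · subst h1; simp; ring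
          · simp [h0, h1]
      set M2 := (P : Matrix (Fin (m + 2)) (Fin (m + 2)) ℤ) * M with hM2
      have hs' : (s : ZMod N) * g = 1 := by exact_mod_cast hs
      have hc0 : (M2 0 0 : ZMod N) = 1 := by
        rw [hM2, hcol, hP]; simp [hs']
      have hci : ∀ i : Fin (m + 1), (M2 i.succ 0 : ZMod N) = 0 := by
        intro i
        rw [hM2, hcol, hP]
        by_cases h1 : i.succ = 1
        · rw [h1]; simp [hs']
        · simp [h1, Fin.succ_ne_zero]
      have hdet : (((M2.submatrix Fin.succ Fin.succ).det : ℤ) : ZMod N) = 1 := by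
        have h2 : ((M2.det : ℤ) : ZMod N) = 1 := by
          rw [hM2, Matrix.det_mul, Matrix.SpecialLinearGroup.det_coe, one_mul, h]
        rw [← det_redMat, det_of_column_zero _ (fun i => hci i), redMat_apply, hc0, one_mul] at h2
        rw [← det_redMat]
        exact h2
      obtain ⟨W', hW'⟩ := exists_SL_lift N (m + 1) _ hdet
      let W2 : Matrix (Fin (m + 2)) (Fin (m + 2)) ℤ := Matrix.of
        (Fin.cons (Fin.cons 1 fun j => M2 0 j.succ) fun i => Fin.cons 0 fun j => W' i j)
      have hW2 : W2.det = 1 := by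
        rw [det_of_column_zero _ (fun i => by simp [W2])]
        have : W2.submatrix Fin.succ Fin.succ = W' := by ext i j; simp [W2]
        rw [this]; simp [W2]
      have hW2M : redMat N W2 = redMat N M2 := by
        ext i j
        refine Fin.cases ?_ (fun i => ?_) i
        · refine Fin.cases ?_ (fun j => ?_) j
          · simp [redMat_apply, W2, hc0]
          · simp [redMat_apply, W2]
        · refine Fin.cases ?_ (fun j => ?_) j
          · simp [redMat_apply, W2, hci]
          · have := congrArg (fun X => X i j) hW'
            simpa [redMat_apply, W2] using this
      let W3 : Matrix.SpecialLinearGroup (Fin (m + 2)) ℤ := ⟨W2, hW2⟩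
      refine ⟨P⁻¹ * W3, ?_⟩
      have e : M = ((P⁻¹ : Matrix.SpecialLinearGroup _ ℤ) : Matrix _ _ ℤ) * M2 := by
        rw [hM2, ← Matrix.mul_assoc, ← Matrix.SpecialLinearGroup.coe_mul, inv_mul_cancel]; simp
      conv_rhs => rw [e]
      rw [Matrix.SpecialLinearGroup.coe_mul, map_mul, map_mul, ← hW2M]


/-! ### Blocks of symplectic matrices and the group `Γ_∞` -/

section SymplecticBlocks

variable {n : ℕ}

theorem blkB_mul (γ δ : Sp n) : blkB (γ * δ) = blkA γ * blkB δ + blkB γ * blkD δ := by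
  rw [blkB, coe_mul_eq, Matrix.toBlocks_fromBlocks₁₂]

theorem blkD_mul (γ δ : Sp n) : blkD (γ * δ) = blkC γ * blkB δ + blkD γ * blkD δ := by
  rw [blkD, coe_mul_eq, Matrix.toBlocks_fromBlocks₂₂]

theorem blkB_inv (γ : Sp n) : blkB γ⁻¹ = -(blkB γ)ᵀ := by
  rw [blkB, coe_inv_eq, Matrix.toBlocks_fromBlocks₁₂]

theorem blkD_inv (γ : Sp n) : blkD γ⁻¹ = (blkA γ)ᵀ := by
  rw [blkD, coe_inv_eq, Matrix.toBlocks_fromBlocks₂₂]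

theorem blkB_one : blkB (1 : Sp n) = 0 := by
  ext i j
  simp [blkB, Matrix.toBlocks₁₂]

theorem blkD_one : blkD (1 : Sp n) = 1 := by
  ext i j
  simp [blkD, Matrix.toBlocks₂₂, Matrix.one_apply]

theorem sp_ext {γ δ : Sp n} (hA : blkA γ = blkA δ) (hB : blkB γ = blkB δ) (hC : blkC γ = blkC δ)
    (hD : blkD γ = blkD δ) : γ = δ := by
  apply Subtype.ext
  rw [coe_eq_fromBlocks γ, coe_eq_fromBlocks δ, hA, hB, hC, hD]

/-- The row relations of a symplectic matrix, dual to the column relations `block_relations`. -/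
theorem row_relations (γ : Sp n) :
    blkC γ * (blkD γ)ᵀ = blkD γ * (blkC γ)ᵀ ∧ blkD γ * (blkA γ)ᵀ - blkC γ * (blkB γ)ᵀ = 1 := by
  constructor
  · have h := blkC_mul γ γ⁻¹
    rw [mul_inv_cancel, blkC_one, blkA_inv, blkC_inv, Matrix.mul_neg] at h
    exact (sub_eq_zero.1 (by rw [sub_eq_add_neg]; exact h.symm))
  · have h := blkD_mul γ γ⁻¹
    rw [mul_inv_cancel, blkD_one, blkB_inv, blkD_inv, Matrix.mul_neg] at h
    rw [h]; abel

/-- The symplectic matrix with given blocks. -/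
def mkSp (A B C D : Matrix (Fin n) (Fin n) ℤ) (h1 : Aᵀ * C = Cᵀ * A) (h2 : Bᵀ * D = Dᵀ * B)
    (h3 : Aᵀ * D - Cᵀ * B = 1) : Sp n :=
  ⟨Matrix.fromBlocks A B C D, SymplecticGroup.fromBlocks_mem_iff.2 ⟨h1, h2, h3⟩⟩

/-- The Levi element `diag(ᵗW', W)` of `Γ_∞`, where `W'` is the inverse of `W`. -/
def levi (W W' : Matrix (Fin n) (Fin n) ℤ) (h : W' * W = 1) : Sp n :=
  mkSp W'ᵀ 0 0 W (by simp) (by simp) (by simpa using h)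

/-- The unipotent element `(1 S; 0 1)` of `Γ_∞`. -/
def unip (S : Matrix (Fin n) (Fin n) ℤ) (h : S.IsSymm) : Sp n :=
  mkSp 1 S 0 1 (by simp) (by simpa using h.eq) (by simp)

@[simp] theorem blkA_mkSp (A B C D : Matrix (Fin n) (Fin n) ℤ) (h1 h2 h3) :
    blkA (mkSp A B C D h1 h2 h3) = A := rfl
@[simp] theorem blkB_mkSp (A B C D : Matrix (Fin n) (Fin n) ℤ) (h1 h2 h3) :
    blkB (mkSp A B C D h1 h2 h3) = B := rfl
@[simp] theorem blkC_mkSp (A B C D : Matrix (Fin n) (Fin n) ℤ) (h1 h2 h3) :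
    blkC (mkSp A B C D h1 h2 h3) = C := rfl
@[simp] theorem blkD_mkSp (A B C D : Matrix (Fin n) (Fin n) ℤ) (h1 h2 h3) :
    blkD (mkSp A B C D h1 h2 h3) = D := rfl

theorem blkA_gammaPM : blkA (gammaPM n) = Gpm n := rfl
theorem blkB_gammaPM : blkB (gammaPM n) = 0 := rfl
theorem blkC_gammaPM : blkC (gammaPM n) = 0 := rfl
theorem blkD_gammaPM : blkD (gammaPM n) = Gpm n := rfl

theorem Gpm_mul_self : Gpm n * Gpm n = 1 := by
  rw [Gpm, Matrix.diagonal_mul_diagonal, ← Matrix.diagonal_one]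
  congr 1
  funext i
  by_cases h : (i : ℕ) = 0 <;> simp [h]

theorem det_Gpm (hn : 0 < n) : (Gpm n).det = -1 := by
  obtain ⟨m, rfl⟩ := Nat.exists_eq_succ_of_ne_zero hn.ne'
  rw [Gpm, Matrix.det_diagonal, Fin.prod_univ_succ]
  simp

theorem gammaPM_mul_self : gammaPM n * gammaPM n = 1 := by
  apply sp_ext <;>
    simp [blkA_mul, blkB_mul, blkC_mul, blkD_mul, blkA_gammaPM, blkB_gammaPM, blkC_gammaPM,
      blkD_gammaPM, Gpm_mul_self, blkA_one, blkB_one, blkC_one, blkD_one]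

theorem gammaPM_inv : (gammaPM n)⁻¹ = gammaPM n :=
  inv_eq_of_mul_eq_one_right gammaPM_mul_self

theorem gammaPM_mem_GammaInf : gammaPM n ∈ GammaInf n := blkC_gammaPM

theorem mem_GammaInf {γ : Sp n} : γ ∈ GammaInf n ↔ blkC γ = 0 := Iff.rfl

theorem mem_GammaInfPlus {γ : Sp n} : γ ∈ GammaInfPlus n ↔ blkC γ = 0 ∧ (blkA γ).det = 1 := Iff.rfl

theorem det_mul_det_of_mem {γ : Sp n} (h : γ ∈ GammaInf n) : (blkA γ).det * (blkD γ).det = 1 := by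
  have h' := (block_relations γ).2.2
  rw [mem_GammaInf.1 h] at h'
  have := congrArg Matrix.det h'
  simpa using this

theorem mem_GammaInfPlus' {γ : Sp n} : γ ∈ GammaInfPlus n ↔ blkC γ = 0 ∧ (blkD γ).det = 1 := by
  rw [mem_GammaInfPlus]
  constructor
  · rintro ⟨h, h'⟩
    have := det_mul_det_of_mem (γ := γ) h
    exact ⟨h, by simpa [h'] using this⟩
  · rintro ⟨h, h'⟩
    have := det_mul_det_of_mem (γ := γ) h
    exact ⟨h, by simpa [h'] using this⟩

theorem det_blkD_of_mem {γ : Sp n} (h : γ ∈ GammaInf n) :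
    (blkD γ).det = 1 ∨ (blkD γ).det = -1 :=
  Int.isUnit_iff.1 (IsUnit.of_mul_eq_one_right _ (det_mul_det_of_mem h))

theorem GammaInfPlus_le : GammaInfPlus n ≤ GammaInf n := fun _ h => h.1

/-- `Γ_∞ = Γ_∞⁺ ∪ γ_± Γ_∞⁺`. -/
theorem mem_GammaInf_cases (hn : 0 < n) {γ : Sp n} (h : γ ∈ GammaInf n) :
    γ ∈ GammaInfPlus n ∨ gammaPM n * γ ∈ GammaInfPlus n := by
  rcases det_blkD_of_mem h with h1 | h1
  · exact Or.inl (mem_GammaInfPlus'.2 ⟨h, h1⟩)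
  · refine Or.inr (mem_GammaInfPlus'.2 ⟨mul_mem gammaPM_mem_GammaInf h, ?_⟩)
    rw [blkD_mul, blkC_gammaPM, blkD_gammaPM, Matrix.zero_mul, zero_add, Matrix.det_mul, h1,
      det_Gpm hn]
    rfl

theorem gammaPM_notMem (hn : 0 < n) : gammaPM n ∉ GammaInfPlus n := by
  rintro ⟨-, h⟩
  rw [blkA_gammaPM, det_Gpm hn] at h
  norm_num at h

/-- `Γ_∞⁺` is normalized by `Γ_∞`. -/
theorem conj_mem_GammaInfPlus {g p : Sp n} (hg : g ∈ GammaInf n) (hp : p ∈ GammaInfPlus n) :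
    g * p * g⁻¹ ∈ GammaInfPlus n := by
  have hg' := inv_mem hg
  have e1 := mem_GammaInf.1 hg
  have e2 := mem_GammaInf.1 hg'
  refine mem_GammaInfPlus'.2 ⟨mul_mem (mul_mem hg (GammaInfPlus_le hp)) hg', ?_⟩
  have h := det_mul_det_of_mem hg
  rw [blkD_mul, blkD_mul, blkC_mul, e1, (mem_GammaInfPlus'.1 hp).1, blkD_inv]
  simp [(mem_GammaInfPlus'.1 hp).2]
  linarith

end SymplecticBlocks

/-! ### Congruence subgroups and `Γ_∞⁺ Γ(N)` -/

section Congruence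

variable {n N : ℕ}

theorem mem_GammaFull_iff {γ : Sp n} :
    γ ∈ GammaFull n N ↔ redMat N (blkA γ) = 1 ∧ redMat N (blkB γ) = 0 ∧ redMat N (blkC γ) = 0 ∧
      redMat N (blkD γ) = 1 := by
  have : γ ∈ GammaFull n N ↔ (γ : Matrix (Fin n ⊕ Fin n) (Fin n ⊕ Fin n) ℤ).map
      (Int.castRingHom (ZMod N)) = 1 := Iff.rfl
  rw [this, coe_eq_fromBlocks, Matrix.fromBlocks_map, ← Matrix.fromBlocks_one,
    Matrix.fromBlocks_inj]
  rfl

theorem mem_Gamma0_iff {γ : Sp n} : γ ∈ Gamma0 n N ↔ redMat N (blkC γ) = 0 := by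
  have : γ ∈ Gamma0 n N ↔ ∀ i j, (N : ℤ) ∣ blkC γ i j := Iff.rfl
  rw [this, ← Matrix.ext_iff]
  simp only [redMat_apply, Matrix.zero_apply, ZMod.intCast_zmod_eq_zero_iff_dvd]

theorem GammaFull_le_Gamma0 : GammaFull n N ≤ Gamma0 n N := fun _ h =>
  mem_Gamma0_iff.2 (mem_GammaFull_iff.1 h).2.2.1

theorem GammaInf_le_Gamma0 : GammaInf n ≤ Gamma0 n N := fun _ h =>
  mem_Gamma0_iff.2 (by rw [mem_GammaInf.1 h, map_zero])

theorem gammaPM_mem_Gamma0 : gammaPM n ∈ Gamma0 n N := GammaInf_le_Gamma0 gammaPM_mem_GammaInf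

instance GammaFull_normal : (GammaFull n N).Normal where
  conj_mem := by
    intro a ha g
    have ha' : redMat N (a : Matrix (Fin n ⊕ Fin n) (Fin n ⊕ Fin n) ℤ) = 1 := ha
    change redMat N ((g * a * g⁻¹ : Sp n) : Matrix (Fin n ⊕ Fin n) (Fin n ⊕ Fin n) ℤ) = 1
    rw [Submonoid.coe_mul, Submonoid.coe_mul, map_mul, map_mul, ha', mul_one, ← map_mul,
      ← Submonoid.coe_mul, mul_inv_cancel]
    exact map_one _

/-- The group `Γ_∞⁺ Γ(N)`. -/
def KGrp (n N : ℕ) : Subgroup (Sp n) := GammaInfPlus n ⊔ GammaFull n N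

theorem coe_KGrp : (KGrp n N : Set (Sp n)) =
    (GammaInfPlus n : Set (Sp n)) * (GammaFull n N : Set (Sp n)) :=
  Subgroup.mul_normal _ _

theorem mem_KGrp {γ : Sp n} :
    γ ∈ KGrp n N ↔ ∃ p ∈ GammaInfPlus n, ∃ ν ∈ GammaFull n N, p * ν = γ := by
  rw [← SetLike.mem_coe, coe_KGrp, Set.mem_mul]
  rfl

theorem GammaInfPlus_le_KGrp : GammaInfPlus n ≤ KGrp n N := le_sup_left

theorem GammaFull_le_KGrp : GammaFull n N ≤ KGrp n N := le_sup_right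

theorem conj_mem_KGrp {g κ : Sp n} (hg : g ∈ GammaInf n) (hκ : κ ∈ KGrp n N) :
    g * κ * g⁻¹ ∈ KGrp n N := by
  obtain ⟨p, hp, ν, hν, rfl⟩ := mem_KGrp.1 hκ
  refine mem_KGrp.2 ⟨_, conj_mem_GammaInfPlus hg hp, _, GammaFull_normal.conj_mem ν hν g, ?_⟩
  group

theorem mul_mem_conj_KGrp {g κ : Sp n} (hg : g ∈ GammaInf n) :
    g * κ * g⁻¹ ∈ KGrp n N ↔ κ ∈ KGrp n N := by
  refine ⟨fun h => ?_, conj_mem_KGrp hg⟩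
  have := conj_mem_KGrp (inv_mem hg) h
  simpa [mul_assoc] using this

/-- The symmetric matrix with the same upper triangle as `S`. -/
def symmetrize {R ι : Type*} [LinearOrder ι] (S : Matrix ι ι R) : Matrix ι ι R :=
  Matrix.of fun i j => S (min i j) (max i j)

theorem symmetrize_isSymm {R ι : Type*} [LinearOrder ι] (S : Matrix ι ι R) :
    (symmetrize S).IsSymm := by
  ext i j
  simp [symmetrize, min_comm, max_comm]

theorem symmetrize_eq {R ι : Type*} [LinearOrder ι] {S : Matrix ι ι R} (h : S.IsSymm) :
    symmetrize S = S := by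
  ext i j
  rcases le_total i j with hij | hij
  · simp [symmetrize, hij]
  · simpa [symmetrize, hij] using h.apply i j

/-- By the surjectivity of `SL_n(ℤ) → SL_n(ℤ/N)`, an element of `Γ_0(N)` with `det D ≡ 1 mod N`
lies in `Γ_∞⁺ Γ(N)`. -/
theorem mem_KGrp_of_det {h : Sp n} (h0 : h ∈ Gamma0 n N)
    (hd : (((blkD h).det : ℤ) : ZMod N) = 1) : h ∈ KGrp n N := by
  obtain ⟨W, hW⟩ := exists_SL_lift N n _ hd
  have hWi : ((W⁻¹ : Matrix.SpecialLinearGroup (Fin n) ℤ) : Matrix (Fin n) (Fin n) ℤ) * W = 1 := by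
    rw [← Matrix.SpecialLinearGroup.coe_mul, inv_mul_cancel]; simp
  set W' : Matrix (Fin n) (Fin n) ℤ := ((W⁻¹ : Matrix.SpecialLinearGroup (Fin n) ℤ) :
    Matrix (Fin n) (Fin n) ℤ) with hW'
  set L := levi (W : Matrix (Fin n) (Fin n) ℤ) W' hWi with hL
  have hLm : L ∈ GammaInfPlus n := mem_GammaInfPlus'.2 ⟨rfl, W.det_coe⟩
  obtain ⟨g, hg⟩ : ∃ g, g = L⁻¹ * h := ⟨_, rfl⟩
  have hgC : redMat N (blkC g) = 0 := mem_Gamma0_iff.1 (hg ▸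
    mul_mem (inv_mem (GammaInf_le_Gamma0 (GammaInfPlus_le hLm))) h0)
  have hgD : redMat N (blkD g) = 1 := by
    have : blkD g = W' * blkD h := by
      rw [hg, blkD_mul, blkD_inv, blkC_inv]; simp [hL, levi]
    rw [this, map_mul, ← hW, ← map_mul, hWi, map_one]
  obtain ⟨-, hr2, hr3⟩ := block_relations g
  have hgA : redMat N (blkA g) = 1 := by
    have := congrArg (redMat N) hr3
    simp only [map_sub, map_mul, redMat_transpose, hgC, hgD, map_one, mul_one,
      Matrix.transpose_zero, zero_mul, sub_zero] at this
    simpa using congrArg Matrix.transpose this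
  have hgB : (redMat N (blkB g)).IsSymm := by
    have := congrArg (redMat N) hr2
    simp only [map_mul, redMat_transpose, hgD, mul_one, Matrix.transpose_one, one_mul] at this
    exact this
  set S := symmetrize (blkB g) with hS
  have hSB : redMat N S = redMat N (blkB g) := by
    rw [← symmetrize_eq hgB]; rfl
  set u := unip S (symmetrize_isSymm _) with hu
  have hum : u ∈ GammaInfPlus n := mem_GammaInfPlus'.2 ⟨rfl, Matrix.det_one⟩
  have hfin : u⁻¹ * g ∈ GammaFull n N := by
    have hSs : Sᵀ = S := symmetrize_isSymm _
    simp only [mem_GammaFull_iff, blkA_mul, blkB_mul, blkC_mul, blkD_mul, blkA_inv, blkB_inv,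
      blkC_inv, blkD_inv]
    simp [hu, unip, hgA, hgC, hgD, hSs, hSB, -RingHom.mapMatrix_apply]
  refine mem_KGrp.2 ⟨L * u, mul_mem hLm hum, _, hfin, ?_⟩
  rw [hg]; group

end Congruence


/-! ### Lagrangians modulo `N` in general position -/

section LocalGlobal

/-- A function that respects congruences and takes a value prime to `p` for every prime `p ∣ N`
takes a value prime to `N`. -/
theorem exists_isCoprime_value {α : Type*} [AddCommGroup α] (f : α → ℤ)
    (hf : ∀ (p : ℕ) (x y : α), (p : ℤ) ∣ f (x + (p : ℤ) • y) - f x) {N : ℕ} (hN : 0 < N)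
    (h : ∀ p : ℕ, p.Prime → p ∣ N → ∃ x, ¬ (p : ℤ) ∣ f x) : ∃ x, IsCoprime (f x) N := by
  have key : ∀ s : Finset ℕ, (∀ p ∈ s, p.Prime ∧ p ∣ N) → ∃ x, ∀ p ∈ s, ¬ (p : ℤ) ∣ f x := by
    intro s
    induction s using Finset.induction_on with
    | empty => exact fun _ => ⟨0, by simp⟩
    | insert p s hps ih =>
      intro hs
      obtain ⟨x, hx⟩ := ih fun q hq => hs q (Finset.mem_insert_of_mem hq)
      have hp := hs p (Finset.mem_insert_self _ _)
      obtain ⟨z, hz⟩ := h p hp.1 hp.2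
      have hcop : IsCoprime (((∏ q ∈ s, q : ℕ) : ℤ)) (p : ℤ) := by
        rw [Nat.isCoprime_iff_coprime]
        refine Nat.Coprime.prod_left fun q hq => ?_
        refine (Nat.coprime_primes (hs q (Finset.mem_insert_of_mem hq)).1 hp.1).2 ?_
        rintro rfl
        exact hps hq
      obtain ⟨a, b, hab⟩ := hcop
      refine ⟨x + (a * ((∏ q ∈ s, q : ℕ) : ℤ)) • (z - x), fun q hq => ?_⟩
      rcases Finset.mem_insert.1 hq with rfl | hq
      · have e : x + (a * ((∏ q ∈ s, q : ℕ) : ℤ)) • (z - x) = z + (q : ℤ) • ((-b) • (z - x)) := by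
          rw [eq_sub_of_add_eq hab, smul_smul]
          module
        rw [e]
        intro hd
        exact hz ((dvd_sub_right hd).1 (hf q z ((-b) • (z - x))))
      · obtain ⟨M, hM⟩ := Finset.dvd_prod_of_mem (fun q : ℕ => q) hq
        have e : x + (a * ((∏ q ∈ s, q : ℕ) : ℤ)) • (z - x) =
            x + (q : ℤ) • ((a * (M : ℤ)) • (z - x)) := by
          rw [hM, smul_smul]; push_cast; congr 2; ring
        rw [e]
        intro hd
        exact hx q hq ((dvd_sub_right hd).1 (hf q x ((a * (M : ℤ)) • (z - x))))
  obtain ⟨x, hx⟩ := key N.primeFactors fun p hp =>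
    ⟨Nat.prime_of_mem_primeFactors hp, Nat.dvd_of_mem_primeFactors hp⟩
  refine ⟨x, ?_⟩
  rw [Int.isCoprime_iff_gcd_eq_one]
  by_contra hne
  obtain ⟨p, hp, hpd⟩ := Nat.exists_prime_and_dvd hne
  have h1 : (p : ℤ) ∣ f x := (Int.natCast_dvd_natCast.2 hpd).trans (Int.gcd_dvd_left _ _)
  have h2 : (p : ℤ) ∣ N := (Int.natCast_dvd_natCast.2 hpd).trans (Int.gcd_dvd_right _ _)
  exact hx p (Nat.mem_primeFactors.2 ⟨hp, Int.natCast_dvd_natCast.1 h2, hN.ne'⟩) h1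

/-- Over a field, translating a Lagrangian `(C D)` by a suitable symmetric `S` makes the second
block `D + C S` invertible. While `D` is singular, a left null vector `v` of `D` gives a right
null vector `u = ᵗ(v C) ≠ 0`, and adding `C s ᵗs` with `s · u ≠ 0` shrinks the kernel. -/
theorem exists_isSymm_det_add_mul_ne_zero {F : Type*} [Field F] {n : ℕ}
    (C : Matrix (Fin n) (Fin n) F) : ∀ (d : ℕ) (D : Matrix (Fin n) (Fin n) F),
    C * Dᵀ = D * Cᵀ → (∀ v, v ᵥ* C = 0 → v ᵥ* D = 0 → v = 0) →
    Module.finrank F (LinearMap.ker D.mulVecLin) ≤ d →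
    ∃ S : Matrix (Fin n) (Fin n) F, S.IsSymm ∧ (D + C * S).det ≠ 0 := by
  intro d
  induction d with
  | zero =>
    intro D _ _ hd
    refine ⟨0, Matrix.isSymm_zero, ?_⟩
    rw [Matrix.mul_zero, add_zero]
    intro h0
    obtain ⟨v, hv, hDv⟩ := Matrix.exists_mulVec_eq_zero_iff.2 h0
    have : LinearMap.ker D.mulVecLin = ⊥ := Submodule.finrank_eq_zero.1 (Nat.le_zero.1 hd)
    exact hv ((Submodule.eq_bot_iff _).1 this v (by simpa using hDv))
  | succ d ih =>
    intro D hs hr hd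
    by_cases h0 : D.det = 0
    swap
    · exact ⟨0, Matrix.isSymm_zero, by simpa using h0⟩
    obtain ⟨v, hv, hDv⟩ := Matrix.exists_vecMul_eq_zero_iff.2 h0
    set u := v ᵥ* C with hu
    have hu0 : u ≠ 0 := fun h => hv (hr v h hDv)
    have hDu : D *ᵥ u = 0 := by
      have h1 : D *ᵥ u = v ᵥ* (C * Dᵀ) := by
        rw [← Matrix.vecMul_vecMul, Matrix.vecMul_transpose]
      rw [h1, hs, ← Matrix.vecMul_vecMul, hDv, Matrix.zero_vecMul]
    obtain ⟨i, hi⟩ := Function.ne_iff.1 hu0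
    set s : Fin n → F := Pi.single i 1 with hsdef
    have hsu : s ⬝ᵥ u ≠ 0 := by simpa [hsdef] using hi
    have hss : (Matrix.vecMulVec s s).IsSymm := by
      ext a b; simp [Matrix.vecMulVec_apply, mul_comm]
    have hsym : C * (D + C * Matrix.vecMulVec s s)ᵀ = (D + C * Matrix.vecMulVec s s) * Cᵀ := by
      simp only [Matrix.transpose_add, Matrix.transpose_mul, hss.eq, Matrix.mul_add, Matrix.add_mul,
        hs, Matrix.mul_assoc]
    have hrank : ∀ w, w ᵥ* C = 0 → w ᵥ* (D + C * Matrix.vecMulVec s s) = 0 → w = 0 := by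
      intro w h1 h2
      refine hr w h1 ?_
      rw [Matrix.vecMul_add, ← Matrix.vecMul_vecMul, h1, Matrix.zero_vecMul, add_zero] at h2
      exact h2
    have hlt : LinearMap.ker (D + C * Matrix.vecMulVec s s).mulVecLin <
        LinearMap.ker D.mulVecLin := by
      have hform : ∀ x, (D + C * Matrix.vecMulVec s s) *ᵥ x = D *ᵥ x + (s ⬝ᵥ x) • (C *ᵥ s) := by
        intro x
        rw [Matrix.add_mulVec, Matrix.mul_vecMulVec, Matrix.vecMulVec_mulVec]
        simp
      have hvCs : v ⬝ᵥ (C *ᵥ s) ≠ 0 := by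
        rw [Matrix.dotProduct_mulVec, ← hu, dotProduct_comm]; exact hsu
      refine lt_of_le_of_ne ?_ ?_
      · intro x hx
        simp only [LinearMap.mem_ker, Matrix.mulVecLin_apply, hform] at hx ⊢
        have h1 := congrArg (fun z => v ⬝ᵥ z) hx
        simp only [dotProduct_add, Matrix.dotProduct_mulVec v D, hDv, zero_dotProduct, zero_add,
          dotProduct_smul, smul_eq_mul, dotProduct_zero, mul_eq_zero, hvCs, or_false] at h1
        simpa [h1] using hx
      · intro he
        have h1 : u ∈ LinearMap.ker D.mulVecLin := by simpa using hDu
        rw [← he] at h1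
        simp only [LinearMap.mem_ker, Matrix.mulVecLin_apply, hform, hDu, zero_add] at h1
        have h2 := congrArg (fun z => v ⬝ᵥ z) h1
        simp only [dotProduct_smul, smul_eq_mul, dotProduct_zero, mul_eq_zero, hsu, hvCs,
          or_self] at h2
    have hfr := Submodule.finrank_lt_finrank_of_lt hlt
    obtain ⟨S, hS, hdet⟩ := ih (D + C * Matrix.vecMulVec s s) hsym hrank (by omega)
    refine ⟨Matrix.vecMulVec s s + S, hss.add hS, ?_⟩
    rwa [Matrix.mul_add, ← add_assoc]

theorem dvd_det_sub_det {n : ℕ} (p : ℕ) (M M' : Matrix (Fin n) (Fin n) ℤ)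
    (h : redMat p M = redMat p M') : (p : ℤ) ∣ M.det - M'.det := by
  rw [← ZMod.intCast_zmod_eq_zero_iff_dvd, Int.cast_sub, ← det_redMat, ← det_redMat, h, sub_self]

/-- There is an integral symmetric `S` with `det (D + C S)` prime to `N`. -/
theorem exists_isSymm_isCoprime_det {n N : ℕ} (hN : 0 < N) (γ : Sp n) :
    ∃ S : Matrix (Fin n) (Fin n) ℤ, S.IsSymm ∧ IsCoprime (blkD γ + blkC γ * S).det (N : ℤ) := by
  suffices h : ∃ S : Matrix (Fin n) (Fin n) ℤ,
      IsCoprime (blkD γ + blkC γ * symmetrize S).det (N : ℤ) by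
    obtain ⟨S, hS⟩ := h
    exact ⟨_, symmetrize_isSymm S, hS⟩
  refine exists_isCoprime_value
    (fun S : Matrix (Fin n) (Fin n) ℤ => (blkD γ + blkC γ * symmetrize S).det) ?_ hN ?_
  · intro p x y
    apply dvd_det_sub_det
    have e : redMat p (symmetrize (x + (p : ℤ) • y)) = redMat p (symmetrize x) := by
      ext i j
      simp only [redMat_apply, symmetrize, Matrix.of_apply, Matrix.add_apply, Matrix.smul_apply,
        smul_eq_mul]
      simp
    rw [map_add, map_mul, e, ← map_mul, ← map_add]
  · intro p hp _
    have := Fact.mk hp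
    obtain ⟨h1, h2⟩ := row_relations γ
    obtain ⟨S, hS, hdet⟩ := exists_isSymm_det_add_mul_ne_zero (redMat p (blkC γ)) _
      (redMat p (blkD γ)) (by
        rw [← redMat_transpose, ← redMat_transpose, ← map_mul, ← map_mul, h1]) (by
        intro v hv1 hv2
        have := congrArg (redMat p) h2
        simp only [map_sub, map_mul, map_one] at this
        have h3 := congrArg (fun M => v ᵥ* M) this
        simp only [Matrix.vecMul_sub, ← Matrix.vecMul_vecMul, hv1, hv2, Matrix.zero_vecMul,
          sub_self, Matrix.vecMul_one] at h3
        exact h3.symm) le_rfl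
    refine ⟨Matrix.of fun i j => ((S i j).val : ℤ), ?_⟩
    have hl : redMat p (symmetrize (Matrix.of fun i j => ((S i j).val : ℤ))) = S := by
      rw [← symmetrize_eq hS]
      ext i j
      simp [redMat_apply, symmetrize]
    rw [← ZMod.intCast_zmod_eq_zero_iff_dvd, ← det_redMat, map_add, map_mul, hl]
    exact hdet

end LocalGlobal

/-! ### Reflections of symmetric matrices modulo `N` -/

section Reflection

variable {n : ℕ}

theorem dvd_quadForm_sub (L : Matrix (Fin n) (Fin n) ℤ) (p : ℕ) (x y : Fin n → ℤ) :
    (p : ℤ) ∣ (x + (p : ℤ) • y) ⬝ᵥ (L *ᵥ (x + (p : ℤ) • y)) - x ⬝ᵥ (L *ᵥ x) := by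
  refine ⟨y ⬝ᵥ (L *ᵥ x) + x ⬝ᵥ (L *ᵥ y) + p * (y ⬝ᵥ (L *ᵥ y)), ?_⟩
  simp only [Matrix.mulVec_add, Matrix.mulVec_smul, add_dotProduct, dotProduct_add,
    smul_dotProduct, dotProduct_smul, smul_eq_mul]
  ring

theorem quadForm_single (L : Matrix (Fin n) (Fin n) ℤ) (i : Fin n) :
    (Pi.single i 1 : Fin n → ℤ) ⬝ᵥ (L *ᵥ Pi.single i 1) = L i i := by
  simp

theorem quadForm_single_add (L : Matrix (Fin n) (Fin n) ℤ) (i j : Fin n) :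
    (Pi.single i 1 + Pi.single j 1 : Fin n → ℤ) ⬝ᵥ (L *ᵥ (Pi.single i 1 + Pi.single j 1)) =
      L i i + L i j + (L j i + L j j) := by
  simp only [Matrix.mulVec_add, add_dotProduct, dotProduct_add, Matrix.mulVec_single_one,
    single_one_dotProduct, Matrix.col_apply]
  ring

/-- An integral symmetric matrix whose entries have no common prime factor represents a number
`κ u` with `κ ∈ {1, 2}` and `u` prime to `N`: for each prime, one of the vectors `e_i`,
`e_i + e_j` will do. -/
theorem exists_quadForm_eq {N : ℕ} (hN : 0 < N) (T : Matrix (Fin n) (Fin n) ℤ) (hT : T.IsSymm)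
    (hc : ∀ p : ℕ, p.Prime → ∃ i j, ¬ (p : ℤ) ∣ T i j) :
    ∃ (x : Fin n → ℤ) (κ c u : ℤ), κ * c = 2 ∧ x ⬝ᵥ (T *ᵥ x) = κ * u ∧ IsCoprime u (N : ℤ) := by
  by_cases hodd : ∃ i, ¬ (2 : ℤ) ∣ T i i
  · obtain ⟨x, hx⟩ := exists_isCoprime_value (fun x : Fin n → ℤ => x ⬝ᵥ (T *ᵥ x))
      (fun p x y => dvd_quadForm_sub T p x y) hN (by
        intro p hp _
        by_cases hd : ∃ i, ¬ (p : ℤ) ∣ T i i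
        · obtain ⟨i, hi⟩ := hd
          exact ⟨Pi.single i 1, by rwa [quadForm_single]⟩
        push Not at hd
        obtain ⟨i, j, hij⟩ := hc p hp
        refine ⟨Pi.single i 1 + Pi.single j 1, ?_⟩
        rw [quadForm_single_add, hT.apply i j]
        intro h
        have h2 : (p : ℤ) ∣ 2 * T i j := by
          have := dvd_sub (dvd_sub h (hd i)) (hd j)
          rwa [show T i i + T i j + (T i j + T j j) - T i i - T j j = 2 * T i j by ring] at this
        rcases Int.Prime.dvd_mul' hp h2 with h3 | h3
        · have : p = 2 := by
            have := Nat.le_of_dvd (by norm_num) (by exact_mod_cast h3 : p ∣ 2)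
            have := hp.two_le
            omega
          subst this
          obtain ⟨i, hi⟩ := hodd
          exact hi (by exact_mod_cast hd i)
        · exact hij h3)
    exact ⟨x, 1, 2, _, by norm_num, by ring, hx⟩
  · push Not at hodd
    -- All diagonal entries are even: halve the quadratic form.
    let L : Matrix (Fin n) (Fin n) ℤ := Matrix.of fun i j =>
      if i < j then T i j else if i = j then T i i / 2 else 0
    have hL : T = L + Lᵀ := by
      ext i j
      rcases lt_trichotomy i j with h | h | h
      · simp [L, h, h.not_gt, h.ne']
      · subst h
        have := Int.mul_ediv_cancel' (hodd i)
        simp [L]; omega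
      · simp [L, h, h.not_gt, h.ne', hT.apply i j]
    have hL2 : ∀ x, x ⬝ᵥ (T *ᵥ x) = 2 * (x ⬝ᵥ (L *ᵥ x)) := by
      intro x
      rw [hL, Matrix.add_mulVec, dotProduct_add, Matrix.mulVec_transpose,
        dotProduct_comm x (x ᵥ* L),
        ← Matrix.dotProduct_mulVec, two_mul]
    obtain ⟨x, hx⟩ := exists_isCoprime_value (fun x : Fin n → ℤ => x ⬝ᵥ (L *ᵥ x))
      (fun p x y => dvd_quadForm_sub L p x y) hN (by
        intro p hp _
        by_cases hd : ∃ i, ¬ (p : ℤ) ∣ L i i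
        · obtain ⟨i, hi⟩ := hd
          exact ⟨Pi.single i 1, by rwa [quadForm_single]⟩
        push Not at hd
        obtain ⟨i, j, hij⟩ := hc p hp
        refine ⟨Pi.single i 1 + Pi.single j 1, ?_⟩
        rw [quadForm_single_add]
        intro h
        have := dvd_sub (dvd_sub h (hd i)) (hd j)
        refine hij ?_
        have e := congrArg (fun M => M i j) hL
        simp only [Matrix.add_apply, Matrix.transpose_apply] at e
        rwa [show L i i + L i j + (L j i + L j j) - L i i - L j j = L i j + L j i by ring,
          ← e] at this)
    exact ⟨x, 2, 1, _, by norm_num, hL2 x, hx⟩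

/-- Every integral symmetric matrix has, modulo `N`, an isometry of determinant `-1`: the
reflection in a vector `x` such that `T[x]` divides `2 T x` up to a unit modulo `N`. -/
theorem exists_isometry_det_eq_neg_one {N : ℕ} (hn : 0 < n) (hN : 0 < N)
    (T : Matrix (Fin n) (Fin n) ℤ) (hT : T.IsSymm) :
    ∃ V : Matrix (Fin n) (Fin n) ℤ, redMat N (Vᵀ * T * V) = redMat N T ∧
      ((V.det : ℤ) : ZMod N) = -1 := by
  by_cases hT0 : T = 0
  · refine ⟨Gpm n, by simp [hT0], by rw [det_Gpm hn]; simp⟩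
  obtain ⟨i0, j0, hij0⟩ : ∃ i j, T i j ≠ 0 := by
    by_contra h
    push Not at h
    exact hT0 (by ext i j; exact h i j)
  obtain ⟨t, ht, ht1⟩ := Finset.extract_gcd (fun a : Fin n × Fin n => T a.1 a.2)
    (s := Finset.univ) ⟨(i0, j0), Finset.mem_univ _⟩
  set m := Finset.univ.gcd fun a : Fin n × Fin n => T a.1 a.2 with hm
  have hm0 : m ≠ 0 := by
    intro h
    exact hij0 (by rw [ht (i0, j0) (Finset.mem_univ _), h, zero_mul])
  let T1 : Matrix (Fin n) (Fin n) ℤ := Matrix.of fun i j => t (i, j)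
  have hTT : T = m • T1 := by
    ext i j
    exact ht (i, j) (Finset.mem_univ _)
  have hT1 : T1.IsSymm := by
    ext i j
    have h := hT.apply i j
    rw [hTT] at h
    exact mul_left_cancel₀ hm0 h
  obtain ⟨x, κ, c, u, hκ, hx, hu⟩ := exists_quadForm_eq hN T1 hT1 (by
    intro p hp
    by_contra h
    push Not at h
    have h1 : (p : ℤ) ∣ Finset.univ.gcd t := Finset.dvd_gcd fun a _ => h a.1 a.2
    rw [ht1] at h1
    exact hp.one_lt.ne' (by exact_mod_cast Int.eq_one_of_dvd_one (by positivity) h1))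
  obtain ⟨e, f, hef⟩ := hu
  have hue : ((u : ZMod N)) * e = 1 := by
    have := congrArg (fun z : ℤ => (z : ZMod N)) hef
    simp at this
    rw [mul_comm]; exact this
  have hκc : (κ : ZMod N) * c = 2 := by exact_mod_cast congrArg (fun z : ℤ => (z : ZMod N)) hκ
  set z := T1 *ᵥ x with hz
  have hzx : x ᵥ* T1 = z := by
    rw [hz, ← Matrix.mulVec_transpose, hT1.eq]
  let V : Matrix (Fin n) (Fin n) ℤ := 1 - Matrix.vecMulVec x ((c * e) • z)
  have hVt : Vᵀ = 1 - Matrix.vecMulVec ((c * e) • z) x := by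
    simp [V, Matrix.transpose_sub, Matrix.transpose_vecMulVec]
  refine ⟨V, ?_, ?_⟩
  · have e1 : Vᵀ * T * V = T + (m * (c * e) * (κ * u * (c * e) - 2)) • Matrix.vecMulVec z z := by
      have h1 : T1 * V = T1 - Matrix.vecMulVec z ((c * e) • z) := by
        rw [show V = 1 - Matrix.vecMulVec x ((c * e) • z) from rfl, Matrix.mul_sub, Matrix.mul_one,
          Matrix.mul_vecMulVec]
      rw [Matrix.mul_assoc, hTT, Matrix.smul_mul, h1, hVt, Matrix.mul_smul, Matrix.sub_mul,
        Matrix.one_mul, Matrix.mul_sub, Matrix.vecMulVec_mul, hzx, Matrix.vecMulVec_mul_vecMulVec,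
        hx]
      ext i j
      simp only [Matrix.smul_apply, Matrix.sub_apply, Matrix.add_apply, Matrix.vecMulVec_apply,
        Pi.smul_apply, smul_eq_mul]
      ring
    rw [e1]
    ext i j
    have h2 : (c : ZMod N) * e * (κ * u * (c * e) - 2) = 0 := by
      linear_combination (c * e * (u * e) : ZMod N) * hκc + 2 * (c : ZMod N) * e * hue
    simp only [redMat_apply, Matrix.add_apply, Matrix.smul_apply, smul_eq_mul]
    push_cast
    linear_combination (m : ZMod N) * (Matrix.vecMulVec z z i j : ℤ) * h2
  · have e2 : V.det = 1 - (c * e) * (κ * u) := by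
      rw [show V = 1 - Matrix.vecMulVec x ((c * e) • z) from rfl, Matrix.vecMulVec_eq Unit,
        Matrix.det_one_sub_mul_comm, Matrix.det_unique, ← hx]
      simp [Matrix.mul_apply, dotProduct, Finset.mul_sum]
      refine Finset.sum_congr rfl fun i _ => by ring
    rw [e2]
    push_cast
    linear_combination (-(u : ZMod N) * e) * hκc - 2 * hue

end Reflection

/-! ### The right translate that replaces `γ_±` -/

section KeyElement

variable {n N : ℕ}

/-- For every `γ` there is a `δ ∈ Γ_0(N)` with `det D ≡ -1` that, acting on the right, has the same
effect on `Γ_∞⁺ Γ(N) γ` as `γ_±` acting on the left. After a translation the Lagrangian `(C D)`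
is `D (T 1)` modulo `N` with `T` symmetric, and an isometry of `T` of determinant `-1` gives `δ`. -/
theorem exists_mem_Gamma0_gammaPM (hn : 0 < n) (hN : 0 < N) (γ : Sp n) :
    ∃ δ ∈ Gamma0 n N, (((blkD δ).det : ℤ) : ZMod N) = -1 ∧ gammaPM n * γ * δ * γ⁻¹ ∈ KGrp n N := by
  obtain ⟨S, hS, hcop⟩ := exists_isSymm_isCoprime_det hN γ
  set σ := unip S hS with hσ
  obtain ⟨g, hg⟩ : ∃ g, g = γ * σ := ⟨_, rfl⟩
  have hgD : blkD g = blkD γ + blkC γ * S := by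
    rw [hg, blkD_mul]; simp [hσ, unip]; abel
  obtain ⟨e, f, hef⟩ := hcop
  rw [← hgD] at hef
  have hed : ((blkD g).det : ZMod N) * e = 1 := by
    have := congrArg (fun z : ℤ => (z : ZMod N)) hef
    simp at this
    rw [mul_comm]; exact this
  obtain ⟨hr1, hr2⟩ := row_relations g
  set C := blkC g
  set D := blkD g
  set E := e • D.adjugate with hE
  have hDE : redMat N D * redMat N E = 1 := by
    rw [← map_mul, hE, Matrix.mul_smul, Matrix.mul_adjugate, smul_smul]
    ext i j
    rw [redMat_apply, Matrix.smul_apply, smul_eq_mul, Int.cast_mul, Int.cast_mul,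
      mul_comm (e : ZMod N), hed, one_mul]
    simp [Matrix.one_apply]
  have hED : redMat N E * redMat N D = 1 := mul_eq_one_comm.1 hDE
  have hr1' : redMat N C * (redMat N D)ᵀ = redMat N D * (redMat N C)ᵀ := by
    rw [← redMat_transpose, ← redMat_transpose, ← map_mul, ← map_mul, hr1]
  have hr2' : redMat N D * (redMat N (blkA g))ᵀ - redMat N C * (redMat N (blkB g))ᵀ = 1 := by
    rw [← redMat_transpose, ← redMat_transpose, ← map_mul, ← map_mul, ← map_sub, hr2, map_one]
  have hT0 : (redMat N (E * C)).IsSymm := by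
    have h1 : (redMat N D)ᵀ * (redMat N E)ᵀ = 1 := by
      rw [← Matrix.transpose_mul, hED, Matrix.transpose_one]
    rw [Matrix.IsSymm, map_mul, Matrix.transpose_mul]
    calc (redMat N C)ᵀ * (redMat N E)ᵀ
        = redMat N E * (redMat N D * (redMat N C)ᵀ) * (redMat N E)ᵀ := by
          rw [← Matrix.mul_assoc, hED, Matrix.one_mul]
      _ = redMat N E * redMat N C := by
          rw [← hr1', Matrix.mul_assoc, Matrix.mul_assoc, h1, Matrix.mul_one]
  -- `T` is `D⁻¹ C` modulo `N`.
  set T := symmetrize (E * C) with hT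
  have hTs : T.IsSymm := symmetrize_isSymm _
  have hTE : redMat N T = redMat N E * redMat N C := by
    rw [← map_mul, ← symmetrize_eq hT0]; rfl
  have hDT : redMat N C = redMat N D * redMat N T := by
    rw [hTE, ← Matrix.mul_assoc, hDE, Matrix.one_mul]
  have hTt : (redMat N T)ᵀ = redMat N T := by rw [← redMat_transpose, hTs.eq]
  obtain ⟨V0, hV1, hV2⟩ := exists_isometry_det_eq_neg_one hn hN T hTs
  -- Lift the isometry to an integral matrix `V` of determinant `-1`.
  obtain ⟨W, hW⟩ := exists_SL_lift N n (Gpm n * V0) (by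
    rw [Matrix.det_mul, det_Gpm hn, Int.cast_mul, hV2]; simp)
  set V := Gpm n * (W : Matrix (Fin n) (Fin n) ℤ) with hV
  have hVV0 : redMat N V = redMat N V0 := by
    rw [hV, map_mul, hW, ← map_mul, ← Matrix.mul_assoc, Gpm_mul_self, Matrix.one_mul]
  have hVdet : V.det = -1 := by rw [hV, Matrix.det_mul, det_Gpm hn, W.det_coe]; rfl
  set V' := -V.adjugate with hV'
  have hVV' : V * V' = 1 := by
    rw [hV', Matrix.mul_neg, Matrix.mul_adjugate, hVdet]; simp
  have hV'V : V' * V = 1 := mul_eq_one_comm.1 hVV'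
  -- `L = diag(V, ᵗV⁻¹)` is conjugated back by the translation `σ`; since `V` is an isometry of
  -- `T`, right multiplication by `L` preserves the row span of `(C D)` modulo `N`.
  set L := levi V'ᵀ Vᵀ (by rw [← Matrix.transpose_mul, hV'V, Matrix.transpose_one]) with hL
  have hLA : blkA L = V := Matrix.transpose_transpose _
  have hLD : blkD L = V'ᵀ := rfl
  have hLB : blkB L = 0 := rfl
  have hLC : blkC L = 0 := rfl
  have hV'det : V'.det = -1 := by
    have := congrArg Matrix.det hV'V
    rw [Matrix.det_mul, hVdet, Matrix.det_one] at this
    linarith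
  have hVTV : (redMat N V)ᵀ * redMat N T * redMat N V = redMat N T := by
    rw [hVV0, ← redMat_transpose, ← map_mul, ← map_mul, hV1]
  have hTV : redMat N T * redMat N V = (redMat N V')ᵀ * redMat N T := by
    have h1 : (redMat N V')ᵀ * (redMat N V)ᵀ = 1 := by
      rw [← Matrix.transpose_mul, ← map_mul, hVV', map_one, Matrix.transpose_one]
    conv_rhs => rw [← hVTV]
    rw [← Matrix.mul_assoc, ← Matrix.mul_assoc, h1, Matrix.one_mul]
  have hh : γ * (σ * L * σ⁻¹) * γ⁻¹ = g * L * g⁻¹ := by rw [hg]; group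
  have hσC : blkC σ = 0 := rfl
  have hσD : blkD σ = 1 := rfl
  have hσA : blkA σ = 1 := rfl
  have hC0 : redMat N (blkC (g * L * g⁻¹)) = 0 := by
    rw [blkC_mul, blkC_mul, blkD_mul, blkA_inv, blkC_inv, hLA, hLB, hLC, hLD]
    simp only [Matrix.mul_zero, add_zero, zero_add, map_add, map_mul, map_neg, redMat_transpose]
    change redMat N C * redMat N V * (redMat N D)ᵀ +
      redMat N D * (redMat N V')ᵀ * -(redMat N C)ᵀ = 0
    rw [hDT, Matrix.transpose_mul, hTt, Matrix.mul_assoc (redMat N D), hTV]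
    noncomm_ring
  have hD1 : (((blkD (g * L * g⁻¹)).det : ℤ) : ZMod N) = -1 := by
    have e1 : redMat N (blkD (g * L * g⁻¹)) =
        redMat N D * ((redMat N V')ᵀ *
          ((redMat N (blkA g))ᵀ - redMat N T * (redMat N (blkB g))ᵀ)) := by
      rw [blkD_mul, blkC_mul, blkD_mul, blkD_inv, blkB_inv, hLA, hLB, hLC, hLD]
      simp only [Matrix.mul_zero, add_zero, zero_add, map_add, map_mul, map_neg, redMat_transpose]
      change redMat N C * redMat N V * -(redMat N (blkB g))ᵀ +
        redMat N D * (redMat N V')ᵀ * (redMat N (blkA g))ᵀ = _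
      rw [hDT, Matrix.mul_assoc (redMat N D), hTV]
      noncomm_ring
    have e2 : (redMat N D).det * ((redMat N (blkA g))ᵀ - redMat N T * (redMat N (blkB g))ᵀ).det =
        1 := by
      rw [← Matrix.det_mul, Matrix.mul_sub, ← Matrix.mul_assoc, ← hDT, hr2', Matrix.det_one]
    rw [← det_redMat, e1, Matrix.det_mul, Matrix.det_mul, Matrix.det_transpose, det_redMat N V',
      hV'det]
    push_cast
    linear_combination (-1 : ZMod N) * e2
  refine ⟨σ * L * σ⁻¹, GammaInf_le_Gamma0 (mul_mem (mul_mem ?_ ?_) (inv_mem ?_)), ?_, ?_⟩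
  · exact hσC
  · exact hLC
  · exact hσC
  · rw [blkD_mul, blkD_mul, blkC_mul, hσC, hσD, hLC, hLD, blkD_inv, hσA]
    simp [hV'det]
  · have e3 : gammaPM n * γ * (σ * L * σ⁻¹) * γ⁻¹ = gammaPM n * (g * L * g⁻¹) := by
      rw [← hh]; group
    rw [e3]
    refine mem_KGrp_of_det (mul_mem gammaPM_mem_Gamma0 (mem_Gamma0_iff.2 hC0)) ?_
    rw [blkD_mul, blkC_gammaPM, blkD_gammaPM, Matrix.zero_mul, zero_add, Matrix.det_mul,
      det_Gpm hn, Int.cast_mul, hD1]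
    simp

end KeyElement


/-! ### Action on the upper half-space and automorphy factors -/

section Action

variable {n : ℕ}

theorem toC_add (M M' : Matrix (Fin n) (Fin n) ℤ) : toC (M + M') = toC M + toC M' :=
  Matrix.map_add _ (map_add _) _ _

@[simp] theorem toC_zero : toC (0 : Matrix (Fin n) (Fin n) ℤ) = 0 := by
  ext i j
  simp [toC]

@[simp] theorem toC_one : toC (1 : Matrix (Fin n) (Fin n) ℤ) = 1 :=
  Matrix.map_one _ (map_zero _) (map_one _)

theorem det_toC (M : Matrix (Fin n) (Fin n) ℤ) : (toC M).det = ((M.det : ℤ) : ℂ) :=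
  ((Int.castRingHom ℂ).map_det M).symm

/-- The automorphy factor `det(Cτ + D)`. -/
noncomputable def jdet (γ : Sp n) (τ : SiegelH n) : ℂ := (denom γ τ.1).det

theorem jdet_ne_zero (γ : Sp n) (τ : SiegelH n) : jdet γ τ ≠ 0 :=
  ((Matrix.isUnit_iff_isUnit_det _).1 (denom_isUnit γ τ)).ne_zero

theorem moebius_mul_denom (γ : Sp n) (τ : SiegelH n) :
    (moebius γ τ).1 * denom γ τ.1 = numer γ τ.1 := by
  change numer γ τ.1 * (denom γ τ.1)⁻¹ * denom γ τ.1 = _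
  rw [Matrix.mul_assoc, Matrix.nonsing_inv_mul _ ((Matrix.isUnit_iff_isUnit_det _).1
    (denom_isUnit γ τ)), Matrix.mul_one]

theorem denom_mul (γ δ : Sp n) (τ : SiegelH n) :
    denom (γ * δ) τ.1 = denom γ (moebius δ τ).1 * denom δ τ.1 := by
  have h := moebius_mul_denom δ τ
  rw [denom, blkC_mul, blkD_mul, denom.eq_1 γ, Matrix.add_mul, Matrix.mul_assoc, h]
  simp only [numer, denom, toC_add, toC_mul]
  noncomm_ring

theorem numer_mul (γ δ : Sp n) (τ : SiegelH n) :
    numer (γ * δ) τ.1 = numer γ (moebius δ τ).1 * denom δ τ.1 := by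
  have h := moebius_mul_denom δ τ
  rw [numer, blkA_mul, blkB_mul, numer.eq_1 γ, Matrix.add_mul, Matrix.mul_assoc, h]
  simp only [numer, denom, toC_add, toC_mul]
  noncomm_ring

theorem moebius_mul (γ δ : Sp n) (τ : SiegelH n) :
    moebius (γ * δ) τ = moebius γ (moebius δ τ) := by
  apply Subtype.ext
  change numer (γ * δ) τ.1 * (denom (γ * δ) τ.1)⁻¹ =
    numer γ (moebius δ τ).1 * (denom γ (moebius δ τ).1)⁻¹
  rw [numer_mul, denom_mul, Matrix.mul_inv_rev, Matrix.mul_assoc, ← Matrix.mul_assoc (denom δ τ.1),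
    Matrix.mul_nonsing_inv _ ((Matrix.isUnit_iff_isUnit_det _).1 (denom_isUnit δ τ)),
    Matrix.one_mul]

theorem jdet_mul (γ δ : Sp n) (τ : SiegelH n) :
    jdet (γ * δ) τ = jdet γ (moebius δ τ) * jdet δ τ := by
  rw [jdet, denom_mul, Matrix.det_mul]; rfl

theorem slash_slash (k : ℕ) (f : SiegelH n → ℂ) (γ δ : Sp n) :
    slash k (slash k f γ) δ = slash k f (γ * δ) := by
  funext τ
  have h := jdet_mul γ δ τ
  simp only [jdet] at h
  simp only [slash, h, moebius_mul, mul_zpow]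
  ring

theorem oneSlash_apply (k : ℕ) (γ : Sp n) (τ : SiegelH n) :
    oneSlash k γ τ = jdet γ τ ^ (-(k : ℤ)) := by
  simp [oneSlash, slash, jdet]

theorem oneSlash_mul (k : ℕ) (γ δ : Sp n) (τ : SiegelH n) :
    oneSlash k (γ * δ) τ = jdet δ τ ^ (-(k : ℤ)) * oneSlash k γ (moebius δ τ) := by
  rw [oneSlash_apply, oneSlash_apply, jdet_mul, mul_zpow, mul_comm]

theorem jdet_of_mem {p : Sp n} (hp : p ∈ GammaInf n) (τ : SiegelH n) :
    jdet p τ = (((blkD p).det : ℤ) : ℂ) := by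
  rw [jdet, denom, mem_GammaInf.1 hp, toC_zero, Matrix.zero_mul, zero_add, det_toC]

theorem oneSlash_of_mem_mul (k : ℕ) {p : Sp n} (hp : p ∈ GammaInfPlus n) (γ : Sp n)
    (τ : SiegelH n) : oneSlash k (p * γ) τ = oneSlash k γ τ := by
  rw [oneSlash_apply, oneSlash_apply, jdet_mul, jdet_of_mem (GammaInfPlus_le hp),
    (mem_GammaInfPlus'.1 hp).2]
  simp

theorem oneSlash_gammaPM_mul (hn : 0 < n) (k : ℕ) (γ : Sp n) (τ : SiegelH n) :
    oneSlash k (gammaPM n * γ) τ = (-1) ^ k * oneSlash k γ τ := by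
  rw [oneSlash_apply, oneSlash_apply, jdet_mul, jdet_of_mem gammaPM_mem_GammaInf, blkD_gammaPM,
    det_Gpm hn, mul_zpow]
  congr 1
  push_cast
  rw [zpow_neg, ← inv_zpow, zpow_natCast, inv_neg, inv_one]

theorem norm_jdet_of_mem_mul {p : Sp n} (hp : p ∈ GammaInf n) (γ : Sp n) (τ : SiegelH n) :
    ‖jdet (p * γ) τ‖ = ‖jdet γ τ‖ := by
  rw [jdet_mul, jdet_of_mem hp, norm_mul]
  rcases det_blkD_of_mem hp with h | h <;> simp [h]

open scoped ComplexOrder in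
/-- `Im(γτ) = (Cτ+D)^{-*} Im(τ) (Cτ+D)⁻¹`. -/
theorem im_moebius (γ : Sp n) (τ : SiegelH n) :
    ((moebius γ τ).1.map Complex.im).map Complex.ofReal =
      ((denom γ τ.1)⁻¹)ᴴ * ((τ.1.map Complex.im).map Complex.ofReal) * (denom γ τ.1)⁻¹ := by
  have hd := (Matrix.isUnit_iff_isUnit_det _).1 (denom_isUnit γ τ)
  have hdH : IsUnit (denom γ τ.1)ᴴ.det := by
    rw [Matrix.det_conjTranspose]; exact hd.star
  have h1 := moebius_mul_denom γ τ
  have h := herm_identity γ (τ := τ.1)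
  rw [← h1, Matrix.conjTranspose_mul] at h
  have e : (denom γ τ.1)ᴴ * ((moebius γ τ).1 - ((moebius γ τ).1)ᴴ) * denom γ τ.1 =
      τ.1 - (τ.1)ᴴ := by
    rw [← h]; noncomm_ring
  rw [sub_conjTranspose_eq (moebius γ τ).2.1, sub_conjTranspose_eq τ.2.1, Matrix.mul_smul,
    Matrix.smul_mul] at e
  have e2 := smul_right_injective _ (show (2 * Complex.I : ℂ) ≠ 0 by simp) e
  rw [← e2, Matrix.conjTranspose_nonsing_inv, Matrix.mul_assoc, Matrix.mul_assoc,
    Matrix.mul_nonsing_inv _ hd, Matrix.mul_one, ← Matrix.mul_assoc, Matrix.nonsing_inv_mul _ hdH,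
    Matrix.one_mul]

theorem posDef_smul_one {y : ℝ} (hy : 0 < y) :
    (Complex.I * y) • (1 : Matrix (Fin n) (Fin n) ℂ) ∈ siegelSet n := by
  have h : ((Complex.I * y) • (1 : Matrix (Fin n) (Fin n) ℂ)).map Complex.im =
      y • (1 : Matrix (Fin n) (Fin n) ℝ) := by
    ext i j
    by_cases hij : i = j <;> simp [hij]
  refine ⟨?_, ?_⟩
  · rw [Matrix.IsSymm, Matrix.transpose_smul, Matrix.transpose_one]
  · rw [h]
    exact Matrix.PosDef.one.smul hy

/-- The point `i y · 1` of `𝔥_n`. -/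
noncomputable def iyPt (n : ℕ) (y : ℝ) (hy : 0 < y) : SiegelH n :=
  ⟨(Complex.I * y) • 1, posDef_smul_one hy⟩

/-- The base point `i · 1` of `𝔥_n`. -/
noncomputable def iPt (n : ℕ) : SiegelH n := iyPt n 1 one_pos

theorem iPt_val : (iPt n).1 = Complex.I • 1 := by
  simp [iPt, iyPt]

theorem im_iPt : ((iPt n).1.map Complex.im) = 1 := by
  rw [iPt_val]
  ext i j
  by_cases hij : i = j
  · subst hij; simp
  · simp [hij]

theorem denom_iPt (γ : Sp n) : denom γ (iPt n).1 = Complex.I • toC (blkC γ) + toC (blkD γ) := by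
  rw [denom, iPt_val, Matrix.mul_smul, Matrix.mul_one]

/-- `det(Ci + D)` is a nonzero Gaussian integer. -/
theorem one_le_norm_jdet_iPt (γ : Sp n) : 1 ≤ ‖jdet γ (iPt n)‖ := by
  let G : Matrix (Fin n) (Fin n) GaussianInt := Matrix.of fun i j => ⟨blkD γ i j, blkC γ i j⟩
  have hG : jdet γ (iPt n) = GaussianInt.toComplex G.det := by
    rw [RingHom.map_det, jdet, denom_iPt]
    congr 1
    ext i j
    simp [G, toC, GaussianInt.toComplex_def]
    ring
  have h0 : G.det ≠ 0 := by
    intro h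
    exact jdet_ne_zero γ (iPt n) (by rw [hG, h, map_zero])
  have h1 : (1 : ℤ) ≤ Zsqrtd.norm G.det := GaussianInt.norm_pos.2 h0
  have h2 : ((Zsqrtd.norm G.det : ℤ) : ℝ) = Complex.normSq (jdet γ (iPt n)) := by
    rw [hG]; exact GaussianInt.intCast_real_norm _
  rw [Complex.normSq_eq_norm_sq] at h2
  have h3 : (1 : ℝ) ≤ ‖jdet γ (iPt n)‖ ^ 2 := by rw [← h2]; exact_mod_cast h1
  nlinarith [norm_nonneg (jdet γ (iPt n))]

/-- `det Im(γτ) = det Im(τ) / |det(Cτ+D)|²` at the base point. -/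
theorem det_im_moebius_iPt (γ : Sp n) :
    ((moebius γ (iPt n)).1.map Complex.im).det = (‖jdet γ (iPt n)‖ ^ 2)⁻¹ := by
  have h := congrArg Matrix.det (im_moebius γ (iPt n))
  rw [im_iPt] at h
  have e1 : ((1 : Matrix (Fin n) (Fin n) ℝ).map Complex.ofReal) = 1 :=
    Matrix.map_one _ (by simp) (by simp)
  have e2 : (((moebius γ (iPt n)).1.map Complex.im).map Complex.ofReal).det =
      ((((moebius γ (iPt n)).1.map Complex.im).det : ℝ) : ℂ) :=
    (Complex.ofRealHom.map_det _).symm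
  rw [e1, Matrix.mul_one, Matrix.det_mul, Matrix.det_conjTranspose, e2, Matrix.det_nonsing_inv,
    Ring.inverse_eq_inv'] at h
  apply Complex.ofReal_injective
  rw [h]
  change (starRingEnd ℂ) (jdet γ (iPt n))⁻¹ * (jdet γ (iPt n))⁻¹ = _
  rw [mul_comm, Complex.mul_conj, Complex.normSq_eq_norm_sq, norm_inv, inv_pow]

end Action


/-! ### Block diagonal matrices -/

section BlockDiagonal

variable {R : Type*} {m : ℕ}

/-- The block diagonal matrix `diag(a, M)`. -/
def bl (a : R) [Zero R] (M : Matrix (Fin m) (Fin m) R) : Matrix (Fin (m + 1)) (Fin (m + 1)) R :=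
  Matrix.of (Fin.cons (Fin.cons a fun _ => 0) fun i => Fin.cons 0 fun j => M i j)

section
variable [Zero R] (a : R) (M : Matrix (Fin m) (Fin m) R) (i j : Fin m)
@[simp] theorem bl_zero_zero : bl a M 0 0 = a := rfl
@[simp] theorem bl_zero_succ : bl a M 0 j.succ = 0 := rfl
@[simp] theorem bl_succ_zero : bl a M i.succ 0 = 0 := rfl
@[simp] theorem bl_succ_succ : bl a M i.succ j.succ = M i j := rfl
end

theorem matrix_ext_succ {R : Type*} {A B : Matrix (Fin (m + 1)) (Fin (m + 1)) R}
    (h00 : A 0 0 = B 0 0) (h0 : ∀ j : Fin m, A 0 j.succ = B 0 j.succ)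
    (h1 : ∀ i : Fin m, A i.succ 0 = B i.succ 0)
    (h2 : ∀ i j : Fin m, A i.succ j.succ = B i.succ j.succ) : A = B := by
  ext i j
  refine Fin.cases ?_ (fun i => ?_) i
  · refine Fin.cases ?_ (fun j => ?_) j
    exacts [h00, h0 j]
  · refine Fin.cases ?_ (fun j => ?_) j
    exacts [h1 i, h2 i j]

variable [CommRing R]

theorem bl_mul (a b : R) (M M' : Matrix (Fin m) (Fin m) R) :
    bl a M * bl b M' = bl (a * b) (M * M') := by
  apply matrix_ext_succ <;> intros <;> simp [Matrix.mul_apply, Fin.sum_univ_succ]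

theorem bl_add (a b : R) (M M' : Matrix (Fin m) (Fin m) R) :
    bl a M + bl b M' = bl (a + b) (M + M') := by
  apply matrix_ext_succ <;> intros <;> simp

theorem bl_sub (a b : R) (M M' : Matrix (Fin m) (Fin m) R) :
    bl a M - bl b M' = bl (a - b) (M - M') := by
  apply matrix_ext_succ <;> intros <;> simp

theorem bl_transpose (a : R) (M : Matrix (Fin m) (Fin m) R) : (bl a M)ᵀ = bl a Mᵀ := by
  apply matrix_ext_succ <;> intros <;> simp

theorem bl_one : bl (1 : R) (1 : Matrix (Fin m) (Fin m) R) = 1 := by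
  apply matrix_ext_succ <;> intros <;> simp [Matrix.one_apply, (Fin.succ_ne_zero _).symm]

theorem bl_zero : bl (0 : R) (0 : Matrix (Fin m) (Fin m) R) = 0 := by
  apply matrix_ext_succ <;> intros <;> simp

theorem det_bl (a : R) (M : Matrix (Fin m) (Fin m) R) : (bl a M).det = a * M.det := by
  rw [det_of_column_zero _ fun i => rfl]
  rfl

theorem toC_bl (a : ℤ) (M : Matrix (Fin m) (Fin m) ℤ) : toC (bl a M) = bl (a : ℂ) (toC M) := by
  apply matrix_ext_succ <;> intros <;> simp [toC]

end BlockDiagonal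

/-! ### The embedding of `Sp_m` into `Sp_{m+1}` -/

section Embedding

variable {m : ℕ}

/-- The embedding `Sp_m → Sp_{m+1}` that fixes the first pair of coordinates. -/
def iota : Sp m →* Sp (m + 1) := MonoidHom.mk'
  (fun y => mkSp (bl 1 (blkA y)) (bl 0 (blkB y)) (bl 0 (blkC y)) (bl 1 (blkD y))
    (by rw [bl_transpose, bl_transpose, bl_mul, bl_mul, (block_relations y).1]; simp)
    (by rw [bl_transpose, bl_transpose, bl_mul, bl_mul, (block_relations y).2.1]; simp)
    (by rw [bl_transpose, bl_transpose, bl_mul, bl_mul, bl_sub, (block_relations y).2.2]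
        simp [bl_one]))
  (fun y y' => by
    apply sp_ext <;>
      simp [blkA_mul, blkB_mul, blkC_mul, blkD_mul, bl_mul, bl_add])

theorem blkA_iota (y : Sp m) : blkA (iota y) = bl 1 (blkA y) := rfl
theorem blkB_iota (y : Sp m) : blkB (iota y) = bl 0 (blkB y) := rfl
theorem blkC_iota (y : Sp m) : blkC (iota y) = bl 0 (blkC y) := rfl
theorem blkD_iota (y : Sp m) : blkD (iota y) = bl 1 (blkD y) := rfl

theorem iota_mem_GammaInf {p : Sp m} (hp : p ∈ GammaInf m) : iota p ∈ GammaInf (m + 1) := by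
  rw [mem_GammaInf, blkC_iota, mem_GammaInf.1 hp, bl_zero]

theorem denom_iota_iPt (y : Sp m) :
    denom (iota y) (iPt (m + 1)).1 = bl 1 (denom y (iPt m).1) := by
  rw [denom_iPt, denom_iPt, blkC_iota, blkD_iota, toC_bl, toC_bl]
  apply matrix_ext_succ <;> intros <;> simp

theorem jdet_iota_iPt (y : Sp m) : jdet (iota y) (iPt (m + 1)) = jdet y (iPt m) := by
  rw [jdet, denom_iota_iPt, det_bl, one_mul]; rfl

theorem moebius_iota_iPt (y : Sp m) :
    (moebius (iota y) (iPt (m + 1))).1 = bl Complex.I (moebius y (iPt m)).1 := by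
  have hd := (Matrix.isUnit_iff_isUnit_det _).1 (denom_isUnit (iota y) (iPt (m + 1)))
  have h : bl Complex.I (moebius y (iPt m)).1 * denom (iota y) (iPt (m + 1)).1 =
      numer (iota y) (iPt (m + 1)).1 := by
    rw [denom_iota_iPt, bl_mul, moebius_mul_denom, numer, numer, iPt_val, iPt_val, blkA_iota,
      blkB_iota, toC_bl, toC_bl]
    apply matrix_ext_succ <;> intros <;> simp
  change numer (iota y) (iPt (m + 1)).1 * (denom (iota y) (iPt (m + 1)).1)⁻¹ = _
  rw [← h, Matrix.mul_assoc, Matrix.mul_nonsing_inv _ hd, Matrix.mul_one]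

end Embedding

/-! ### Integral isotropic subspaces -/

section IsotropicReduction

theorem row_relations' {n : ℕ} (γ : Sp n) :
    blkA γ * (blkB γ)ᵀ = blkB γ * (blkA γ)ᵀ ∧ blkA γ * (blkD γ)ᵀ - blkB γ * (blkC γ)ᵀ = 1 := by
  constructor
  · have h := blkB_mul γ γ⁻¹
    rw [mul_inv_cancel, blkB_one, blkB_inv, blkD_inv, Matrix.mul_neg] at h
    exact (sub_eq_zero.1 (by rw [h]; abel)).symm
  · have h := blkA_mul γ γ⁻¹
    rw [mul_inv_cancel, blkA_one, blkA_inv, blkC_inv, Matrix.mul_neg] at h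
    rw [h]; abel

/-- Right multiplication by a symplectic matrix preserves isotropic families of row vectors. -/
theorem isotropic_mul {n : ℕ} {r : Type*} [Fintype r] (M M' : Matrix r (Fin n) ℤ)
    (h : M * M'ᵀ = M' * Mᵀ) (γ : Sp n) :
    (M * blkA γ + M' * blkC γ) * (M * blkB γ + M' * blkD γ)ᵀ =
      (M * blkB γ + M' * blkD γ) * (M * blkA γ + M' * blkC γ)ᵀ := by
  obtain ⟨h1, h2⟩ := row_relations' γ
  obtain ⟨h3, h4⟩ := row_relations γ
  set A := blkA γ; set B := blkB γ; set C := blkC γ; set D := blkD γ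
  have h4' : C * Bᵀ - D * Aᵀ = -1 := by rw [← h4]; abel
  rw [← sub_eq_zero] at h ⊢
  calc _ = M * (A * Bᵀ - B * Aᵀ) * Mᵀ + M * (A * Dᵀ - B * Cᵀ) * M'ᵀ +
        M' * (C * Bᵀ - D * Aᵀ) * Mᵀ + M' * (C * Dᵀ - D * Cᵀ) * M'ᵀ := by
        simp only [Matrix.transpose_add, Matrix.transpose_mul, Matrix.mul_add, Matrix.add_mul,
          Matrix.mul_sub, Matrix.sub_mul, Matrix.mul_assoc]
        abel
    _ = 0 := by
        rw [h1, h2, h3, h4', ← h]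
        simp [sub_eq_add_neg]

theorem exists_sl_two (x y : ℤ) : ∃ a b c d : ℤ, a * d - c * b = 1 ∧ x * a + y * c = 0 := by
  by_cases h : x = 0 ∧ y = 0
  · exact ⟨1, 0, 0, 1, by norm_num, by simp [h.1, h.2]⟩
  have hg : Int.gcd x y ≠ 0 := fun h0 => h (Int.gcd_eq_zero_iff.1 h0)
  obtain ⟨x', hx⟩ : ((Int.gcd x y : ℕ) : ℤ) ∣ x := Int.gcd_dvd_left _ _
  obtain ⟨y', hy⟩ : ((Int.gcd x y : ℕ) : ℤ) ∣ y := Int.gcd_dvd_right _ _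
  have hb := Int.gcd_eq_gcd_ab x y
  set g : ℤ := ((Int.gcd x y : ℕ) : ℤ)
  have hg' : g ≠ 0 := Int.natCast_ne_zero.2 hg
  refine ⟨y', Int.gcdA x y, -x', Int.gcdB x y, ?_, ?_⟩
  · apply mul_left_cancel₀ hg'
    linear_combination Int.gcdB x y * hy.symm + Int.gcdA x y * hx.symm - hb
  · linear_combination y' * hx - x' * hy

/-- `Sp_{m+1}(ℤ)` carries every integral row vector `(x y)` to a multiple of the first unit vector
of the second half. -/
theorem exists_sp_vecMul {m : ℕ} (x y : Fin (m + 1) → ℤ) :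
    ∃ (γ : Sp (m + 1)) (g : ℤ), x ᵥ* blkA γ + y ᵥ* blkC γ = 0 ∧
      x ᵥ* blkB γ + y ᵥ* blkD γ = Pi.single 0 g := by
  choose a b c d h1 h2 using fun i => exists_sl_two (x i) (y i)
  let σ : Sp (m + 1) := mkSp (Matrix.diagonal a) (Matrix.diagonal b) (Matrix.diagonal c)
    (Matrix.diagonal d)
    (by rw [Matrix.diagonal_transpose, Matrix.diagonal_transpose, Matrix.diagonal_mul_diagonal,
          Matrix.diagonal_mul_diagonal]; simp [mul_comm])
    (by rw [Matrix.diagonal_transpose, Matrix.diagonal_transpose, Matrix.diagonal_mul_diagonal,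
          Matrix.diagonal_mul_diagonal]; simp [mul_comm])
    (by rw [Matrix.diagonal_transpose, Matrix.diagonal_transpose, Matrix.diagonal_mul_diagonal,
          Matrix.diagonal_mul_diagonal, Matrix.diagonal_sub, ← Matrix.diagonal_one]
        congr 1; funext i; exact h1 i)
  have hσ : x ᵥ* blkA σ + y ᵥ* blkC σ = 0 := by
    funext i
    simp [σ, Matrix.vecMul_diagonal, h2]
  obtain ⟨U, g, hU⟩ := exists_SL_vecMul (x ᵥ* blkB σ + y ᵥ* blkD σ)
  set U' := ((U⁻¹ : Matrix.SpecialLinearGroup (Fin (m + 1)) ℤ) :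
    Matrix (Fin (m + 1)) (Fin (m + 1)) ℤ)
  have hUU : U' * U = 1 := by
    rw [← Matrix.SpecialLinearGroup.coe_mul, inv_mul_cancel]; simp
  refine ⟨σ * levi U U' hUU, g, ?_, ?_⟩
  · rw [blkA_mul, blkC_mul]
    simp only [levi, blkA_mkSp, blkC_mkSp, Matrix.mul_zero, add_zero]
    rw [← Matrix.vecMul_vecMul, ← Matrix.vecMul_vecMul, ← Matrix.add_vecMul, hσ,
      Matrix.zero_vecMul]
  · rw [blkB_mul, blkD_mul]
    simp only [levi, blkB_mkSp, blkD_mkSp, Matrix.mul_zero, zero_add]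
    rw [← Matrix.vecMul_vecMul, ← Matrix.vecMul_vecMul, ← Matrix.add_vecMul, hU]

/-- `Sp_m(ℤ)` carries every isotropic family of integral row vectors into the standard
Lagrangian. -/
theorem exists_sp_mul_eq_zero {r : Type*} [Fintype r] : ∀ (m : ℕ) (M M' : Matrix r (Fin m) ℤ),
    M * M'ᵀ = M' * Mᵀ → ∃ γ : Sp m, M * blkA γ + M' * blkC γ = 0
  | 0, _, _, _ => ⟨1, by ext i j; exact j.elim0⟩
  | m + 1, M, M', h => by
    by_cases hz : ∀ i, M i = 0 ∧ M' i = 0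
    · refine ⟨1, ?_⟩
      have e1 : M = 0 := by ext i j; rw [(hz i).1]; rfl
      have e2 : M' = 0 := by ext i j; rw [(hz i).2]; rfl
      rw [e1, e2]; simp
    push Not at hz
    obtain ⟨i, hi⟩ := hz
    obtain ⟨γ, g, h1, h2⟩ := exists_sp_vecMul (M i) (M' i)
    have hiso := isotropic_mul M M' h γ
    set P := M * blkA γ + M' * blkC γ with hP
    set P' := M * blkB γ + M' * blkD γ with hP'
    have hPi : P i = 0 := h1
    have hPi' : P' i = Pi.single 0 g := h2
    have hg : g ≠ 0 := by
      rintro rfl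
      rw [Pi.single_zero] at hPi'
      have hinv : ∀ v v' : Fin (m + 1) → ℤ, v ᵥ* blkA γ + v' ᵥ* blkC γ = 0 →
          v ᵥ* blkB γ + v' ᵥ* blkD γ = 0 → v = 0 ∧ v' = 0 := by
        intro v v' e1 e2
        obtain ⟨r1, r2⟩ := row_relations' γ
        obtain ⟨r3, r4⟩ := row_relations γ
        constructor
        · have : v = (v ᵥ* blkA γ + v' ᵥ* blkC γ) ᵥ* (blkD γ)ᵀ -
              (v ᵥ* blkB γ + v' ᵥ* blkD γ) ᵥ* (blkC γ)ᵀ := by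
            simp only [Matrix.add_vecMul, Matrix.vecMul_vecMul]
            rw [r3, add_sub_add_right_eq_sub, ← Matrix.vecMul_sub, r2, Matrix.vecMul_one]
          rw [this, e1, e2]; simp
        · have : v' = (v ᵥ* blkB γ + v' ᵥ* blkD γ) ᵥ* (blkA γ)ᵀ -
              (v ᵥ* blkA γ + v' ᵥ* blkC γ) ᵥ* (blkB γ)ᵀ := by
            simp only [Matrix.add_vecMul, Matrix.vecMul_vecMul]
            rw [r1, add_sub_add_left_eq_sub, ← Matrix.vecMul_sub, r4, Matrix.vecMul_one]
          rw [this, e1, e2]; simp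
      obtain ⟨e1, e2⟩ := hinv _ _ h1 (by rw [h2, Pi.single_zero])
      exact hi e1 e2
    -- Isotropy with the reduced row kills the first column.
    have hcol : ∀ j, P j 0 = 0 := by
      intro j
      have := congrArg (fun X => X j i) hiso
      simp only [Matrix.mul_apply, Matrix.transpose_apply, hPi, hPi', Pi.zero_apply, mul_zero,
        Finset.sum_const_zero, Pi.single_apply, mul_ite, Finset.sum_ite_eq', Finset.mem_univ,
        if_true] at this
      exact (mul_eq_zero.1 this).resolve_right hg
    have hiso' : P.submatrix id Fin.succ * (P'.submatrix id Fin.succ)ᵀ =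
        P'.submatrix id Fin.succ * (P.submatrix id Fin.succ)ᵀ := by
      ext j l
      have := congrArg (fun X => X j l) hiso
      simpa [Matrix.mul_apply, Fin.sum_univ_succ, hcol] using this
    obtain ⟨δ, hδ⟩ := exists_sp_mul_eq_zero m _ _ hiso'
    refine ⟨γ * iota δ, ?_⟩
    have e : M * blkA (γ * iota δ) + M' * blkC (γ * iota δ) =
        P * blkA (iota δ) + P' * blkC (iota δ) := by
      rw [blkA_mul, blkC_mul, hP, hP']
      simp only [Matrix.mul_add, Matrix.add_mul, Matrix.mul_assoc]
      abel
    rw [e, blkA_iota, blkC_iota]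
    ext j l
    refine Fin.cases ?_ (fun l => ?_) l
    · simp [Matrix.mul_apply, Fin.sum_univ_succ, hcol]
    · have := congrArg (fun X => X j l) hδ
      simpa [Matrix.mul_apply, Fin.sum_univ_succ, hcol] using this

end IsotropicReduction

/-! ### Splitting the classes of `Sp_{m+1}` over those of `Sp_m` -/

section Splitting

variable {m : ℕ}

/-- `x ∈ Γ_∞ z ι(y)` where `z = (A B; C D)` has `C = c e₀ ᵗq` of rank one with `q` primitive and
`D q = d e₀`. -/
def RankOneSplit (x : Sp (m + 1)) (y : Sp m) (q : Fin (m + 1) → ℤ) (c d : ℤ) : Prop :=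
  (∃ V : Matrix.SpecialLinearGroup (Fin (m + 1)) ℤ,
    (V : Matrix (Fin (m + 1)) (Fin (m + 1)) ℤ) 0 = q) ∧
  ∃ u ∈ GammaInf (m + 1), blkC (u * x * (iota y)⁻¹) = Matrix.vecMulVec (Pi.single 0 c) q ∧
    blkD (u * x * (iota y)⁻¹) *ᵥ q = Pi.single 0 d

/-- The data of a splitting determine the class of `x` modulo `Γ_∞`. -/
theorem RankOneSplit.mul_inv_mem {x x' : Sp (m + 1)} {y : Sp m} {q : Fin (m + 1) → ℤ} {c d : ℤ}
    (h : RankOneSplit x y q c d) (h' : RankOneSplit x' y q c d) : x * x'⁻¹ ∈ GammaInf (m + 1) := by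
  obtain ⟨-, u, hu, hC, hD⟩ := h
  obtain ⟨-, u', hu', hC', hD'⟩ := h'
  have key : (u * x * (iota y)⁻¹) * (u' * x' * (iota y)⁻¹)⁻¹ ∈ GammaInf (m + 1) := by
    rw [mem_GammaInf, blkC_mul, blkA_inv, blkC_inv, hC, hC', Matrix.mul_neg,
      Matrix.transpose_vecMulVec, Matrix.mul_vecMulVec, hD, Matrix.vecMulVec_mul,
      Matrix.vecMul_transpose, hD']
    ext i j
    simp only [Matrix.add_apply, Matrix.neg_apply, Matrix.vecMulVec_apply, Matrix.zero_apply,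
      Pi.single_apply]
    split_ifs <;> ring
  have e : x * x'⁻¹ = u⁻¹ * ((u * x * (iota y)⁻¹) * (u' * x' * (iota y)⁻¹)⁻¹) * u' := by group
  rw [e]
  exact mul_mem (mul_mem (inv_mem hu) key) hu'

/-- Every `x ∈ Sp_{m+1}(ℤ)` splits over some class `Γ_∞ y` of `Sp_m(ℤ)`: reducing the first column
of `C` to a multiple of `e₀`, the remaining rows of `(C D)` are isotropic in the last `2m`
coordinates, and `y` carries them into the standard Lagrangian. -/
theorem exists_split (x : Sp (m + 1)) : ∃ y : Sp m, ∀ p ∈ GammaInf m,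
    x * (iota (p * y))⁻¹ ∈ GammaInf (m + 1) ∨
      ∃ q c d, q 0 ≠ 0 ∧ c ≠ 0 ∧ RankOneSplit x (p * y) q c d := by
  obtain ⟨U, g, hU⟩ := exists_SL_mulVec (fun i => blkC x i 0)
  set U' := ((U⁻¹ : Matrix.SpecialLinearGroup (Fin (m + 1)) ℤ) :
    Matrix (Fin (m + 1)) (Fin (m + 1)) ℤ)
  have hUU : U' * U = 1 := by
    rw [← Matrix.SpecialLinearGroup.coe_mul, inv_mul_cancel]; simp
  set u := levi (U : Matrix (Fin (m + 1)) (Fin (m + 1)) ℤ) U' hUU with hu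
  have hum : u ∈ GammaInf (m + 1) := rfl
  obtain ⟨x1, hx1⟩ : ∃ x1, x1 = u * x := ⟨_, rfl⟩
  have hcol : ∀ i, blkC x1 i 0 = (Pi.single 0 g : Fin (m + 1) → ℤ) i := by
    intro i
    rw [← hU, hx1, blkC_mul]
    simp [hu, levi, Matrix.mul_apply, Matrix.mulVec, dotProduct]
  have hcol' : ∀ i : Fin m, blkC x1 i.succ 0 = 0 := fun i => by rw [hcol]; simp
  have hiso := (row_relations x1).1
  by_cases hg : g = 0
  · have hcol0 : ∀ i, blkC x1 i 0 = 0 := fun i => by rw [hcol, hg]; simp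
    obtain ⟨γ, hγ⟩ := exists_sp_mul_eq_zero m ((blkC x1).submatrix id Fin.succ)
      ((blkD x1).submatrix id Fin.succ) (by
        ext j l
        have := congrArg (fun X => X j l) hiso
        simpa [Matrix.mul_apply, Fin.sum_univ_succ, hcol0] using this)
    refine ⟨γ⁻¹, fun p hp => Or.inl ?_⟩
    have h1 : x1 * iota γ ∈ GammaInf (m + 1) := by
      rw [mem_GammaInf, blkC_mul, blkA_iota, blkC_iota]
      ext j l
      refine Fin.cases ?_ (fun l => ?_) l
      · simp [Matrix.mul_apply, Fin.sum_univ_succ, hcol0]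
      · have := congrArg (fun X => X j l) hγ
        simpa [Matrix.mul_apply, Fin.sum_univ_succ, hcol0] using this
    have e : x * (iota (p * γ⁻¹))⁻¹ = u⁻¹ * (x1 * iota γ) * (iota p)⁻¹ := by
      rw [hx1, map_mul, map_inv]; group
    rw [e]
    exact mul_mem (mul_mem (inv_mem hum) h1) (inv_mem (iota_mem_GammaInf hp))
  · obtain ⟨γ, hγ⟩ := exists_sp_mul_eq_zero m ((blkC x1).submatrix Fin.succ Fin.succ)
      ((blkD x1).submatrix Fin.succ Fin.succ) (by
        ext j l
        have := congrArg (fun X => X j.succ l.succ) hiso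
        simpa [Matrix.mul_apply, Fin.sum_univ_succ, hcol'] using this)
    refine ⟨γ⁻¹, fun p hp => Or.inr ?_⟩
    have hpi := inv_mem (iota_mem_GammaInf hp)
    obtain ⟨z, hz⟩ : ∃ z, z = x1 * iota γ := ⟨_, rfl⟩
    have hzrow : ∀ (i : Fin m) l, blkC z i.succ l = 0 := by
      intro i l
      rw [hz, blkC_mul, blkA_iota, blkC_iota]
      refine Fin.cases ?_ (fun l => ?_) l
      · simp [Matrix.mul_apply, Fin.sum_univ_succ, hcol']
      · have := congrArg (fun X => X i l) hγ
        simpa [Matrix.mul_apply, Fin.sum_univ_succ, hcol'] using this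
    have hz00 : blkC z 0 0 = g := by
      rw [hz, blkC_mul, blkA_iota, blkC_iota]
      simp [Matrix.mul_apply, Fin.sum_univ_succ, hcol]
    obtain ⟨z', hz'⟩ : ∃ z', z' = z * (iota p)⁻¹ := ⟨_, rfl⟩
    have hCz' : blkC z' = blkC z * blkA (iota p⁻¹) := by
      rw [hz', blkC_mul, mem_GammaInf.1 hpi, Matrix.mul_zero, add_zero, map_inv]
    have hrow' : ∀ (i : Fin m) l, blkC z' i.succ l = 0 := by
      intro i l
      rw [hCz']; simp [Matrix.mul_apply, hzrow]
    have h00' : blkC z' 0 0 = g := by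
      rw [hCz', blkA_iota]; simp [Matrix.mul_apply, Fin.sum_univ_succ, hz00]
    obtain ⟨V, c, hV⟩ := exists_SL_vecMul (blkC z' 0)
    set q := ((V⁻¹ : Matrix.SpecialLinearGroup (Fin (m + 1)) ℤ) :
      Matrix (Fin (m + 1)) (Fin (m + 1)) ℤ) 0 with hq
    have hw : blkC z' 0 = c • q := by
      have h1 : (blkC z' 0 ᵥ* (V : Matrix (Fin (m + 1)) (Fin (m + 1)) ℤ)) ᵥ*
          ((V⁻¹ : Matrix.SpecialLinearGroup (Fin (m + 1)) ℤ) :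
            Matrix (Fin (m + 1)) (Fin (m + 1)) ℤ) = blkC z' 0 := by
        rw [Matrix.vecMul_vecMul, ← Matrix.SpecialLinearGroup.coe_mul, mul_inv_cancel]
        simp
      rw [← h1, hV]
      ext j
      simp [hq]
    have hcq : c * q 0 = g := by
      rw [← h00', hw]; rfl
    have hc : c ≠ 0 := by rintro rfl; exact hg (by rw [← hcq, zero_mul])
    have hq0 : q 0 ≠ 0 := by intro h; exact hg (by rw [← hcq, h, mul_zero])
    have hCv : blkC z' = Matrix.vecMulVec (Pi.single 0 c) q := by
      ext i l
      refine Fin.cases ?_ (fun i => ?_) i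
      · rw [hw]; simp [Matrix.vecMulVec_apply]
      · rw [hrow']; simp [Matrix.vecMulVec_apply]
    have hDq : blkD z' *ᵥ q = Pi.single 0 ((blkD z' *ᵥ q) 0) := by
      have h1 := (row_relations z').1
      rw [hCv, Matrix.transpose_vecMulVec, Matrix.mul_vecMulVec, Matrix.vecMulVec_mul,
        Matrix.vecMul_transpose] at h1
      ext i
      refine Fin.cases ?_ (fun i => ?_) i
      · simp
      · have h2 := congrArg (fun X => X i.succ 0) h1
        simp only [Matrix.vecMulVec_apply, Pi.single_eq_same,
          Pi.single_eq_of_ne (Fin.succ_ne_zero i), zero_mul] at h2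
        rw [Pi.single_eq_of_ne (Fin.succ_ne_zero i)]
        exact (mul_eq_zero.1 h2.symm).resolve_right hc
    have e : z' = u * x * (iota (p * γ⁻¹))⁻¹ := by
      rw [hz', hz, hx1, map_mul, map_inv]; group
    exact ⟨q, c, _, hq0, hc, ⟨V⁻¹, hq.symm⟩, u, hum, by rw [← e]; exact hCv, by rw [← e]; exact hDq⟩

/-- The factor `c τ[q] + d` of the automorphy factor, for `τ = diag(i, τ')`. -/
noncomputable def splitFactor (τ' : Matrix (Fin m) (Fin m) ℂ) (q : Fin (m + 1) → ℤ) (c d : ℤ) : ℂ :=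
  c * ((fun i => (q i : ℂ)) ⬝ᵥ (bl Complex.I τ' *ᵥ fun i => (q i : ℂ))) + d

/-- In a basis that contains the primitive vector `q`, the automorphy factor of `z` is
`c τ[q] + d` times an integral minor of `D`, and that minor is nonzero because the automorphy factor
is. -/
theorem RankOneSplit.norm_jdet_ge {x : Sp (m + 1)} {y : Sp m} {q : Fin (m + 1) → ℤ} {c d : ℤ}
    (h : RankOneSplit x y q c d) :
    ‖jdet y (iPt m)‖ * ‖splitFactor (moebius y (iPt m)).1 q c d‖ ≤ ‖jdet x (iPt (m + 1))‖ := by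
  obtain ⟨⟨V, hV⟩, u, hu, hC, hD⟩ := h
  obtain ⟨z, hz⟩ : ∃ z, z = u * x * (iota y)⁻¹ := ⟨_, rfl⟩
  rw [← hz] at hC hD
  have hx : ‖jdet x (iPt (m + 1))‖ =
      ‖jdet z (moebius (iota y) (iPt (m + 1)))‖ * ‖jdet y (iPt m)‖ := by
    have e : u * x = z * iota y := by rw [hz]; group
    rw [← norm_jdet_of_mem_mul hu, e, jdet_mul, norm_mul, jdet_iota_iPt]
  set τ := moebius (iota y) (iPt (m + 1)) with hτ
  have hτv : τ.1 = bl Complex.I (moebius y (iPt m)).1 := moebius_iota_iPt y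
  set Vm : Matrix (Fin (m + 1)) (Fin (m + 1)) ℤ := (V : Matrix (Fin (m + 1)) (Fin (m + 1)) ℤ)
  set Δ := ((blkD z * Vmᵀ).submatrix Fin.succ Fin.succ).det with hΔ
  have hCc : toC (blkC z) = Matrix.vecMulVec (Pi.single 0 (c : ℂ)) (fun i => (q i : ℂ)) := by
    rw [hC]
    ext i j
    simp [toC, Matrix.vecMulVec_apply, Pi.single_apply]
  have hVq : ∀ M : Matrix (Fin (m + 1)) (Fin (m + 1)) ℂ, ∀ i,
      (M * toC Vmᵀ) i 0 = (M *ᵥ fun i => (q i : ℂ)) i := by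
    intro M i
    rw [Matrix.mul_apply, Matrix.mulVec, dotProduct]
    refine Finset.sum_congr rfl fun l _ => ?_
    rw [← hV]; rfl
  have hDc : toC (blkD z) *ᵥ (fun i => (q i : ℂ)) = Pi.single 0 (d : ℂ) := by
    funext i
    have := congrFun hD i
    have h2 := congrArg (Int.cast : ℤ → ℂ) this
    rw [Pi.single_apply] at h2
    simp only [Matrix.mulVec, dotProduct, Int.cast_sum, Int.cast_mul, Int.cast_ite,
      Int.cast_zero] at h2
    rw [Pi.single_apply, ← h2]
    rfl
  have hcol : ∀ i, (denom z τ.1 * toC Vmᵀ) i 0 =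
      (Pi.single 0 (splitFactor (moebius y (iPt m)).1 q c d) : Fin (m + 1) → ℂ) i := by
    intro i
    rw [hVq, denom, Matrix.add_mulVec, hDc, ← Matrix.mulVec_mulVec, hCc, Matrix.vecMulVec_mulVec,
      hτv]
    refine Fin.cases ?_ (fun i => ?_) i
    · simp [splitFactor]
      ring
    · simp
  have hsub : (denom z τ.1 * toC Vmᵀ).submatrix Fin.succ Fin.succ =
      toC ((blkD z * Vmᵀ).submatrix Fin.succ Fin.succ) := by
    have e1 : toC ((blkD z * Vmᵀ).submatrix Fin.succ Fin.succ) =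
        (toC (blkD z) * toC Vmᵀ).submatrix Fin.succ Fin.succ := by
      rw [← toC_mul]; rfl
    rw [e1, denom, Matrix.add_mul, hCc, Matrix.vecMulVec_mul, Matrix.vecMulVec_mul]
    ext i j
    simp [Matrix.vecMulVec_apply]
  have hdet : jdet z τ = splitFactor (moebius y (iPt m)).1 q c d * Δ := by
    have h1 : (denom z τ.1 * toC Vmᵀ).det = jdet z τ := by
      rw [Matrix.det_mul, det_toC, Matrix.det_transpose, V.det_coe, jdet]; simp
    rw [← h1, det_of_column_zero _ fun i => by rw [hcol]; simp, hsub, det_toC, hcol]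
    simp [hΔ]
  have hΔ0 : Δ ≠ 0 := by
    intro h0
    exact jdet_ne_zero z τ (by rw [hdet, h0]; simp)
  have hΔ1 : (1 : ℝ) ≤ ‖(Δ : ℂ)‖ := by
    rw [Complex.norm_intCast]
    exact_mod_cast Int.one_le_abs hΔ0
  rw [hx, hdet, norm_mul]
  have := mul_le_mul_of_nonneg_left hΔ1
    (mul_nonneg (norm_nonneg (jdet y (iPt m)))
      (norm_nonneg (splitFactor (moebius y (iPt m)).1 q c d)))
  nlinarith

end Splitting


/-! ### Sums over lattices -/

section LatticeSums

open MeasureTheory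

/-- Casting integral vectors to real ones. -/
abbrev zvec {m : ℕ} (x : Fin m → ℤ) : Fin m → ℝ := fun i => (x i : ℝ)

/-- The unit cube with integral lower corner `x`. -/
def unitCube {m : ℕ} (x : Fin m → ℤ) : Set (Fin m → ℝ) :=
  Set.pi Set.univ fun i => Set.Ico (x i : ℝ) (x i + 1)

theorem measurableSet_unitCube {m : ℕ} (x : Fin m → ℤ) : MeasurableSet (unitCube x) :=
  MeasurableSet.pi Set.countable_univ fun _ _ => measurableSet_Ico

theorem volume_unitCube_zero {m : ℕ} : volume (unitCube (0 : Fin m → ℤ)) = 1 := by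
  rw [unitCube, Real.volume_pi_Ico]
  simp

theorem tsum_setLIntegral_le {m : ℕ} (f : (Fin m → ℝ) → ENNReal) :
    ∑' x : Fin m → ℤ, ∫⁻ y in unitCube 0, f (y + zvec x) ≤ ∫⁻ y, f y := by
  have hdisj : Pairwise (Function.onFun Disjoint fun x : Fin m → ℤ => unitCube x) := by
    intro x x' hne
    rw [Function.onFun, Set.disjoint_left]
    intro v hv hv'
    apply hne
    funext i
    have h1 := hv i (Set.mem_univ i)
    have h2 := hv' i (Set.mem_univ i)
    rw [← Int.floor_eq_iff.2 h1, ← Int.floor_eq_iff.2 h2]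
  calc _ = ∑' x : Fin m → ℤ, ∫⁻ y in unitCube x, f y := by
        refine tsum_congr fun x => ?_
        have h := (measurePreserving_add_right volume (zvec x)).setLIntegral_comp_preimage_emb
          (measurableEmbedding_addRight _) f (unitCube x)
        have e : unitCube (0 : Fin m → ℤ) = (fun v => v + zvec x) ⁻¹' unitCube x := by
          ext v
          simp only [unitCube, zvec, Set.mem_pi, Set.mem_univ, true_imp_iff, Set.mem_Ico,
            Set.mem_preimage, Pi.add_apply, Pi.zero_apply, Int.cast_zero]
          refine forall_congr' fun i => ?_
          constructor <;> rintro ⟨h1, h2⟩ <;> constructor <;> linarith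
        rw [← h, ← e]
    _ = ∫⁻ y in ⋃ x : Fin m → ℤ, unitCube x, f y :=
        (lintegral_iUnion (fun x => measurableSet_unitCube x) hdisj f).symm
    _ ≤ ∫⁻ y, f y := setLIntegral_le_lintegral _ _

/-- A lattice sum is bounded by an integral when the summand varies slowly on a set whose
translates by the lattice cover the space. -/
theorem tsum_le_lintegral {m : ℕ} {f : (Fin m → ℝ) → ENNReal} (hfm : Measurable f)
    {C : ENNReal} {B : Set (Fin m → ℝ)} (hcov : ∀ v, ∃ x : Fin m → ℤ, v - zvec x ∈ B)
    (hf : ∀ v, ∀ b ∈ B, f v ≤ C * f (v + b)) (v₀ : Fin m → ℝ) :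
    ∑' x : Fin m → ℤ, f (v₀ + zvec x) ≤ C * ∫⁻ y, f y := by
  have key : ∀ y, ∑' x : Fin m → ℤ, f (v₀ + zvec x) ≤ C * ∑' x : Fin m → ℤ, f (y + zvec x) := by
    intro y
    obtain ⟨x₀, hx₀⟩ := hcov (y - v₀)
    rw [← ENNReal.tsum_mul_left, ← (Equiv.addRight x₀).tsum_eq (fun x => f (v₀ + zvec x))]
    refine ENNReal.tsum_le_tsum fun x => ?_
    refine (hf _ _ hx₀).trans (le_of_eq ?_)
    congr 2
    funext i
    simp [zvec]
    ring
  calc ∑' x : Fin m → ℤ, f (v₀ + zvec x)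
      = ∫⁻ _ in unitCube (0 : Fin m → ℤ), ∑' x : Fin m → ℤ, f (v₀ + zvec x) := by
        rw [setLIntegral_const, volume_unitCube_zero, mul_one]
    _ ≤ ∫⁻ y in unitCube (0 : Fin m → ℤ), C * ∑' x : Fin m → ℤ, f (y + zvec x) :=
        lintegral_mono fun y => key y
    _ = C * ∑' x : Fin m → ℤ, ∫⁻ y in unitCube 0, f (y + zvec x) := by
        rw [lintegral_const_mul, lintegral_tsum]
        · exact fun x => (hfm.comp (measurable_add_const _)).aemeasurable
        · exact Measurable.tsum fun x => hfm.comp (measurable_add_const _)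
    _ ≤ C * ∫⁻ y, f y := by gcongr; exact tsum_setLIntegral_le f

/-- The integral of `(1 + |w|²)^{-s}` over `ℝ^m`. -/
noncomputable def japaneseIntegral (m s : ℕ) : ENNReal :=
  ∫⁻ w : Fin m → ℝ, ENNReal.ofReal (((1 + w ⬝ᵥ w) ^ s)⁻¹)

theorem japaneseIntegral_ne_top {m s : ℕ} (h : m < 2 * s) : japaneseIntegral m s ≠ ⊤ := by
  have hint := integrable_rpow_neg_one_add_norm_sq (E := Fin m → ℝ) (μ := volume)
    (r := (2 * s : ℕ)) (by rw [Module.finrank_fin_fun]; exact_mod_cast h)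
  have hlt := hint.lintegral_lt_top
  refine ne_top_of_le_ne_top hlt.ne (lintegral_mono fun w => ENNReal.ofReal_le_ofReal ?_)
  have hnorm : ‖w‖ ^ 2 ≤ w ⬝ᵥ w := by
    have h0 : 0 ≤ w ⬝ᵥ w := Finset.sum_nonneg fun i _ => mul_self_nonneg _
    have h1 : ‖w‖ ≤ Real.sqrt (w ⬝ᵥ w) := by
      refine (pi_norm_le_iff_of_nonneg (Real.sqrt_nonneg _)).2 fun i => ?_
      refine Real.le_sqrt_of_sq_le ?_
      rw [Real.norm_eq_abs, sq_abs, sq]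
      exact Finset.single_le_sum (f := fun i => w i * w i) (fun i _ => mul_self_nonneg _)
        (Finset.mem_univ i)
    calc ‖w‖ ^ 2 ≤ Real.sqrt (w ⬝ᵥ w) ^ 2 := by gcongr
      _ = _ := Real.sq_sqrt h0
  have e : (1 + ‖w‖ ^ 2) ^ (-((2 * s : ℕ) : ℝ) / 2) = ((1 + ‖w‖ ^ 2) ^ s)⁻¹ := by
    rw [show -((2 * s : ℕ) : ℝ) / 2 = -(s : ℝ) by push_cast; ring, Real.rpow_neg (by positivity),
      Real.rpow_natCast]
  rw [e]
  gcongr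

open scoped MatrixOrder in
theorem exists_transpose_mul_self {m : ℕ} {Y : Matrix (Fin m) (Fin m) ℝ} (hY : Y.PosDef) :
    ∃ A : Matrix (Fin m) (Fin m) ℝ, Y = Aᵀ * A := by
  have h0 : 0 ≤ Y := Matrix.nonneg_iff_posSemidef.2 hY.posSemidef
  obtain ⟨A, hA⟩ := CStarAlgebra.nonneg_iff_eq_star_mul_self.1 h0
  refine ⟨A, ?_⟩
  rw [hA, Matrix.star_eq_conjTranspose, Matrix.conjTranspose_eq_transpose_of_trivial]

theorem quadForm_transpose_mul_self {m : ℕ} (A : Matrix (Fin m) (Fin m) ℝ) (v : Fin m → ℝ) :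
    v ⬝ᵥ ((Aᵀ * A) *ᵥ v) = (A *ᵥ v) ⬝ᵥ (A *ᵥ v) := by
  rw [← Matrix.mulVec_mulVec, Matrix.dotProduct_mulVec, Matrix.vecMul_transpose]

/-- If the translates of the ellipsoid `Y[v] ≤ ρ` by `ℤ^m` cover `ℝ^m`, then
`∑ (1 + Y[x])^{-s} ≪ (det Y)^{-1/2}` with a constant independent of `Y`. -/
theorem tsum_quadForm_le {m s : ℕ} {Y : Matrix (Fin m) (Fin m) ℝ} (hY : Y.PosDef) {ρ : ℝ}
    (hcov : ∀ v : Fin m → ℝ, ∃ x : Fin m → ℤ, (v - zvec x) ⬝ᵥ (Y *ᵥ (v - zvec x)) ≤ ρ)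
    (v₀ : Fin m → ℝ) :
    ∑' x : Fin m → ℤ,
        ENNReal.ofReal (((1 + (v₀ + zvec x) ⬝ᵥ (Y *ᵥ (v₀ + zvec x))) ^ s)⁻¹) ≤
      ENNReal.ofReal ((2 + 2 * ρ) ^ s) *
        (ENNReal.ofReal ((Real.sqrt Y.det)⁻¹) * japaneseIntegral m s) := by
  obtain ⟨A, hA⟩ := exists_transpose_mul_self hY
  have hYq : ∀ v, v ⬝ᵥ (Y *ᵥ v) = (A *ᵥ v) ⬝ᵥ (A *ᵥ v) := fun v => by
    rw [hA, quadForm_transpose_mul_self]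
  have hsq : ∀ w : Fin m → ℝ, 0 ≤ w ⬝ᵥ w := fun w => Finset.sum_nonneg fun i _ => mul_self_nonneg _
  have hρ : 0 ≤ ρ := by
    obtain ⟨x, hx⟩ := hcov 0
    rw [hYq] at hx
    exact (hsq _).trans hx
  have hdet : |A.det| = Real.sqrt Y.det := by
    rw [hA, Matrix.det_mul, Matrix.det_transpose, Real.sqrt_mul_self_eq_abs]
  have hdet0 : A.det ≠ 0 := by
    intro h0
    have := hY.det_pos
    rw [hA, Matrix.det_mul, h0, mul_zero] at this
    exact lt_irrefl _ this
  set g : (Fin m → ℝ) → ENNReal := fun w => ENNReal.ofReal (((1 + w ⬝ᵥ w) ^ s)⁻¹) with hg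
  have hgm : Measurable g := by
    refine ENNReal.measurable_ofReal.comp (Measurable.inv (Measurable.pow_const ?_ _))
    simp only [dotProduct]
    fun_prop
  have hAm : Measurable (Matrix.toLin' A) := by
    exact (LinearMap.continuous_of_finiteDimensional _).measurable
  have hint : ∫⁻ v, g (A *ᵥ v) = ENNReal.ofReal ((Real.sqrt Y.det)⁻¹) * japaneseIntegral m s := by
    have h1 := lintegral_map (μ := volume) hgm hAm
    rw [Real.map_matrix_volume_pi_eq_smul_volume_pi hdet0, lintegral_smul_measure] at h1
    simp only [Matrix.toLin'_apply] at h1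
    rw [← h1, abs_inv, hdet]
    rfl
  rw [← hint]
  simp only [hYq]
  refine tsum_le_lintegral (f := fun v => g (A *ᵥ v)) (hgm.comp hAm)
    (B := {v | v ⬝ᵥ (Y *ᵥ v) ≤ ρ}) hcov ?_ v₀
  intro v b hb
  change b ⬝ᵥ (Y *ᵥ b) ≤ ρ at hb
  rw [hYq] at hb
  simp only [hg]
  rw [← ENNReal.ofReal_mul (by positivity)]
  refine ENNReal.ofReal_le_ofReal ?_
  rw [Matrix.mulVec_add]
  set p := A *ᵥ v
  set r := A *ᵥ b
  have h1 : (p + r) ⬝ᵥ (p + r) ≤ 2 * (p ⬝ᵥ p) + 2 * (r ⬝ᵥ r) := by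
    have h2 := hsq (p - r)
    simp only [sub_dotProduct, dotProduct_sub] at h2
    simp only [add_dotProduct, dotProduct_add]
    linarith
  have hp := hsq p
  have h3 : 1 + (p + r) ⬝ᵥ (p + r) ≤ (2 + 2 * ρ) * (1 + p ⬝ᵥ p) := by nlinarith
  have h4 := hsq (p + r)
  rw [← div_eq_mul_inv, le_div_iff₀ (by positivity), inv_mul_le_iff₀ (by positivity), ← mul_pow,
    mul_comm (1 + p ⬝ᵥ p)]
  gcongr

/-- `∑_d (1 + ((x+d)/t)²)⁻¹ ≪ t` for `t ≥ 1`. -/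
theorem tsum_int_le {t : ℝ} (ht : 1 ≤ t) (x : ℝ) :
    ∑' d : ℤ, ENNReal.ofReal ((1 + ((x + d) / t) ^ 2)⁻¹) ≤
      ENNReal.ofReal 4 * (ENNReal.ofReal t * japaneseIntegral 1 1) := by
  have ht0 : 0 < t := by linarith
  have hY : (Matrix.diagonal fun _ : Fin 1 => (t ^ 2)⁻¹).PosDef :=
    Matrix.PosDef.diagonal fun _ => by positivity
  have hq : ∀ v : Fin 1 → ℝ, v ⬝ᵥ ((Matrix.diagonal fun _ : Fin 1 => (t ^ 2)⁻¹) *ᵥ v) =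
      (v 0 / t) ^ 2 := by
    intro v
    simp [Matrix.mulVec_diagonal, dotProduct]
    field_simp
  have h := tsum_quadForm_le (s := 1) hY (ρ := 1) (fun v => ⟨fun _ => ⌊v 0⌋, by
    rw [hq]
    have h1 := Int.floor_le (v 0)
    have h2 := Int.lt_floor_add_one (v 0)
    rw [sq_le_one_iff_abs_le_one, abs_div, abs_of_pos ht0, div_le_one ht0]
    refine le_trans (abs_le.2 ?_) ht
    simp only [Pi.sub_apply, zvec]
    constructor <;> linarith⟩) (fun _ => x)
  simp only [hq, pow_one, Matrix.det_diagonal, Finset.univ_unique, Finset.prod_singleton] at h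
  rw [Real.sqrt_inv, Real.sqrt_sq ht0.le, inv_inv] at h
  rw [← (Equiv.funUnique (Fin 1) ℤ).tsum_eq]
  rw [show (4 : ℝ) = 2 + 2 * 1 by norm_num]
  convert h using 3
  rfl

end LatticeSums


/-! ### The covering radius of `Im(y i)` -/

section Covering

variable {m : ℕ}

theorem quadForm_nonneg {Y : Matrix (Fin m) (Fin m) ℝ} (hY : Y.PosDef) (v : Fin m → ℝ) :
    0 ≤ v ⬝ᵥ (Y *ᵥ v) := by
  simpa using hY.posSemidef.dotProduct_mulVec_nonneg v

theorem re_quadForm {Y : Matrix (Fin m) (Fin m) ℝ} (p : Fin m → ℂ) :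
    (star p ⬝ᵥ (Y.map Complex.ofReal *ᵥ p)).re =
      (fun i => (p i).re) ⬝ᵥ (Y *ᵥ fun i => (p i).re) +
        (fun i => (p i).im) ⬝ᵥ (Y *ᵥ fun i => (p i).im) := by
  simp only [dotProduct, Matrix.mulVec, Finset.mul_sum, Complex.re_sum, ← Finset.sum_add_distrib]
  refine Finset.sum_congr rfl fun i _ => Finset.sum_congr rfl fun j _ => ?_
  simp

/-- Translates of the ellipsoid `Im(y i)[v] ≤ 2m` by the lattice cover the space, uniformly in
`y ∈ Sp_m(ℤ)`: since `D ᵗA - C ᵗB = 1`, one has `v = C z₁ + D z₂` for suitable real `z₁, z₂`,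
which may be reduced modulo integral vectors. -/
theorem exists_int_quadForm_le (y : Sp m) (v : Fin m → ℝ) :
    ∃ x : Fin m → ℤ, (v - zvec x) ⬝ᵥ
      ((moebius y (iPt m)).1.map Complex.im *ᵥ (v - zvec x)) ≤ 2 * m := by
  set Q := denom y (iPt m).1 with hQ
  have hQd : IsUnit Q.det := (Matrix.isUnit_iff_isUnit_det _).1 (denom_isUnit y (iPt m))
  set Y := (moebius y (iPt m)).1.map Complex.im with hY
  have hYp : Y.PosDef := (moebius y (iPt m)).2.2
  set z1 : Fin m → ℝ := -(((blkB y).map (Int.cast : ℤ → ℝ))ᵀ *ᵥ v) with hz1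
  set z2 : Fin m → ℝ := ((blkA y).map (Int.cast : ℤ → ℝ))ᵀ *ᵥ v with hz2
  have hv : (blkC y).map (Int.cast : ℤ → ℝ) *ᵥ z1 + (blkD y).map (Int.cast : ℤ → ℝ) *ᵥ z2 = v := by
    have h1 := congrArg (fun M => M.map (Int.castRingHom ℝ)) (row_relations y).2
    have h2 : (blkD y).map (Int.cast : ℤ → ℝ) * ((blkA y).map (Int.cast : ℤ → ℝ))ᵀ -
        (blkC y).map (Int.cast : ℤ → ℝ) * ((blkB y).map (Int.cast : ℤ → ℝ))ᵀ = 1 := by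
      ext i j
      have h3 := congrArg (fun M => M i j) h1
      simpa [Matrix.mul_apply, Matrix.one_apply, apply_ite] using h3
    rw [hz1, hz2, Matrix.mulVec_neg, Matrix.mulVec_mulVec, Matrix.mulVec_mulVec, neg_add_eq_sub,
      ← Matrix.sub_mulVec, h2, Matrix.one_mulVec]
  refine ⟨fun i => (blkC y *ᵥ fun j => ⌊z1 j⌋) i + (blkD y *ᵥ fun j => ⌊z2 j⌋) i, ?_⟩
  set w : Fin m → ℂ := fun j =>
    ((Int.fract (z2 j) : ℝ) : ℂ) - Complex.I * ((Int.fract (z1 j) : ℝ) : ℂ) with hw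
  have hre : (fun i => ((Q *ᵥ w) i).re) =
      v - zvec (fun i => (blkC y *ᵥ fun j => ⌊z1 j⌋) i + (blkD y *ᵥ fun j => ⌊z2 j⌋) i) := by
    funext i
    have hvi := congrFun hv i
    simp only [Pi.sub_apply]
    rw [← hvi]
    simp only [hQ, denom_iPt, Matrix.mulVec, dotProduct, Pi.add_apply, Complex.re_sum, zvec,
      Int.cast_add, Int.cast_sum, Int.cast_mul, ← Finset.sum_add_distrib, ← Finset.sum_sub_distrib]
    refine Finset.sum_congr rfl fun j _ => ?_
    have e1 : (w j).re = Int.fract (z2 j) := by simp [hw]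
    have e2 : (w j).im = -Int.fract (z1 j) := by simp [hw]
    have e3 : (Complex.I * (blkC y i j : ℂ) + (blkD y i j : ℂ)).re = blkD y i j := by simp
    have e4 : (Complex.I * (blkC y i j : ℂ) + (blkD y i j : ℂ)).im = blkC y i j := by simp
    change ((Complex.I * (blkC y i j : ℂ) + (blkD y i j : ℂ)) * w j).re = _
    rw [Complex.mul_re, e1, e2, e3, e4]
    simp only [Int.fract, Matrix.map_apply]
    ring
  have hform : (star (Q *ᵥ w) ⬝ᵥ (Y.map Complex.ofReal *ᵥ (Q *ᵥ w))) = star w ⬝ᵥ w := by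
    have h := im_moebius y (iPt m)
    rw [im_iPt, Matrix.map_one _ (by simp) (by simp), Matrix.mul_one] at h
    rw [hY, h, ← Matrix.mulVec_mulVec, ← hQ, Matrix.mulVec_mulVec w Q⁻¹ Q,
      Matrix.nonsing_inv_mul _ hQd, Matrix.one_mulVec, Matrix.star_mulVec, Matrix.dotProduct_mulVec,
      Matrix.vecMul_vecMul, ← Matrix.conjTranspose_mul, Matrix.nonsing_inv_mul _ hQd]
    simp
  have h := re_quadForm (Y := Y) (Q *ᵥ w)
  rw [hform, hre] at h
  have h1 := quadForm_nonneg hYp (fun i => ((Q *ᵥ w) i).im)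
  have h2 : (star w ⬝ᵥ w).re ≤ 2 * m := by
    simp only [dotProduct, Complex.re_sum]
    calc _ ≤ ∑ _ : Fin m, (2 : ℝ) := Finset.sum_le_sum fun i _ => by
          have f1 := Int.fract_nonneg (z1 i)
          have f2 := Int.fract_nonneg (z2 i)
          have g1 := (Int.fract_lt_one (z1 i)).le
          have g2 := (Int.fract_lt_one (z2 i)).le
          simp [hw]
          nlinarith
      _ = 2 * m := by simp [mul_comm]
  linarith

end Covering

/-! ### Sums of the splitting factors -/

section Weights

variable {m : ℕ}

/-- The contribution of the data `(q, c, d)`, `q = (a, q')`, to the majorant of the Eisenstein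
series of degree `m + 1` over the class of `y`. -/
noncomputable def splitWeight (y : Sp m) (c a : ℤ) (q' : Fin m → ℤ) (d : ℤ) : ENNReal :=
  if c = 0 ∨ a = 0 then 0 else
    ENNReal.ofReal ((‖splitFactor (moebius y (iPt m)).1 (Fin.cons a q') c d‖ ^ (m + 3))⁻¹)

theorem splitFactor_eq (τ' : Matrix (Fin m) (Fin m) ℂ) (a : ℤ) (q' : Fin m → ℤ) (c d : ℤ) :
    splitFactor τ' (Fin.cons a q') c d =
      ((c * (zvec q' ⬝ᵥ (τ'.map Complex.re *ᵥ zvec q')) + d : ℝ) : ℂ) +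
      ((c * (a ^ 2 + zvec q' ⬝ᵥ (τ'.map Complex.im *ᵥ zvec q')) : ℝ) : ℂ) * Complex.I := by
  have ha : ((a : ℂ) ^ 2).im = 0 ∧ ((a : ℂ) ^ 2).re = (a : ℝ) ^ 2 := by
    constructor <;> simp [sq]
  apply Complex.ext
  · simp [splitFactor, dotProduct, Matrix.mulVec, Fin.sum_univ_succ, ha.1]
  · simp [splitFactor, dotProduct, Matrix.mulVec, Fin.sum_univ_succ, ha.2, ← sq]

/-- For fixed `q` and `c` the sum over `d` runs along a horizontal line at height
`T = |c| (a² + Im τ'[q'])`, which makes it `O(T^{-(m+2)})`; the powers of `|c|`, `a²` and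
`1 + Im τ'[q']` are then separated. -/
theorem tsum_splitWeight_d (y : Sp m) {c a : ℤ} (hc : c ≠ 0) (ha : a ≠ 0) (q' : Fin m → ℤ) :
    ∑' d : ℤ, splitWeight y c a q' d ≤
      ENNReal.ofReal 4 * japaneseIntegral 1 1 * (ENNReal.ofReal ((c : ℝ) ^ 2)⁻¹ *
        (ENNReal.ofReal ((a : ℝ) ^ 2)⁻¹ * ENNReal.ofReal ((1 + zvec q' ⬝ᵥ
          ((moebius y (iPt m)).1.map Complex.im *ᵥ zvec q')) ^ (m + 1))⁻¹)) := by
  set τ' := (moebius y (iPt m)).1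
  set u := zvec q' ⬝ᵥ (τ'.map Complex.im *ᵥ zvec q') with hu
  set x := (c : ℝ) * (zvec q' ⬝ᵥ (τ'.map Complex.re *ᵥ zvec q')) with hx
  have hu0 : 0 ≤ u := quadForm_nonneg (moebius y (iPt m)).2.2 _
  have hc1 : (1 : ℝ) ≤ |(c : ℝ)| := by exact_mod_cast Int.one_le_abs hc
  have ha1 : (1 : ℝ) ≤ (a : ℝ) ^ 2 := by
    have : (1 : ℝ) ≤ |(a : ℝ)| := by exact_mod_cast Int.one_le_abs ha
    rw [← sq_abs]; nlinarith
  set t := (a : ℝ) ^ 2 + u with ht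
  have ht1 : 1 ≤ t := by linarith
  set T := |(c : ℝ)| * t with hT
  have hT1 : 1 ≤ T := by nlinarith
  have hT0 : 0 < T := by linarith
  have hterm : ∀ d : ℤ, splitWeight y c a q' d ≤
      ENNReal.ofReal ((T ^ (m + 3))⁻¹) * ENNReal.ofReal ((1 + ((x + d) / T) ^ 2)⁻¹) := by
    intro d
    rw [splitWeight, if_neg (by tauto), ← ENNReal.ofReal_mul (by positivity), ← mul_inv]
    refine ENNReal.ofReal_le_ofReal (inv_anti₀ (by positivity) ?_)
    set F := splitFactor τ' (Fin.cons a q') c d with hF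
    have hF2 : ‖F‖ ^ 2 = T ^ 2 * (1 + ((x + d) / T) ^ 2) := by
      have e : T ^ 2 = (c * t) ^ 2 := by rw [hT, mul_pow, sq_abs, mul_pow]
      have e2 : T ^ 2 * (1 + ((x + d) / T) ^ 2) = T ^ 2 + (x + d) ^ 2 := by field_simp
      rw [e2, e, hF, splitFactor_eq, ← Complex.normSq_eq_norm_sq, Complex.normSq_add_mul_I]
      ring
    have hFT : T ≤ ‖F‖ := by
      refine le_of_sq_le_sq ?_ (norm_nonneg _)
      rw [hF2]
      nlinarith [sq_nonneg ((x + d) / T), sq_nonneg T]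
    calc T ^ (m + 3) * (1 + ((x + d) / T) ^ 2) = T ^ (m + 1) * ‖F‖ ^ 2 := by rw [hF2]; ring
      _ ≤ ‖F‖ ^ (m + 1) * ‖F‖ ^ 2 := by gcongr
      _ = ‖F‖ ^ (m + 3) := by ring
  refine (ENNReal.tsum_le_tsum hterm).trans ?_
  rw [ENNReal.tsum_mul_left]
  refine (mul_le_mul_right (tsum_int_le hT1 x) _).trans ?_
  have hfin : ENNReal.ofReal ((T ^ (m + 3))⁻¹) * ENNReal.ofReal T ≤
      ENNReal.ofReal ((c : ℝ) ^ 2)⁻¹ *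
        (ENNReal.ofReal ((a : ℝ) ^ 2)⁻¹ * ENNReal.ofReal ((1 + u) ^ (m + 1))⁻¹) := by
    rw [← ENNReal.ofReal_mul (by positivity), ← ENNReal.ofReal_mul (by positivity),
      ← ENNReal.ofReal_mul (by positivity), ← mul_inv, ← mul_inv]
    refine ENNReal.ofReal_le_ofReal ?_
    have e : (T ^ (m + 3))⁻¹ * T = (T ^ (m + 2))⁻¹ := by field_simp; ring
    rw [e]
    refine inv_anti₀ (by positivity) ?_
    rw [hT, mul_pow, ← sq_abs (c : ℝ)]
    have h1 : |(c : ℝ)| ^ 2 ≤ |(c : ℝ)| ^ (m + 2) := pow_le_pow_right₀ hc1 (by omega)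
    have h2 : (a : ℝ) ^ 2 * (1 + u) ^ (m + 1) ≤ t ^ (m + 2) := by
      calc (a : ℝ) ^ 2 * (1 + u) ^ (m + 1) ≤ t * t ^ (m + 1) := by
            gcongr <;> linarith
        _ = t ^ (m + 2) := by ring
    gcongr
  calc _ = ENNReal.ofReal 4 * japaneseIntegral 1 1 *
        (ENNReal.ofReal ((T ^ (m + 3))⁻¹) * ENNReal.ofReal T) := by ring
    _ ≤ _ := by gcongr

/-- The constant `∑_{c ≠ 0} c⁻²`. -/
noncomputable def zetaTwo : ENNReal := ∑' c : ℤ, ENNReal.ofReal ((c : ℝ) ^ 2)⁻¹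

theorem zetaTwo_ne_top : zetaTwo ≠ ⊤ := by
  have h : Summable fun c : ℤ => ((c : ℝ) ^ 2)⁻¹ := by
    simpa using Real.summable_one_div_int_pow.2 one_lt_two
  exact h.tsum_ofReal_ne_top

/-- The sum over all splitting data above `y` is bounded by a constant times `|det(Ci + D)|`, this
factor being `det Im(y i)^{-1/2}`, the density of the points `q'` in the metric `Im(y i)`. -/
theorem exists_tsum_splitWeight_le (m : ℕ) : ∃ K : ENNReal, K ≠ ⊤ ∧ ∀ y : Sp m,
    ∑' p : ℤ × ℤ × (Fin m → ℤ) × ℤ, splitWeight y p.1 p.2.1 p.2.2.1 p.2.2.2 ≤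
      K * ENNReal.ofReal ‖jdet y (iPt m)‖ := by
  set J := ENNReal.ofReal 4 * japaneseIntegral 1 1 with hJ
  set L := ENNReal.ofReal ((2 + 2 * (2 * m : ℝ)) ^ (m + 1)) * japaneseIntegral m (m + 1) with hL
  have hJt : J ≠ ⊤ :=
    ENNReal.mul_ne_top ENNReal.ofReal_ne_top (japaneseIntegral_ne_top (by norm_num))
  have hLt : L ≠ ⊤ := ENNReal.mul_ne_top ENNReal.ofReal_ne_top (japaneseIntegral_ne_top (by omega))
  refine ⟨J * (zetaTwo * (zetaTwo * L)), ENNReal.mul_ne_top hJt (ENNReal.mul_ne_top zetaTwo_ne_top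
    (ENNReal.mul_ne_top zetaTwo_ne_top hLt)), fun y => ?_⟩
  set Y := (moebius y (iPt m)).1.map Complex.im with hY
  have hq := tsum_quadForm_le (s := m + 1) (moebius y (iPt m)).2.2
    (exists_int_quadForm_le y) 0
  have hdet : (Real.sqrt Y.det)⁻¹ = ‖jdet y (iPt m)‖ := by
    rw [hY, det_im_moebius_iPt, Real.sqrt_inv, Real.sqrt_sq (norm_nonneg _), inv_inv]
  simp only [zero_add] at hq
  rw [hdet] at hq
  calc _ = ∑' (c : ℤ) (a : ℤ) (q' : Fin m → ℤ) (d : ℤ), splitWeight y c a q' d := by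
        simp only [ENNReal.tsum_prod']
    _ ≤ ∑' (c : ℤ) (a : ℤ) (q' : Fin m → ℤ), J * (ENNReal.ofReal ((c : ℝ) ^ 2)⁻¹ *
        (ENNReal.ofReal ((a : ℝ) ^ 2)⁻¹ *
          ENNReal.ofReal ((1 + zvec q' ⬝ᵥ (Y *ᵥ zvec q')) ^ (m + 1))⁻¹)) := by
        refine ENNReal.tsum_le_tsum fun c => ENNReal.tsum_le_tsum fun a =>
          ENNReal.tsum_le_tsum fun q' => ?_
        by_cases h : c = 0 ∨ a = 0
        · simp [splitWeight, h]
        · push Not at h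
          exact tsum_splitWeight_d y h.1 h.2 q'
    _ = J * (zetaTwo * (zetaTwo *
        ∑' q' : Fin m → ℤ, ENNReal.ofReal ((1 + zvec q' ⬝ᵥ (Y *ᵥ zvec q')) ^ (m + 1))⁻¹)) := by
        simp only [ENNReal.tsum_mul_left, ENNReal.tsum_mul_right, zetaTwo]
    _ ≤ J * (zetaTwo * (zetaTwo * (ENNReal.ofReal ((2 + 2 * (2 * m : ℝ)) ^ (m + 1)) *
        (ENNReal.ofReal ‖jdet y (iPt m)‖ * japaneseIntegral m (m + 1))))) := by gcongr
    _ = _ := by rw [hL]; ring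

end Weights

/-! ### Convergence at the base point -/

section Convergence

/-- The majorant `∑ |det(Ci + D)|^{-(n+2)}` over `Γ_∞ \ Sp_n(ℤ)`. -/
noncomputable def infMajorant (n : ℕ) : ENNReal :=
  ∑' q : Quotient (QuotientGroup.rightRel (GammaInf n)),
    ENNReal.ofReal ((‖jdet q.out (iPt n)‖ ^ (n + 2))⁻¹)

theorem rightRel_mk_eq {G : Type*} [Group G] {H : Subgroup G} {g h : G} :
    Quotient.mk (QuotientGroup.rightRel H) g = Quotient.mk (QuotientGroup.rightRel H) h ↔
      h * g⁻¹ ∈ H := by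
  rw [Quotient.eq, ← QuotientGroup.rightRel_apply]

theorem out_mul_inv_mem {G : Type*} [Group G] (H : Subgroup G) (g : G) :
    (Quotient.mk (QuotientGroup.rightRel H) g).out * g⁻¹ ∈ H :=
  rightRel_mk_eq.1 (Quotient.out_eq _).symm

/-- The Eisenstein majorant of weight `n + 2` converges, by induction on the degree: the classes
of `Sp_{m+1}(ℤ)` inject into the classes of `Sp_m(ℤ)` decorated with splitting data, and the
factor `|det(Ci + D)|` lost in summing over the data is the gain in passing from weight `m + 2` to
`m + 3`. -/
theorem infMajorant_ne_top : ∀ n, infMajorant n ≠ ⊤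
  | 0 => by
    have : Unique (Sp 0) := ⟨⟨1⟩, fun a => by apply sp_ext <;> (ext i j; exact i.elim0)⟩
    have : Finite (Quotient (QuotientGroup.rightRel (GammaInf 0))) := inferInstance
    have := Fintype.ofFinite (Quotient (QuotientGroup.rightRel (GammaInf 0)))
    rw [infMajorant, tsum_fintype]
    exact ENNReal.sum_ne_top.2 fun _ _ => ENNReal.ofReal_ne_top
  | m + 1 => by
    obtain ⟨K, hK, hKy⟩ := exists_tsum_splitWeight_le m
    have ih := infMajorant_ne_top m
    -- The splitting data attached to a class.
    have hsplit : ∀ x : Sp (m + 1), ∃ (q : Quotient (QuotientGroup.rightRel (GammaInf m)))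
        (s : Unit ⊕ (ℤ × ℤ × (Fin m → ℤ) × ℤ)),
        Sum.elim (fun _ => x * (iota q.out)⁻¹ ∈ GammaInf (m + 1))
          (fun p => p.2.1 ≠ 0 ∧ p.1 ≠ 0 ∧
            RankOneSplit x q.out (Fin.cons p.2.1 p.2.2.1) p.1 p.2.2.2) s := by
      intro x
      obtain ⟨y, hy⟩ := exists_split x
      refine ⟨Quotient.mk _ y, ?_⟩
      have h := hy _ (out_mul_inv_mem (GammaInf m) y)
      rw [inv_mul_cancel_right] at h
      rcases h with h | ⟨q, c, d, hq, hc, h⟩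
      · exact ⟨Sum.inl (), h⟩
      · exact ⟨Sum.inr (c, q 0, Fin.tail q, d), hq, hc, by rwa [Fin.cons_self_tail]⟩
    choose φ ψ hφ using hsplit
    let Φ : Quotient (QuotientGroup.rightRel (GammaInf (m + 1))) →
      Quotient (QuotientGroup.rightRel (GammaInf m)) × (Unit ⊕ (ℤ × ℤ × (Fin m → ℤ) × ℤ)) :=
      fun q => (φ q.out, ψ q.out)
    have hΦ : Function.Injective Φ := by
      intro q q' h
      obtain ⟨h1, h2⟩ := Prod.ext_iff.1 h
      change φ q.out = φ q'.out at h1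
      change ψ q.out = ψ q'.out at h2
      have e := hφ q.out
      have e' := hφ q'.out
      rw [← h1, ← h2] at e'
      rw [← q.out_eq, ← q'.out_eq, eq_comm, rightRel_mk_eq]
      generalize ψ q.out = s at e e'
      rcases s with s | s
      · have := mul_mem e (inv_mem e')
        simpa [mul_assoc] using this
      · exact e.2.2.mul_inv_mem e'.2.2
    let g : Quotient (QuotientGroup.rightRel (GammaInf m)) ×
        (Unit ⊕ (ℤ × ℤ × (Fin m → ℤ) × ℤ)) → ENNReal := fun r =>
      Sum.elim (fun _ => ENNReal.ofReal ((‖jdet r.1.out (iPt m)‖ ^ (m + 2))⁻¹))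
        (fun p => ENNReal.ofReal ((‖jdet r.1.out (iPt m)‖ ^ (m + 3))⁻¹) *
          splitWeight r.1.out p.1 p.2.1 p.2.2.1 p.2.2.2) r.2
    have hterm : ∀ q : Quotient (QuotientGroup.rightRel (GammaInf (m + 1))),
        ENNReal.ofReal ((‖jdet q.out (iPt (m + 1))‖ ^ (m + 1 + 2))⁻¹) ≤ g (Φ q) := by
      intro q
      have e := hφ q.out
      simp only [g, Φ]
      have hj1 := one_le_norm_jdet_iPt (φ q.out).out
      generalize ψ q.out = s at e
      rcases s with s | p
      · have h1 := norm_jdet_of_mem_mul e (iota (φ q.out).out) (iPt (m + 1))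
        rw [inv_mul_cancel_right, jdet_iota_iPt] at h1
        rw [Sum.elim_inl, h1]
        refine ENNReal.ofReal_le_ofReal (inv_anti₀ (by positivity) ?_)
        exact pow_le_pow_right₀ hj1 (by omega)
      · obtain ⟨ha, hc, e⟩ := e
        have h1 := e.norm_jdet_ge
        rw [Sum.elim_inr, splitWeight, if_neg (by tauto), ← ENNReal.ofReal_mul (by positivity),
          ← mul_inv, ← mul_pow]
        refine ENNReal.ofReal_le_ofReal (inv_anti₀ ?_ (by gcongr))
        refine pow_pos (mul_pos (by linarith) ?_) _
        rw [norm_pos_iff, splitFactor_eq]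
        intro h0
        have h2 := congrArg Complex.im h0
        simp only [Complex.add_im, Complex.ofReal_im, Complex.mul_im, Complex.ofReal_re,
          Complex.I_im, Complex.I_re, mul_one, mul_zero, add_zero, zero_add, Complex.zero_im] at h2
        have h3 := quadForm_nonneg (moebius (φ q.out).out (iPt m)).2.2 (zvec p.2.2.1)
        have h4 : (0 : ℝ) < (p.2.1 : ℝ) ^ 2 := by
          have : (p.2.1 : ℝ) ≠ 0 := by exact_mod_cast ha
          positivity
        rcases mul_eq_zero.1 h2 with h5 | h5
        · exact hc (by exact_mod_cast h5)
        · linarith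
    have htot : ∑' r, g r ≤ (1 + K) * infMajorant m := by
      rw [ENNReal.tsum_prod', infMajorant, ← ENNReal.tsum_mul_left]
      refine ENNReal.tsum_le_tsum fun q => ?_
      rw [ENNReal.summable.tsum_sum ENNReal.summable]
      simp only [g, Sum.elim_inl, Sum.elim_inr, tsum_fintype, Finset.univ_unique,
        Finset.sum_singleton, ENNReal.tsum_mul_left, add_mul, one_mul]
      refine add_le_add le_rfl ?_
      refine (mul_le_mul_right (hKy q.out) _).trans (le_of_eq ?_)
      have hj1 := one_le_norm_jdet_iPt q.out
      rw [mul_left_comm, ← ENNReal.ofReal_mul (by positivity)]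
      congr 2
      have : ‖jdet q.out (iPt m)‖ ≠ 0 := by positivity
      field_simp
      ring
    exact ne_top_of_le_ne_top (ENNReal.mul_ne_top (by simp [hK]) ih)
      ((ENNReal.tsum_le_tsum hterm).trans
        ((ENNReal.tsum_comp_le_tsum_of_injective hΦ g).trans htot))

end Convergence


/-! ### Comparison of automorphy factors -/

section Comparison

variable {n : ℕ}

/-- The symmetric matrix `(Cτ + D)⁻¹ C`, which compares the automorphy factors at `τ` and at
nearby points. -/
noncomputable def zmat (γ : Sp n) (τ : SiegelH n) : Matrix (Fin n) (Fin n) ℂ :=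
  (denom γ τ.1)⁻¹ * toC (blkC γ)

theorem zmat_transpose (γ : Sp n) (τ : SiegelH n) : (zmat γ τ)ᵀ = zmat γ τ := by
  have hd := (Matrix.isUnit_iff_isUnit_det _).1 (denom_isUnit γ τ)
  have hdT : IsUnit (denom γ τ.1)ᵀ.det := by rwa [Matrix.det_transpose]
  have hs : (τ.1)ᵀ = τ.1 := τ.2.1
  have h1 : toC (blkC γ) * (toC (blkD γ))ᵀ = toC (blkD γ) * (toC (blkC γ))ᵀ := by
    rw [← toC_transpose, ← toC_transpose, ← toC_mul, ← toC_mul, (row_relations γ).1]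
  have h2 : denom γ τ.1 * (toC (blkC γ))ᵀ = toC (blkC γ) * (denom γ τ.1)ᵀ := by
    simp only [denom, Matrix.transpose_add, Matrix.transpose_mul, hs, Matrix.add_mul,
      Matrix.mul_add, h1, Matrix.mul_assoc]
  rw [zmat, Matrix.transpose_mul, Matrix.transpose_nonsing_inv]
  calc _ = (denom γ τ.1)⁻¹ * (denom γ τ.1 * (toC (blkC γ))ᵀ) * ((denom γ τ.1)ᵀ)⁻¹ := by
        rw [← Matrix.mul_assoc, Matrix.nonsing_inv_mul _ hd, Matrix.one_mul]
    _ = _ := by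
        rw [h2, Matrix.mul_assoc, Matrix.mul_assoc, Matrix.mul_nonsing_inv _ hdT, Matrix.mul_one]

/-- For `Z = (Cτ + D)⁻¹ C` one has `Z - Z* = -Z* (τ - τ*) Z`. -/
theorem zmat_sub_conjTranspose (γ : Sp n) (τ : SiegelH n) :
    zmat γ τ - (zmat γ τ)ᴴ = -((zmat γ τ)ᴴ * (τ.1 - (τ.1)ᴴ) * zmat γ τ) := by
  set Q := denom γ τ.1 with hQ
  set C := toC (blkC γ) with hC
  have hd : IsUnit Q.det := (Matrix.isUnit_iff_isUnit_det _).1 (denom_isUnit γ τ)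
  have hdT : IsUnit Qᵀ.det := by rwa [Matrix.det_transpose]
  have hdH : IsUnit Qᴴ.det := by rw [Matrix.det_conjTranspose]; exact hd.star
  have hs : (τ.1)ᵀ = τ.1 := τ.2.1
  have hZ : zmat γ τ = Cᵀ * Qᵀ⁻¹ := by
    rw [← zmat_transpose, zmat, Matrix.transpose_mul, Matrix.transpose_nonsing_inv]
  have hZH : (zmat γ τ)ᴴ = Cᵀ * Qᴴ⁻¹ := by
    rw [zmat, Matrix.conjTranspose_mul, Matrix.conjTranspose_nonsing_inv, hC, toC_conjTranspose]
  have hsub : Qᴴ - Qᵀ = ((τ.1)ᴴ - τ.1) * Cᵀ := by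
    simp only [hQ, denom, Matrix.conjTranspose_add, Matrix.conjTranspose_mul, toC_conjTranspose,
      Matrix.transpose_add, Matrix.transpose_mul, hs, Matrix.sub_mul]
    abel
  calc zmat γ τ - (zmat γ τ)ᴴ = Cᵀ * Qᴴ⁻¹ * (Qᴴ - Qᵀ) * Qᵀ⁻¹ := by
        rw [hZH, hZ, Matrix.mul_sub, Matrix.sub_mul, Matrix.mul_assoc _ Qᴴ⁻¹ Qᴴ,
          Matrix.nonsing_inv_mul _ hdH, Matrix.mul_one, Matrix.mul_assoc _ Qᵀ Qᵀ⁻¹,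
          Matrix.mul_nonsing_inv _ hdT, Matrix.mul_one]
    _ = _ := by rw [hsub, hZH, hZ]; noncomm_ring

/-- `- Im Z = Z* Im(τ) Z` for `Z = (Cτ + D)⁻¹ C`, on the diagonal. -/
theorem im_zmat_diag (γ : Sp n) (τ : SiegelH n) (j : Fin n) :
    -(zmat γ τ j j).im =
      (fun i => (zmat γ τ i j).re) ⬝ᵥ (τ.1.map Complex.im *ᵥ fun i => (zmat γ τ i j).re) +
        (fun i => (zmat γ τ i j).im) ⬝ᵥ (τ.1.map Complex.im *ᵥ fun i => (zmat γ τ i j).im) := by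
  have h := congrArg (fun M => M j j) (zmat_sub_conjTranspose γ τ)
  simp only [sub_conjTranspose_eq τ.2.1] at h
  have e : ((zmat γ τ)ᴴ * ((2 * Complex.I) • (τ.1.map Complex.im).map Complex.ofReal) *
      zmat γ τ) j j = (2 * Complex.I) * (star (fun i => zmat γ τ i j) ⬝ᵥ
        ((τ.1.map Complex.im).map Complex.ofReal *ᵥ fun i => zmat γ τ i j)) := by
    rw [Matrix.mul_smul, Matrix.smul_mul, Matrix.smul_apply, smul_eq_mul, Matrix.mul_assoc]
    rfl
  rw [Matrix.neg_apply, e] at h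
  have h2 := congrArg Complex.im h
  rw [← re_quadForm]
  simp only [Matrix.sub_apply, Matrix.conjTranspose_apply, RCLike.star_def, Complex.sub_im,
    Complex.conj_im, Complex.neg_im, Complex.mul_im, Complex.mul_re, Complex.I_re, Complex.I_im,
    Complex.re_ofNat, Complex.im_ofNat] at h2
  linarith

theorem norm_zmat_sq_le (γ : Sp n) (τ : SiegelH n) {c : ℝ}
    (h : ∀ v : Fin n → ℝ, c * (v ⬝ᵥ v) ≤ v ⬝ᵥ (τ.1.map Complex.im *ᵥ v)) (j : Fin n) :
    c * ∑ i, ‖zmat γ τ i j‖ ^ 2 ≤ -(zmat γ τ j j).im := by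
  rw [im_zmat_diag]
  refine le_trans (le_of_eq ?_) (add_le_add (h _) (h _))
  rw [← mul_add]
  congr 1
  simp only [dotProduct, ← Finset.sum_add_distrib]
  refine Finset.sum_congr rfl fun i _ => ?_
  rw [← Complex.normSq_eq_norm_sq, Complex.normSq_apply]

/-- The entries of `(Cτ + D)⁻¹ C` are bounded in terms of `Im τ` alone: the diagonal identity
`-Im Z = Z* Im(τ) Z` bounds a column of `Z` quadratically by one of its own entries. -/
theorem norm_zmat_le (γ : Sp n) (τ : SiegelH n) {c : ℝ} (hc : 0 < c)
    (h : ∀ v : Fin n → ℝ, c * (v ⬝ᵥ v) ≤ v ⬝ᵥ (τ.1.map Complex.im *ᵥ v)) (i j : Fin n) :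
    ‖zmat γ τ i j‖ ≤ c⁻¹ := by
  have h1 := norm_zmat_sq_le γ τ h j
  have h2 : -(zmat γ τ j j).im ≤ ‖zmat γ τ j j‖ :=
    (neg_le_abs _).trans (Complex.abs_im_le_norm _)
  have h3 : ∀ l, ‖zmat γ τ l j‖ ^ 2 ≤ ∑ i, ‖zmat γ τ i j‖ ^ 2 := fun l =>
    Finset.single_le_sum (f := fun i => ‖zmat γ τ i j‖ ^ 2) (fun i _ => sq_nonneg _)
      (Finset.mem_univ l)
  have h4 : ∀ l, c * ‖zmat γ τ l j‖ ^ 2 ≤ ‖zmat γ τ j j‖ := fun l =>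
    (mul_le_mul_of_nonneg_left (h3 l) hc.le).trans (h1.trans h2)
  have h5 : ‖zmat γ τ j j‖ ≤ c⁻¹ := by
    rw [← one_div, le_div_iff₀ hc]
    by_contra hlt
    push Not at hlt
    nlinarith [h4 j, norm_nonneg (zmat γ τ j j)]
  have h6 : ‖zmat γ τ i j‖ ^ 2 ≤ c⁻¹ ^ 2 := by
    have := (h4 i).trans h5
    rw [sq c⁻¹, ← div_eq_mul_inv c⁻¹, le_div_iff₀ hc]
    linarith
  exact le_of_sq_le_sq h6 (by positivity)

/-- `det(CW + D) = det(Cτ + D) det(1 + Z(W - τ))` for every complex `W`, symmetric or not. -/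
theorem det_denom_eq (γ : Sp n) (τ : SiegelH n) (W : Matrix (Fin n) (Fin n) ℂ) :
    (toC (blkC γ) * W + toC (blkD γ)).det = jdet γ τ * (1 + zmat γ τ * (W - τ.1)).det := by
  have hd := (Matrix.isUnit_iff_isUnit_det _).1 (denom_isUnit γ τ)
  rw [jdet, ← Matrix.det_mul, Matrix.mul_add, Matrix.mul_one, zmat, Matrix.mul_assoc,
    ← Matrix.mul_assoc (denom γ τ.1), Matrix.mul_nonsing_inv _ hd, Matrix.one_mul, denom,
    Matrix.mul_sub]
  congr 1
  abel

theorem norm_det_le {M : Matrix (Fin n) (Fin n) ℂ} {x : ℝ} (h : ∀ i j, ‖M i j‖ ≤ x) :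
    ‖M.det‖ ≤ n.factorial * x ^ n := by
  have := Matrix.det_le (abv := NormedField.toAbsoluteValue ℂ) (x := x) h
  rw [Fintype.card_fin, nsmul_eq_mul] at this
  exact this

theorem norm_zmat_mul_le {γ : Sp n} {τ : SiegelH n} {c R : ℝ} (hc : 0 < c)
    (h : ∀ v : Fin n → ℝ, c * (v ⬝ᵥ v) ≤ v ⬝ᵥ (τ.1.map Complex.im *ᵥ v))
    {W : Matrix (Fin n) (Fin n) ℂ} (hW : ∀ i j, ‖W i j‖ ≤ R) (i j : Fin n) :
    ‖(zmat γ τ * W) i j‖ ≤ n * (R / c) := by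
  rw [Matrix.mul_apply]
  calc _ ≤ ∑ l, ‖zmat γ τ i l * W l j‖ := norm_sum_le _ _
    _ ≤ ∑ _l : Fin n, R / c := by
        refine Finset.sum_le_sum fun l _ => ?_
        rw [norm_mul, div_eq_mul_inv, mul_comm R]
        exact mul_le_mul (norm_zmat_le γ τ hc h i l) (hW l j) (norm_nonneg _) (by positivity)
    _ = _ := by simp

/-- The automorphy factors at two points are comparable, uniformly in `γ`. -/
theorem norm_jdet_le (γ : Sp n) (τ τ' : SiegelH n) {c R : ℝ} (hc : 0 < c)
    (h : ∀ v : Fin n → ℝ, c * (v ⬝ᵥ v) ≤ v ⬝ᵥ (τ.1.map Complex.im *ᵥ v))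
    (hR : ∀ i j, ‖(τ'.1 - τ.1) i j‖ ≤ R) :
    ‖jdet γ τ'‖ ≤ n.factorial * (1 + n * (R / c)) ^ n * ‖jdet γ τ‖ := by
  rw [jdet, denom, det_denom_eq γ τ, norm_mul, mul_comm]
  refine mul_le_mul_of_nonneg_right (norm_det_le fun i j => ?_) (norm_nonneg _)
  rw [Matrix.add_apply]
  refine (norm_add_le _ _).trans (add_le_add ?_ (norm_zmat_mul_le hc h hR i j))
  rw [Matrix.one_apply]
  split_ifs <;> simp

/-- A positive definite form is bounded below by a multiple of the standard one. -/
theorem exists_pos_mul_le {Y : Matrix (Fin n) (Fin n) ℝ} (hY : Y.PosDef) :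
    ∃ c : ℝ, 0 < c ∧ ∀ v : Fin n → ℝ, c * (v ⬝ᵥ v) ≤ v ⬝ᵥ (Y *ᵥ v) := by
  obtain ⟨A, hA⟩ := exists_transpose_mul_self hY
  have hdet : IsUnit A.det := by
    refine isUnit_iff_ne_zero.2 fun h0 => ?_
    have := hY.det_pos
    rw [hA, Matrix.det_mul, h0, mul_zero] at this
    exact lt_irrefl _ this
  set s := ∑ i, ∑ j, A⁻¹ i j ^ 2 with hs
  have hs0 : 0 ≤ s := Finset.sum_nonneg fun i _ => Finset.sum_nonneg fun j _ => sq_nonneg _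
  refine ⟨(1 + s)⁻¹, by positivity, fun v => ?_⟩
  rw [hA, quadForm_transpose_mul_self]
  set w := A *ᵥ v with hw
  have hv : v = A⁻¹ *ᵥ w := by
    rw [hw, Matrix.mulVec_mulVec, Matrix.nonsing_inv_mul _ hdet, Matrix.one_mulVec]
  have hww : 0 ≤ w ⬝ᵥ w := Finset.sum_nonneg fun i _ => mul_self_nonneg _
  have h1 : v ⬝ᵥ v ≤ s * (w ⬝ᵥ w) := by
    calc v ⬝ᵥ v = ∑ i, (A⁻¹ *ᵥ w) i ^ 2 := by
          rw [← hv]; exact Finset.sum_congr rfl fun i _ => (sq _).symm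
      _ ≤ ∑ i, (∑ j, A⁻¹ i j ^ 2) * ∑ j, w j ^ 2 := Finset.sum_le_sum fun i _ =>
          Finset.sum_mul_sq_le_sq_mul_sq Finset.univ (fun j => A⁻¹ i j) w
      _ = s * (w ⬝ᵥ w) := by
          rw [← Finset.sum_mul]
          congr 1
          exact Finset.sum_congr rfl fun i _ => sq _
  rw [inv_mul_le_iff₀ (by positivity)]
  linarith

end Comparison

/-! ### Absolute convergence -/

section AbsoluteConvergence

variable {n : ℕ}

/-- The right cosets `Γ_∞⁺ \ Sp_n(ℤ)`. -/
abbrev Cosets (n : ℕ) : Type := Quotient (QuotientGroup.rightRel (GammaInfPlus n))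

/-- The coset `Γ_∞⁺ x`. -/
abbrev cosetMk (x : Sp n) : Cosets n := Quotient.mk (QuotientGroup.rightRel (GammaInfPlus n)) x

theorem norm_jdet_out (x : Sp n) (τ : SiegelH n) : ‖jdet (cosetMk x).out τ‖ = ‖jdet x τ‖ := by
  have h := norm_jdet_of_mem_mul (GammaInfPlus_le (out_mul_inv_mem (GammaInfPlus n) x)) x τ
  rwa [inv_mul_cancel_right] at h

theorem oneSlash_out (k : ℕ) (x : Sp n) (τ : SiegelH n) :
    oneSlash k (cosetMk x).out τ = oneSlash k x τ := by
  have h := oneSlash_of_mem_mul k (out_mul_inv_mem (GammaInfPlus n) x) x τ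
  rwa [inv_mul_cancel_right] at h

/-- `Γ_∞⁺` has index two in `Γ_∞`, so the convergence over the classes of `Γ_∞` suffices. -/
theorem summable_jdet_iPt (hn : 0 < n) {k : ℕ} (hk : n + 1 < k) :
    Summable fun q : Cosets n => (‖jdet q.out (iPt n)‖ ^ k)⁻¹ := by
  have hsum : Summable fun q : Cosets n => (‖jdet q.out (iPt n)‖ ^ (n + 2))⁻¹ := by
    let s : Quotient (QuotientGroup.rightRel (GammaInf n)) × Bool → Cosets n := fun r =>
      cosetMk (if r.2 then r.1.out else gammaPM n * r.1.out)
    have hs : Function.Surjective s := by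
      intro c
      obtain ⟨x, rfl⟩ := Quotient.exists_rep c
      have h := out_mul_inv_mem (GammaInf n) x
      rcases mem_GammaInf_cases hn h with h | h
      · refine ⟨(Quotient.mk _ x, true), (rightRel_mk_eq.2 ?_).symm⟩
        simpa using h
      · refine ⟨(Quotient.mk _ x, false), (rightRel_mk_eq.2 ?_).symm⟩
        simpa [mul_assoc] using h
    have h1 := ENNReal.tsum_le_tsum_comp_of_surjective hs
      fun q => ENNReal.ofReal ((‖jdet q.out (iPt n)‖ ^ (n + 2))⁻¹)
    have h2 : ∀ r, ‖jdet (s r).out (iPt n)‖ = ‖jdet r.1.out (iPt n)‖ := by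
      rintro ⟨q, b⟩
      rw [norm_jdet_out]
      cases b
      · exact norm_jdet_of_mem_mul gammaPM_mem_GammaInf _ _
      · rfl
    simp only [h2, ENNReal.tsum_prod', tsum_fintype, Fintype.sum_bool] at h1
    rw [ENNReal.tsum_add] at h1
    have h3 : ∑' q : Cosets n, ENNReal.ofReal ((‖jdet q.out (iPt n)‖ ^ (n + 2))⁻¹) ≠ ⊤ :=
      ne_top_of_le_ne_top (ENNReal.add_ne_top.2 ⟨infMajorant_ne_top n, infMajorant_ne_top n⟩) h1
    have h4 := ENNReal.summable_toReal h3
    refine h4.congr fun q => ?_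
    exact ENNReal.toReal_ofReal (by positivity)
  refine Summable.of_nonneg_of_le (fun q => by positivity) (fun q => ?_) hsum
  have := one_le_norm_jdet_iPt q.out
  exact inv_anti₀ (by positivity) (pow_le_pow_right₀ this hk)

theorem norm_oneSlash (k : ℕ) (γ : Sp n) (τ : SiegelH n) :
    ‖oneSlash k γ τ‖ = (‖jdet γ τ‖ ^ k)⁻¹ := by
  rw [oneSlash_apply, norm_zpow, zpow_neg, zpow_natCast]

/-- The terms of the Eisenstein series at `τ` are bounded by those at the base point. -/
theorem norm_oneSlash_le (k : ℕ) (γ : Sp n) (τ : SiegelH n) {c R : ℝ} (hc : 0 < c)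
    (h : ∀ v : Fin n → ℝ, c * (v ⬝ᵥ v) ≤ v ⬝ᵥ (τ.1.map Complex.im *ᵥ v))
    (hR : ∀ i j, ‖((iPt n).1 - τ.1) i j‖ ≤ R) :
    ‖oneSlash k γ τ‖ ≤
      (n.factorial * (1 + n * (R / c)) ^ n) ^ k * (‖jdet γ (iPt n)‖ ^ k)⁻¹ := by
  have h1 := norm_jdet_le γ τ (iPt n) hc h hR
  have h2 := one_le_norm_jdet_iPt γ
  have h3 : 0 < ‖jdet γ τ‖ := norm_pos_iff.2 (jdet_ne_zero γ τ)
  rw [norm_oneSlash, ← div_eq_mul_inv, le_div_iff₀ (by positivity), inv_mul_le_iff₀ (by positivity),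
    ← mul_pow, mul_comm ‖jdet γ τ‖]
  gcongr

/-- Absolute convergence of the Eisenstein series on all of `𝔥_n`. -/
theorem summable_norm_oneSlash (hn : 0 < n) {k : ℕ} (hk : n + 1 < k) (τ : SiegelH n) :
    Summable fun q : Cosets n => ‖oneSlash k q.out τ‖ := by
  obtain ⟨c, hc, h⟩ := exists_pos_mul_le τ.2.2
  have hR : ∀ i j, ‖((iPt n).1 - τ.1) i j‖ ≤ ∑ i, ∑ j, ‖((iPt n).1 - τ.1) i j‖ := fun i j =>
    (Finset.single_le_sum (f := fun j => ‖((iPt n).1 - τ.1) i j‖) (fun _ _ => norm_nonneg _)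
      (Finset.mem_univ j)).trans
    (Finset.single_le_sum (f := fun i => ∑ j, ‖((iPt n).1 - τ.1) i j‖)
      (fun _ _ => Finset.sum_nonneg fun _ _ => norm_nonneg _) (Finset.mem_univ i))
  exact Summable.of_nonneg_of_le (fun _ => norm_nonneg _)
    (fun q => norm_oneSlash_le k q.out τ hc h hR)
    ((summable_jdet_iPt hn hk).mul_left _)

end AbsoluteConvergence

/-! ### The terms at the cusp -/

section Limit

variable {n : ℕ}

theorem iyPt_quadForm (y : ℝ) (hy : 0 < y) (v : Fin n → ℝ) :
    v ⬝ᵥ ((iyPt n y hy).1.map Complex.im *ᵥ v) = y * (v ⬝ᵥ v) := by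
  have h : (iyPt n y hy).1.map Complex.im = y • (1 : Matrix (Fin n) (Fin n) ℝ) := by
    ext i j
    by_cases hij : i = j <;> simp [iyPt, hij]
  rw [h, Matrix.smul_mulVec, Matrix.one_mulVec, dotProduct_smul, smul_eq_mul]

/-- Uniform domination of the terms along `i y`, `y ≥ 1`. -/
theorem norm_oneSlash_iyPt_le (k : ℕ) (γ : Sp n) {y : ℝ} (hy : 1 ≤ y) :
    ‖oneSlash k γ (iyPt n y (by linarith))‖ ≤
      (n.factorial * (1 + n * 1) ^ n) ^ k * (‖jdet γ (iPt n)‖ ^ k)⁻¹ := by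
  have hy0 : 0 < y := by linarith
  have h := norm_oneSlash_le k γ (iyPt n y hy0) hy0
    (fun v => (iyPt_quadForm y hy0 v).ge) (R := y) (fun i j => by
      rw [iPt_val]
      by_cases hij : i = j
      · subst hij
        have e : (Complex.I • (1 : Matrix (Fin n) (Fin n) ℂ) - (iyPt n y hy0).1) i i =
            Complex.I * ((1 - y : ℝ) : ℂ) := by
          simp [iyPt]; ring
        rw [e, norm_mul, Complex.norm_I, one_mul, Complex.norm_real, Real.norm_eq_abs, abs_le]
        constructor <;> linarith
      · simp [iyPt, hij, hy0.le])
  rwa [div_self hy0.ne'] at h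

/-- The imaginary part of `-tr Z` at the base point is the sum of all `|Z_{ij}|²`. -/
theorem trace_zmat_ne_zero {γ : Sp n} (hγ : γ ∉ GammaInf n) : (zmat γ (iPt n)).trace ≠ 0 := by
  have hd := (Matrix.isUnit_iff_isUnit_det _).1 (denom_isUnit γ (iPt n))
  intro h0
  have him : ∀ j, 1 * ∑ i, ‖zmat γ (iPt n) i j‖ ^ 2 ≤ -(zmat γ (iPt n) j j).im :=
    norm_zmat_sq_le γ (iPt n) (fun v => (iyPt_quadForm 1 one_pos v).ge)
  have h1 : ∑ j, ∑ i, ‖zmat γ (iPt n) i j‖ ^ 2 ≤ 0 := by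
    calc _ ≤ ∑ j, -(zmat γ (iPt n) j j).im := Finset.sum_le_sum fun j _ => by
          simpa using him j
      _ = -((zmat γ (iPt n)).trace).im := by
          simp [Matrix.trace]
      _ = 0 := by rw [h0]; simp
  have h2 : zmat γ (iPt n) = 0 := by
    have h3 := (Finset.sum_eq_zero_iff_of_nonneg (fun j _ => Finset.sum_nonneg fun i _ =>
      sq_nonneg ‖zmat γ (iPt n) i j‖)).1 (le_antisymm h1 (Finset.sum_nonneg fun j _ =>
        Finset.sum_nonneg fun i _ => sq_nonneg _))
    ext i j
    have h4 := (Finset.sum_eq_zero_iff_of_nonneg (fun i _ =>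
      sq_nonneg ‖zmat γ (iPt n) i j‖)).1 (h3 j (Finset.mem_univ j)) i (Finset.mem_univ i)
    simpa using h4
  apply hγ
  rw [mem_GammaInf]
  have h5 : toC (blkC γ) = 0 := by
    have : denom γ (iPt n).1 * zmat γ (iPt n) = toC (blkC γ) := by
      rw [zmat, ← Matrix.mul_assoc, Matrix.mul_nonsing_inv _ hd, Matrix.one_mul]
    rw [← this, h2, Matrix.mul_zero]
  ext i j
  have := congrArg (fun M => M i j) h5
  simpa [toC] using this

open Filter Topology in
/-- If `C ≠ 0`, then `det(1 + i s Z)`, with `Z = (Ci + D)⁻¹ C`, is a nonconstant polynomial in `s`,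
its linear coefficient being `i tr Z ≠ 0`; so the term of `γ` vanishes at the cusp. -/
theorem tendsto_oneSlash_iyPt {k : ℕ} (hk : k ≠ 0) {γ : Sp n} (hγ : γ ∉ GammaInf n) :
    Tendsto (fun m : ℕ => oneSlash k γ (iyPt n (m + 1) (by positivity))) atTop (𝓝 0) := by
  set p : Polynomial ℂ :=
    (1 + (Polynomial.X : Polynomial ℂ) • (zmat γ (iPt n)).map Polynomial.C).det with hp
  have hdeg : 0 < p.degree := by
    have h1 : p.coeff 1 ≠ 0 := by
      rw [hp, Matrix.coeff_det_one_add_X_smul_one]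
      exact trace_zmat_ne_zero hγ
    exact lt_of_lt_of_le (by norm_num) (Polynomial.le_degree_of_ne_zero h1)
  have hev : ∀ m : ℕ, jdet γ (iyPt n (m + 1) (by positivity)) =
      jdet γ (iPt n) * p.eval (Complex.I * m) := by
    intro m
    rw [jdet, denom, det_denom_eq γ (iPt n), hp, ← Polynomial.coe_evalRingHom, RingHom.map_det]
    congr 2
    have e : (iyPt n (m + 1) (by positivity)).1 - (iPt n).1 = (Complex.I * m) • 1 := by
      rw [iPt_val, iyPt, ← sub_smul]
      congr 1
      push_cast
      ring
    rw [e, Matrix.mul_smul, Matrix.mul_one]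
    ext i j
    by_cases hij : i = j <;> simp [hij, mul_comm (zmat γ (iPt n) _ _)]
  have ht : Tendsto (fun m : ℕ => ‖jdet γ (iyPt n (m + 1) (by positivity))‖) atTop atTop := by
    simp only [hev, norm_mul]
    refine Tendsto.const_mul_atTop (norm_pos_iff.2 (jdet_ne_zero _ _)) ?_
    refine Polynomial.tendsto_norm_atTop p hdeg ?_
    simpa using tendsto_natCast_atTop_atTop (R := ℝ)
  rw [tendsto_zero_iff_norm_tendsto_zero]
  simp only [norm_oneSlash]
  exact ((tendsto_pow_atTop hk).comp ht).inv_tendsto_atTop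

end Limit


/-! ### Differentiability of series -/

section Weierstrass

open Metric

/-- Weierstrass' theorem in several variables: a normally convergent series of holomorphic
functions is holomorphic. -/
theorem differentiableAt_tsum_of_norm_le {ι E : Type*} [NormedAddCommGroup E] [NormedSpace ℂ E]
    {f : ι → E → ℂ} {u : ι → ℝ} (hu : Summable u) {z₀ : E} {r : ℝ} (hr : 0 < r)
    (hf : ∀ i, DifferentiableOn ℂ (f i) (ball z₀ r)) (hb : ∀ i, ∀ z ∈ ball z₀ r, ‖f i z‖ ≤ u i) :
    DifferentiableAt ℂ (fun z => ∑' i, f i z) z₀ := by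
  have hu0 : ∀ i, 0 ≤ u i := fun i => (norm_nonneg _).trans (hb i z₀ (mem_ball_self hr))
  have hsub : ball z₀ (r / 2) ⊆ ball z₀ r := ball_subset_ball (by linarith)
  have hd : ∀ i, ∀ z ∈ ball z₀ (r / 2), HasFDerivAt (f i) (fderiv ℂ (f i) z) z := fun i z hz =>
    ((hf i).differentiableAt (isOpen_ball.mem_nhds (hsub hz))).hasFDerivAt
  -- Cauchy's estimate on complex lines.
  have hbd : ∀ i, ∀ z ∈ ball z₀ (r / 2), ‖fderiv ℂ (f i) z‖ ≤ 4 / r * u i := by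
    intro i z hz
    refine ContinuousLinearMap.opNorm_le_bound _ (mul_nonneg (by positivity) (hu0 i)) fun v => ?_
    by_cases hv : v = 0
    · simp [hv]
    have hv0 : 0 < ‖v‖ := norm_pos_iff.2 hv
    have hmem : ∀ t : ℂ, ‖t‖ ≤ r / (4 * ‖v‖) → z + t • v ∈ ball z₀ r := by
      intro t ht
      have h1 : ‖t • v‖ ≤ r / 4 := by
        rw [norm_smul]
        calc ‖t‖ * ‖v‖ ≤ r / (4 * ‖v‖) * ‖v‖ := by gcongr
          _ = r / 4 := by field_simp
      rw [mem_ball, dist_eq_norm] at hz ⊢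
      calc ‖z + t • v - z₀‖ = ‖(z - z₀) + t • v‖ := by congr 1; abel
        _ ≤ ‖z - z₀‖ + ‖t • v‖ := norm_add_le _ _
        _ < r := by linarith
    have hline : ∀ t : ℂ, HasDerivAt (fun t : ℂ => z + t • v) v t := fun t => by
      simpa using ((hasDerivAt_id t).smul_const v).const_add z
    have hg : DifferentiableOn ℂ (fun t : ℂ => f i (z + t • v)) (closedBall 0 (r / (4 * ‖v‖))) := by
      intro t ht
      have h1 := (hf i).differentiableAt (isOpen_ball.mem_nhds (hmem t (by simpa using ht)))
      exact (h1.comp t (hline t).differentiableAt).differentiableWithinAt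
    have hder : deriv (fun t : ℂ => f i (z + t • v)) 0 = fderiv ℂ (f i) z v := by
      have h1 : HasFDerivAt (f i) (fderiv ℂ (f i) z) (z + (0 : ℂ) • v) := by
        simpa using hd i z hz
      exact (h1.comp_hasDerivAt (0 : ℂ) (hline 0)).deriv
    rw [← hder]
    refine (Complex.norm_deriv_le_of_forall_mem_sphere_norm_le (R := r / (4 * ‖v‖)) (C := u i)
      (by positivity) ?_ fun t ht => hb i _ (hmem t ?_)).trans (le_of_eq ?_)
    · refine DifferentiableOn.diffContOnCl ?_
      exact hg.mono closure_ball_subset_closedBall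
    · simpa using (mem_sphere.1 ht).le
    · field_simp
  exact (hasFDerivAt_tsum_of_isPreconnected (hu.mul_left _) isOpen_ball
    (convex_ball z₀ (r / 2)).isPreconnected hd hbd (mem_ball_self (by positivity))
    (Summable.of_norm_bounded hu fun i => hb i z₀ (mem_ball_self hr))
    (mem_ball_self (by positivity))).differentiableAt

end Weierstrass

/-! ### Sums over `Γ_∞⁺ \ Sp_n(ℤ)` -/

section CosetSums

variable {n : ℕ}

/-- The series `∑ a(x) det(Cτ + D)^{-k}` over `x ∈ Γ_∞⁺ \ Sp_n(ℤ)`, for a bounded function `a` that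
is left invariant under `Γ_∞⁺`. -/
noncomputable def cosetSum (k : ℕ) (a : Sp n → ℂ) : SiegelH n → ℂ :=
  fun τ => ∑' q : Cosets n, a q.out * oneSlash k q.out τ

/-- Left invariance under `Γ_∞⁺`. -/
def LeftInv {E : Type*} (f : Sp n → E) : Prop := ∀ p ∈ GammaInfPlus n, ∀ x, f (p * x) = f x

theorem LeftInv.out {E : Type*} {f : Sp n → E} (hf : LeftInv f) (x : Sp n) :
    f (cosetMk x).out = f x := by
  have h := hf _ (out_mul_inv_mem (GammaInfPlus n) x) x
  rwa [inv_mul_cancel_right] at h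

theorem leftInv_oneSlash (k : ℕ) (τ : SiegelH n) : LeftInv fun x => oneSlash k x τ :=
  fun _ hp x => oneSlash_of_mem_mul k hp x τ

theorem LeftInv.mul_oneSlash {a : Sp n → ℂ} (ha : LeftInv a) (k : ℕ) (τ : SiegelH n) :
    LeftInv fun x => a x * oneSlash k x τ := fun p hp x => by
  simp only [ha p hp x, leftInv_oneSlash k τ p hp x]

theorem LeftInv.comp_mul_right {E : Type*} {f : Sp n → E} (hf : LeftInv f) (g : Sp n) :
    LeftInv fun x => f (x * g) := fun p hp x => by
  simp only [mul_assoc, hf p hp]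

/-- Right multiplication permutes the cosets `Γ_∞⁺ x`. -/
def cosetMulRight (g : Sp n) : Cosets n ≃ Cosets n where
  toFun := Quotient.map' (· * g) fun x y h => by
    rw [QuotientGroup.rightRel_apply] at h ⊢
    simpa [mul_assoc] using h
  invFun := Quotient.map' (· * g⁻¹) fun x y h => by
    rw [QuotientGroup.rightRel_apply] at h ⊢
    simpa [mul_assoc] using h
  left_inv q := by
    obtain ⟨x, rfl⟩ := Quotient.exists_rep q
    exact congrArg _ (mul_inv_cancel_right x g)
  right_inv q := by
    obtain ⟨x, rfl⟩ := Quotient.exists_rep q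
    exact congrArg _ (inv_mul_cancel_right x g)

/-- Left multiplication by `γ_±` permutes the cosets, since it normalizes `Γ_∞⁺`. -/
def cosetNeg : Cosets n ≃ Cosets n :=
  Function.Involutive.toPerm
    (Quotient.map' (gammaPM n * ·) fun x y h => by
      rw [QuotientGroup.rightRel_apply] at h ⊢
      have := conj_mem_GammaInfPlus gammaPM_mem_GammaInf h
      simpa [mul_assoc] using this)
    (fun q => by
      obtain ⟨x, rfl⟩ := Quotient.exists_rep q
      change cosetMk (gammaPM n * (gammaPM n * x)) = cosetMk x
      rw [← mul_assoc, gammaPM_mul_self, one_mul])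

theorem tsum_mul_right {E : Type*} [AddCommMonoid E] [TopologicalSpace E] [T2Space E]
    {f : Sp n → E} (hf : LeftInv f) (g : Sp n) :
    ∑' q : Cosets n, f (q.out * g) = ∑' q : Cosets n, f q.out := by
  rw [← (cosetMulRight g).tsum_eq fun q => f q.out]
  refine tsum_congr fun q => ?_
  have h : cosetMulRight g q = cosetMk (q.out * g) := by
    conv_lhs => rw [← q.out_eq]
    rfl
  rw [h, hf.out]

theorem tsum_gammaPM_mul {E : Type*} [AddCommMonoid E] [TopologicalSpace E] [T2Space E]
    {f : Sp n → E} (hf : LeftInv f) :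
    ∑' q : Cosets n, f (gammaPM n * q.out) = ∑' q : Cosets n, f q.out := by
  rw [← (cosetNeg (n := n)).tsum_eq fun q => f q.out]
  refine tsum_congr fun q => ?_
  have h : cosetNeg q = cosetMk (gammaPM n * q.out) := by
    conv_lhs => rw [← q.out_eq]
    rfl
  rw [h, hf.out]

/-- The slash operator acts on the sums over `Γ_∞⁺ \ Sp_n(ℤ)` by right translation of the
coefficients. -/
theorem slash_cosetSum (k : ℕ) {a : Sp n → ℂ} (ha : LeftInv a) (γ : Sp n) :
    slash k (cosetSum k a) γ = cosetSum k fun x => a (x * γ⁻¹) := by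
  funext τ
  have h := tsum_mul_right ((ha.comp_mul_right γ⁻¹).mul_oneSlash k τ) γ
  simp only [mul_inv_cancel_right, oneSlash_mul] at h
  rw [slash, cosetSum, cosetSum, ← h, ← tsum_mul_left]
  refine tsum_congr fun q => ?_
  rw [jdet]
  ring

variable {k : ℕ} {a : Sp n → ℂ} {B : ℝ}

theorem summable_cosetSum (hn : 0 < n) (hk : n + 1 < k) (hB : ∀ x, ‖a x‖ ≤ B) (τ : SiegelH n) :
    Summable fun q : Cosets n => a q.out * oneSlash k q.out τ := by
  refine Summable.of_norm_bounded ((summable_norm_oneSlash hn hk τ).mul_left B) fun q => ?_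
  rw [norm_mul]
  exact mul_le_mul_of_nonneg_right (hB _) (norm_nonneg _)

/-- The terms extend holomorphically to a neighbourhood of each point in the space of all complex
matrices, and are dominated there by a constant times their absolute values at the point. -/
theorem isHolomorphic_cosetSum (hn : 0 < n) (hk : n + 1 < k) (hB : ∀ x, ‖a x‖ ≤ B) :
    IsHolomorphic (cosetSum k a) := by
  refine ⟨fun Z => ∑' q : Cosets n, a q.out *
    (toC (blkC q.out) * Matrix.of Z + toC (blkD q.out)).det ^ (-(k : ℤ)), ?_, ?_⟩
  · intro Z₀ hZ₀
    refine DifferentiableAt.differentiableWithinAt ?_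
    set τ₀ : SiegelH n := ⟨Matrix.of Z₀, hZ₀⟩ with hτ₀
    obtain ⟨c, hc, hcY⟩ := exists_pos_mul_le τ₀.2.2
    -- A neighbourhood of `0` on which `det(1 + M)` stays away from `0`.
    obtain ⟨η, hη, hdet⟩ : ∃ η > 0, ∀ M : Fin n → Fin n → ℂ, (∀ i j, ‖M i j‖ < η) →
        (1 / 2 : ℝ) ≤ ‖(1 + Matrix.of M).det‖ := by
      have hcont : Continuous fun M : Fin n → Fin n → ℂ => ‖(1 + Matrix.of M).det‖ := by
        have : Continuous fun M : Fin n → Fin n → ℂ => (1 + Matrix.of M : Matrix _ _ ℂ) :=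
          continuous_const.add continuous_id
        exact this.matrix_det.norm
      have h0 := hcont.continuousAt (x := (0 : Fin n → Fin n → ℂ))
      have h1 : ∀ᶠ M in nhds (0 : Fin n → Fin n → ℂ), (1 / 2 : ℝ) < ‖(1 + Matrix.of M).det‖ := by
        refine h0.eventually (lt_mem_nhds ?_)
        simp
        norm_num
      obtain ⟨η, hη, h2⟩ := Metric.eventually_nhds_iff.1 h1
      refine ⟨η, hη, fun M hM => (h2 ?_).le⟩
      rw [dist_zero_right, pi_norm_lt_iff hη]
      exact fun i => (pi_norm_lt_iff hη).2 fun j => hM i j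
    set r := η * c / (n + 1) with hr
    have hr0 : 0 < r := by positivity
    have hlow : ∀ (q : Cosets n), ∀ Z ∈ Metric.ball Z₀ r, ‖jdet q.out τ₀‖ * (1 / 2) ≤
        ‖(toC (blkC q.out) * Matrix.of Z + toC (blkD q.out)).det‖ := by
      intro q Z hZ
      rw [det_denom_eq q.out τ₀, norm_mul]
      refine mul_le_mul_of_nonneg_left ?_ (norm_nonneg _)
      refine hdet (fun i j => (zmat q.out τ₀ * (Matrix.of Z - τ₀.1)) i j) fun i j => ?_
      have hZ' : ∀ i j, ‖(Matrix.of Z - τ₀.1) i j‖ ≤ r := by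
        intro i j
        rw [Metric.mem_ball, dist_eq_norm] at hZ
        exact ((norm_le_pi_norm _ j).trans (norm_le_pi_norm (Z - Z₀) i)).trans hZ.le
      refine (norm_zmat_mul_le hc hcY hZ' i j).trans_lt ?_
      rw [hr, div_right_comm, mul_div_cancel_right₀ _ hc.ne', ← mul_div_assoc,
        div_lt_iff₀ (by positivity)]
      linarith
    have hne : ∀ (q : Cosets n), ∀ Z ∈ Metric.ball Z₀ r,
        (toC (blkC q.out) * Matrix.of Z + toC (blkD q.out)).det ≠ 0 := by
      intro q Z hZ h0
      have h1 := hlow q Z hZ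
      have h2 := norm_pos_iff.2 (jdet_ne_zero q.out τ₀)
      rw [h0, norm_zero] at h1
      linarith
    refine differentiableAt_tsum_of_norm_le (r := r)
      (u := fun q : Cosets n => B * 2 ^ k * ‖oneSlash k q.out τ₀‖)
      ((summable_norm_oneSlash hn hk τ₀).mul_left _) hr0 (fun q => ?_) (fun q Z hZ => ?_)
    · refine DifferentiableOn.const_mul (fun Z hZ => ?_) _
      refine DifferentiableAt.differentiableWithinAt
        (DifferentiableAt.zpow ?_ (Or.inl (hne q Z hZ)))
      simp only [Matrix.det_apply, Matrix.add_apply, Matrix.mul_apply, Matrix.of_apply]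
      fun_prop
    · have h1 := hlow q Z hZ
      have h2 := norm_pos_iff.2 (jdet_ne_zero q.out τ₀)
      have hB0 : 0 ≤ B := (norm_nonneg _).trans (hB 1)
      rw [norm_mul, norm_zpow, zpow_neg, zpow_natCast, norm_oneSlash, mul_assoc]
      refine mul_le_mul (hB _) ?_ (by positivity) hB0
      rw [← div_eq_mul_inv, le_div_iff₀ (by positivity), inv_mul_le_iff₀
        (pow_pos (norm_pos_iff.2 (hne q Z hZ)) _), ← mul_pow]
      gcongr
      linarith
  · intro τ
    refine tsum_congr fun q => ?_
    rw [oneSlash_apply]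
    rfl

open Filter Topology in
/-- The value at the cusp: only the cosets of `1` and `γ_±` contribute. -/
theorem tendsto_cosetSum_iyPt (hn : 0 < n) (hk : n + 1 < k) (ha : LeftInv a)
    (hB : ∀ x, ‖a x‖ ≤ B) :
    Tendsto (fun m : ℕ => cosetSum k a (iyPt n (m + 1) (by positivity))) atTop
      (𝓝 (a 1 + (-1) ^ k * a (gammaPM n))) := by
  classical
  have hne : cosetMk (1 : Sp n) ≠ cosetMk (gammaPM n) := by
    intro h
    have := rightRel_mk_eq.1 h
    rw [inv_one, mul_one] at this
    exact gammaPM_notMem hn this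
  let g : Cosets n → ℂ := fun q => if q = cosetMk 1 then a 1 else
    if q = cosetMk (gammaPM n) then (-1) ^ k * a (gammaPM n) else 0
  have hg : ∑' q, g q = a 1 + (-1) ^ k * a (gammaPM n) := by
    rw [tsum_eq_sum (s := {cosetMk 1, cosetMk (gammaPM n)}), Finset.sum_pair hne]
    · simp [g, hne.symm]
    · intro q hq
      simp only [Finset.mem_insert, Finset.mem_singleton, not_or] at hq
      simp [g, hq]
  rw [← hg]
  have hone : ∀ τ : SiegelH n, oneSlash k 1 τ = 1 := fun τ => by
    rw [oneSlash_apply, jdet_of_mem (one_mem _), blkD_one]; simp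
  refine tendsto_tsum_of_dominated_convergence
    (bound := fun q => B * ((n.factorial * (1 + n * 1) ^ n) ^ k * (‖jdet q.out (iPt n)‖ ^ k)⁻¹))
    (((summable_jdet_iPt hn hk).mul_left _).mul_left _) (fun q => ?_)
    (Eventually.of_forall fun m q => ?_)
  · by_cases h1 : q = cosetMk 1
    · have : ∀ τ, a q.out * oneSlash k q.out τ = a 1 := fun τ => by
        rw [h1, (ha.mul_oneSlash k τ).out, hone, mul_one]
      simp only [this]
      simp only [g, h1, if_true]
      exact tendsto_const_nhds
    by_cases h2 : q = cosetMk (gammaPM n)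
    · have : ∀ τ, a q.out * oneSlash k q.out τ = (-1) ^ k * a (gammaPM n) := fun τ => by
        have := oneSlash_gammaPM_mul hn k 1 τ
        rw [mul_one, hone, mul_one] at this
        rw [h2, (ha.mul_oneSlash k τ).out, this, mul_comm]
      simp only [this]
      simp only [g, h2, if_true, hne.symm, if_false]
      exact tendsto_const_nhds
    have h3 : q.out ∉ GammaInf n := by
      intro h
      rcases mem_GammaInf_cases hn h with h | h
      · apply h1
        rw [← q.out_eq, eq_comm, rightRel_mk_eq]
        simpa using h
      · apply h2
        rw [← q.out_eq, rightRel_mk_eq]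
        have h4 := conj_mem_GammaInfPlus gammaPM_mem_GammaInf (inv_mem h)
        simpa [mul_assoc, gammaPM_inv, gammaPM_mul_self] using h4
    simp only [g, h1, h2, if_false]
    simpa using (tendsto_oneSlash_iyPt (by omega : k ≠ 0) h3).const_mul (a q.out)
  · rw [norm_mul]
    refine mul_le_mul (hB _) ?_ (norm_nonneg _) ((norm_nonneg _).trans (hB 1))
    exact norm_oneSlash_iyPt_le k q.out (by linarith [Nat.cast_nonneg (α := ℝ) m])

end CosetSums

/-! ### Boundedness in degree one -/

section BoundedAtCusp

theorem jdet_unip {n : ℕ} (S : Matrix (Fin n) (Fin n) ℤ) (h : S.IsSymm) (τ : SiegelH n) :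
    jdet (unip S h) τ = 1 := by
  rw [jdet_of_mem (p := unip S h) rfl]
  simp [unip]

theorem moebius_unip {n : ℕ} (S : Matrix (Fin n) (Fin n) ℤ) (h : S.IsSymm) (τ : SiegelH n) :
    (moebius (unip S h) τ).1 = τ.1 + toC S := by
  change numer (unip S h) τ.1 * (denom (unip S h) τ.1)⁻¹ = _
  simp [numer, denom, unip]

/-- In degree one the sum of the absolute values of the terms is bounded for `Im τ ≥ 1`: it is
invariant under `τ ↦ τ + 1`, and for `|Re τ| ≤ 1` the terms are bounded by those at `i`. -/
theorem exists_norm_cosetSum_le {k : ℕ} (hk : 1 + 1 < k) {a : Sp 1 → ℂ} {B : ℝ}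
    (hB : ∀ x, ‖a x‖ ≤ B) :
    ∃ c : ℝ, ∀ τ : SiegelH 1, 1 ≤ (τ.1 0 0).im → ‖cosetSum k a τ‖ ≤ c := by
  set K : ℝ := (Nat.factorial 1 * (1 + (1 : ℕ) * 1) ^ 1) ^ k
  refine ⟨B * ∑' q : Cosets 1, K * (‖jdet q.out (iPt 1)‖ ^ k)⁻¹, fun τ hτ => ?_⟩
  have hB0 : 0 ≤ B := (norm_nonneg _).trans (hB 1)
  have h1 : ‖cosetSum k a τ‖ ≤ B * ∑' q : Cosets 1, ‖oneSlash k q.out τ‖ := by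
    rw [← tsum_mul_left]
    refine tsum_of_norm_bounded ((summable_norm_oneSlash one_pos hk τ).mul_left B).hasSum
      fun q => ?_
    rw [norm_mul]
    exact mul_le_mul_of_nonneg_right (hB _) (norm_nonneg _)
  refine h1.trans (mul_le_mul_of_nonneg_left ?_ hB0)
  set s : Matrix (Fin 1) (Fin 1) ℤ := Matrix.of fun _ _ => -⌊(τ.1 0 0).re⌋ with hs
  have hsym : s.IsSymm := by ext i j; rfl
  set τ' := moebius (unip s hsym) τ with hτ'
  have hv : τ'.1 0 0 = τ.1 0 0 - ⌊(τ.1 0 0).re⌋ := by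
    rw [hτ', moebius_unip]
    simp [hs, toC, sub_eq_add_neg]
  have hinv : ∑' q : Cosets 1, ‖oneSlash k q.out τ‖ = ∑' q : Cosets 1, ‖oneSlash k q.out τ'‖ := by
    have h := tsum_mul_right (f := fun x : Sp 1 => ‖oneSlash k x τ‖)
      (fun p hp x => by simp only [oneSlash_of_mem_mul k hp]) (unip s hsym)
    rw [← h]
    refine tsum_congr fun q => ?_
    rw [oneSlash_mul, jdet_unip]
    simp
    rfl
  rw [hinv]
  have him : (τ'.1 0 0).im = (τ.1 0 0).im := by rw [hv]; simp
  have hre : (τ'.1 0 0).re = Int.fract (τ.1 0 0).re := by rw [hv]; simp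
  set y := (τ.1 0 0).im with hy
  have hy0 : 0 < y := by linarith
  refine Summable.tsum_le_tsum (fun q => ?_) (summable_norm_oneSlash one_pos hk τ')
    ((summable_jdet_iPt one_pos hk).mul_left K)
  have h := norm_oneSlash_le k q.out τ' (c := y) (R := y) hy0 (fun v => le_of_eq ?_) (fun i j => ?_)
  · rwa [div_self hy0.ne'] at h
  · simp [dotProduct, Matrix.mulVec, him]
    ring
  · rw [Subsingleton.elim i 0, Subsingleton.elim j 0, Matrix.sub_apply, iPt_val]
    simp only [Matrix.smul_apply, Matrix.one_apply_eq, smul_eq_mul, mul_one]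
    refine (Complex.norm_le_abs_re_add_abs_im _).trans ?_
    have f1 := Int.fract_nonneg (τ.1 0 0).re
    have f2 := (Int.fract_lt_one (τ.1 0 0).re).le
    rw [Complex.sub_re, Complex.sub_im, Complex.I_re, Complex.I_im, him, hre, zero_sub, abs_neg,
      abs_of_nonneg f1, abs_of_nonpos (by linarith)]
    linarith

end BoundedAtCusp


/-! ### Finite sums over cosets -/

section CosetFiniteSums

variable {G E : Type*} [Group G] {H : Subgroup G}

theorem apply_out_mk {f : G → E} (hf : ∀ h ∈ H, ∀ x, f (h * x) = f x) (x : G) :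
    f (Quotient.mk (QuotientGroup.rightRel H) x).out = f x := by
  have h := hf _ (out_mul_inv_mem H x) x
  rwa [inv_mul_cancel_right] at h

variable [AddCommMonoid E] [Fintype (Quotient (QuotientGroup.rightRel H))]

theorem sum_out_mul_right {f : G → E} (hf : ∀ h ∈ H, ∀ x, f (h * x) = f x) (g : G) :
    ∑ q : Quotient (QuotientGroup.rightRel H), f (q.out * g) =
      ∑ q : Quotient (QuotientGroup.rightRel H), f q.out := by
  have hbij : Function.Bijective fun q : Quotient (QuotientGroup.rightRel H) =>
      Quotient.mk (QuotientGroup.rightRel H) (q.out * g) := by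
    refine Finite.injective_iff_bijective.1 fun q q' h => ?_
    have h' := rightRel_mk_eq.1 h
    rw [← q.out_eq, ← q'.out_eq, rightRel_mk_eq]
    simpa [mul_assoc] using h'
  rw [← hbij.sum_comp fun q => f q.out]
  exact Finset.sum_congr rfl fun q _ => (apply_out_mk hf _).symm

theorem sum_out_mul_left [H.Normal] {f : G → E} (hf : ∀ h ∈ H, ∀ x, f (h * x) = f x) (g : G) :
    ∑ q : Quotient (QuotientGroup.rightRel H), f (g * q.out) =
      ∑ q : Quotient (QuotientGroup.rightRel H), f q.out := by
  have hbij : Function.Bijective fun q : Quotient (QuotientGroup.rightRel H) =>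
      Quotient.mk (QuotientGroup.rightRel H) (g * q.out) := by
    refine Finite.injective_iff_bijective.1 fun q q' h => ?_
    have h' := Subgroup.Normal.conj_mem ‹H.Normal› _ (rightRel_mk_eq.1 h) g⁻¹
    rw [← q.out_eq, ← q'.out_eq, rightRel_mk_eq]
    simpa [mul_assoc] using h'
  rw [← hbij.sum_comp fun q => f q.out]
  exact Finset.sum_congr rfl fun q _ => (apply_out_mk hf _).symm

end CosetFiniteSums

/-! ### The character of `Γ_0(N)` -/

section Character

variable {n N : ℕ} (χ : DirichletCharacter ℂ N)

theorem chiG_mul {δ : Sp n} (hδ : δ ∈ Gamma0 n N) (β : Sp n) :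
    chiG χ (δ * β) = chiG χ δ * chiG χ β := by
  have h0 := mem_Gamma0_iff.1 hδ
  have h : (((blkD (δ * β)).det : ℤ) : ZMod N) =
      (((blkD δ).det : ℤ) : ZMod N) * (((blkD β).det : ℤ) : ZMod N) := by
    rw [← det_redMat, ← det_redMat, ← det_redMat, blkD_mul, map_add, map_mul, map_mul, h0, zero_mul,
      zero_add, Matrix.det_mul]
  rw [chiG, h, map_mul]
  rfl

theorem chiG_one : chiG χ (1 : Sp n) = 1 := by
  simp [chiG, blkD_one]

theorem chiG_inv_mul {δ : Sp n} (hδ : δ ∈ Gamma0 n N) : chiG χ δ⁻¹ * chiG χ δ = 1 := by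
  rw [← chiG_mul χ (inv_mem hδ), inv_mul_cancel, chiG_one]

theorem conj_chiG {δ : Sp n} (hδ : δ ∈ Gamma0 n N) : conj (chiG χ δ) = chiG χ δ⁻¹ := by
  have h := chiG_inv_mul χ hδ
  have hne : chiG χ δ ≠ 0 := right_ne_zero_of_mul_eq_one h
  have hu : IsUnit ((((blkD δ).det : ℤ) : ZMod N)) := by
    by_contra hu
    exact hne (χ.map_nonunit hu)
  have hnorm : ‖chiG χ δ‖ = 1 := by
    obtain ⟨u, hu⟩ := hu
    rw [chiG, ← hu]
    exact χ.unit_norm_eq_one u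
  have h2 : chiG χ δ * conj (chiG χ δ) = 1 := by
    rw [Complex.mul_conj, Complex.normSq_eq_norm_sq, hnorm]; simp
  rw [mul_comm] at h2
  exact mul_right_cancel₀ hne (h2.trans h.symm)

theorem norm_chiG_le (δ : Sp n) : ‖chiG χ δ‖ ≤ 1 := χ.norm_le_one _

theorem chiG_of_mem_GammaFull {ν : Sp n} (hν : ν ∈ GammaFull n N) : chiG χ ν = 1 := by
  rw [chiG, ← det_redMat, (mem_GammaFull_iff.1 hν).2.2.2, Matrix.det_one, map_one]

theorem chiG_gammaPM (hn : 0 < n) : chiG χ (gammaPM n) = χ (-1) := by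
  rw [chiG, blkD_gammaPM, det_Gpm hn]
  simp

end Character

/-! ### Linearity of the slash operator -/

section Slash

variable {n : ℕ} (k : ℕ)

/-- The slash operator as a linear map. -/
noncomputable def slashLinear (γ : Sp n) : (SiegelH n → ℂ) →ₗ[ℂ] SiegelH n → ℂ where
  toFun f := slash k f γ
  map_add' f g := by funext τ; simp [slash, mul_add]
  map_smul' c f := by
    funext τ
    simp only [slash, Pi.smul_apply, smul_eq_mul, RingHom.id_apply]
    ring

theorem slash_smul (c : ℂ) (f : SiegelH n → ℂ) (γ : Sp n) :
    slash k (c • f) γ = c • slash k f γ := (slashLinear k γ).map_smul c f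

theorem slash_sum {ι : Type*} (s : Finset ι) (f : ι → SiegelH n → ℂ) (γ : Sp n) :
    slash k (∑ i ∈ s, f i) γ = ∑ i ∈ s, slash k (f i) γ := map_sum (slashLinear k γ) f s

end Slash

/-! ### The Eisenstein series of `Γ(N)` -/

section StarSeries

variable {n N k : ℕ}

/-- The characteristic function of `Γ_∞⁺ Γ(N)`. -/
noncomputable def indK (n N : ℕ) : Sp n → ℂ := Set.indicator (KGrp n N) 1

theorem indK_of_mem {x : Sp n} (h : x ∈ KGrp n N) : indK n N x = 1 := Set.indicator_of_mem h 1

theorem indK_of_notMem {x : Sp n} (h : x ∉ KGrp n N) : indK n N x = 0 :=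
  Set.indicator_of_notMem h 1

theorem indK_congr {x y : Sp n} (h : x ∈ KGrp n N ↔ y ∈ KGrp n N) : indK n N x = indK n N y := by
  by_cases hx : x ∈ KGrp n N
  · rw [indK_of_mem hx, indK_of_mem (h.1 hx)]
  · rw [indK_of_notMem hx, indK_of_notMem fun hy => hx (h.2 hy)]

theorem norm_indK_le (x : Sp n) : ‖indK n N x‖ ≤ 1 := by
  by_cases hx : x ∈ KGrp n N
  · rw [indK_of_mem hx, norm_one]
  · rw [indK_of_notMem hx, norm_zero]; exact zero_le_one

theorem leftInv_indK : LeftInv (indK n N) := fun _ hp _ =>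
  indK_congr ((KGrp n N).mul_mem_cancel_left (GammaInfPlus_le_KGrp hp))

/-- The coset of a class of `δ*`. -/
noncomputable def starCoset (c : StarIndex n N) : Cosets n := cosetMk (starRep c)

theorem starCoset_injective : Function.Injective (starCoset : StarIndex n N → Cosets n) := by
  intro c c' h
  have h1 := rightRel_mk_eq.1 h
  rw [← c.out_eq, ← c'.out_eq, rightRel_mk_eq, Subgroup.mem_subgroupOf]
  exact h1

theorem oneSlash_starRep (c : StarIndex n N) (τ : SiegelH n) :
    oneSlash k (starRep c) τ = oneSlash k (starCoset c).out τ := (oneSlash_out _ _ _).symm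

/-- `𝔼*` is the sum over the cosets `Γ_∞⁺ x` contained in `Γ_∞⁺ Γ(N)`. -/
theorem Estar_eq_cosetSum : Estar n N k = cosetSum k (indK n N) := by
  funext τ
  have hsupp : Function.support (fun q : Cosets n => indK n N q.out * oneSlash k q.out τ) ⊆
      Set.range (starCoset : StarIndex n N → Cosets n) := by
    intro q hq
    have hK : q.out ∈ KGrp n N := by
      by_contra h
      exact hq (by simp [indK_of_notMem h])
    obtain ⟨p, hp, ν, hν, hpν⟩ := mem_KGrp.1 hK
    refine ⟨Quotient.mk _ ⟨ν, hν⟩, ?_⟩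
    have h1 := out_mul_inv_mem ((GammaInfPlus n).subgroupOf (GammaFull n N)) ⟨ν, hν⟩
    rw [Subgroup.mem_subgroupOf] at h1
    rw [← q.out_eq, ← hpν, starCoset, rightRel_mk_eq]
    have h2 := mul_mem hp (inv_mem h1)
    simpa [mul_assoc, starRep] using h2
  rw [Estar, cosetSum, ← starCoset_injective.tsum_eq hsupp]
  refine tsum_congr fun c => ?_
  have hc : starRep c ∈ KGrp n N := GammaFull_le_KGrp c.out.2
  rw [oneSlash_starRep, starCoset, leftInv_indK.out, indK_of_mem hc, one_mul]

theorem slash_Estar (γ : Sp n) :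
    slash k (Estar n N k) γ = cosetSum k fun x => indK n N (x * γ⁻¹) := by
  rw [Estar_eq_cosetSum, slash_cosetSum k leftInv_indK]

theorem slash_Estar_mul_left {κ : Sp n} (hκ : κ ∈ KGrp n N) (γ : Sp n) :
    slash k (Estar n N k) (κ * γ) = slash k (Estar n N k) γ := by
  rw [slash_Estar, slash_Estar]
  congr 1
  funext x
  refine indK_congr ?_
  rw [mul_inv_rev, ← mul_assoc]
  exact (KGrp n N).mul_mem_cancel_right (inv_mem hκ)

theorem slash_Estar_gammaPM_mul (hn : 0 < n) (γ : Sp n) :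
    slash k (Estar n N k) (gammaPM n * γ) = (-1 : ℂ) ^ k • slash k (Estar n N k) γ := by
  have h1 : slash k (Estar n N k) (gammaPM n) = (-1 : ℂ) ^ k • Estar n N k := by
    rw [slash_Estar, Estar_eq_cosetSum]
    funext τ
    have h2 := tsum_gammaPM_mul
      (((leftInv_indK (n := n) (N := N)).comp_mul_right (gammaPM n)⁻¹).mul_oneSlash k τ)
    simp only [Pi.smul_apply, smul_eq_mul, cosetSum]
    rw [← h2, ← tsum_mul_left]
    refine tsum_congr fun q => ?_
    rw [oneSlash_gammaPM_mul hn, indK_congr (mul_mem_conj_KGrp gammaPM_mem_GammaInf)]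
    ring
  rw [← slash_slash, h1, slash_smul]

end StarSeries

/-! ### Averages over `Γ(N) \ Γ_0(N)` -/

section Averages

variable {n N k : ℕ} (χ : DirichletCharacter ℂ N)

theorem finite_betaIndex (hN : 0 < N) : Finite (BetaIndex n N) := by
  have : NeZero N := ⟨hN.ne'⟩
  refine Finite.of_injective (fun c : BetaIndex n N =>
    redMat N (betaRep c : Matrix (Fin n ⊕ Fin n) (Fin n ⊕ Fin n) ℤ)) fun c c' h => ?_
  rw [← c.out_eq, ← c'.out_eq, rightRel_mk_eq, Subgroup.mem_subgroupOf]
  change redMat N ((betaRep c' * (betaRep c)⁻¹ : Sp n) :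
    Matrix (Fin n ⊕ Fin n) (Fin n ⊕ Fin n) ℤ) = 1
  simp only at h
  rw [Submonoid.coe_mul, map_mul, ← h, ← map_mul, ← Submonoid.coe_mul, mul_inv_cancel]
  exact map_one _

theorem betaRep_mem (c : BetaIndex n N) : betaRep c ∈ Gamma0 n N := c.out.2

theorem mem_GammaStab_iff {γ δ : Sp n} :
    δ ∈ GammaStab N γ ↔ δ ∈ Gamma0 n N ∧ γ * δ * γ⁻¹ ∈ KGrp n N := by
  have h : δ ∈ GammaStab N γ ↔ δ ∈ Gamma0 n N ∧
      (KGrp n N : Set (Sp n)) * {γ * δ} = (KGrp n N : Set (Sp n)) * {γ} := by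
    rw [coe_KGrp]; rfl
  rw [h]
  refine and_congr_right fun _ => ⟨fun h => ?_, fun h => ?_⟩
  · have h1 : γ * δ ∈ (KGrp n N : Set (Sp n)) * {γ} := by
      rw [← h]; exact ⟨1, one_mem _, γ * δ, rfl, one_mul _⟩
    obtain ⟨κ, hκ, g, hg, hκg⟩ := h1
    rw [Set.mem_singleton_iff] at hg
    simp only [hg] at hκg
    rw [← hκg, mul_inv_cancel_right]
    exact hκ
  · ext x
    simp only [Set.mem_mul, Set.mem_singleton_iff, exists_eq_left, SetLike.mem_coe]
    constructor
    · rintro ⟨κ, hκ, rfl⟩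
      exact ⟨κ * (γ * δ * γ⁻¹), mul_mem hκ h, by group⟩
    · rintro ⟨κ, hκ, rfl⟩
      exact ⟨κ * (γ * δ * γ⁻¹)⁻¹, mul_mem hκ (inv_mem h), by group⟩

theorem GammaFull_le_GammaStab (γ : Sp n) : GammaFull n N ≤ GammaStab N γ := fun ν hν =>
  mem_GammaStab_iff.2 ⟨GammaFull_le_Gamma0 hν,
    GammaFull_le_KGrp (GammaFull_normal.conj_mem ν hν γ)⟩

theorem GammaStab_le_Gamma0 (γ : Sp n) : GammaStab N γ ≤ Gamma0 n N := fun _ h => h.1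

variable [Fintype (BetaIndex n N)]

theorem sum_betaRep_mul_right {E : Type*} [AddCommMonoid E] {f : Sp n → E}
    (hf : ∀ ν ∈ GammaFull n N, ∀ x, f (ν * x) = f x) {δ : Sp n} (hδ : δ ∈ Gamma0 n N) :
    ∑ c : BetaIndex n N, f (betaRep c * δ) = ∑ c : BetaIndex n N, f (betaRep c) :=
  sum_out_mul_right (H := (GammaFull n N).subgroupOf (Gamma0 n N))
    (f := fun x : Gamma0 n N => f x) (fun h hh x => hf h hh x) ⟨δ, hδ⟩

theorem sum_betaRep_mul_left {E : Type*} [AddCommMonoid E] {f : Sp n → E}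
    (hf : ∀ ν ∈ GammaFull n N, ∀ x, f (ν * x) = f x) {δ : Sp n} (hδ : δ ∈ Gamma0 n N) :
    ∑ c : BetaIndex n N, f (δ * betaRep c) = ∑ c : BetaIndex n N, f (betaRep c) :=
  sum_out_mul_left (H := (GammaFull n N).subgroupOf (Gamma0 n N))
    (f := fun x : Gamma0 n N => f x) (fun h hh x => hf h hh x) ⟨δ, hδ⟩

/-- The unnormalized average `∑_β χ̄(β) f|β` over `Γ(N) \ Γ_0(N)`, as a linear map in `f`. -/
noncomputable def betaAverage (k : ℕ) : (SiegelH n → ℂ) →ₗ[ℂ] SiegelH n → ℂ :=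
  ∑ c : BetaIndex n N, conj (chiG χ (betaRep c)) • slashLinear k (betaRep c)

theorem betaAverage_apply (f : SiegelH n → ℂ) :
    betaAverage χ k f = ∑ c : BetaIndex n N, conj (chiG χ (betaRep c)) • slash k f (betaRep c) := by
  simp [betaAverage, slashLinear]

/-- `∑_β χ̄(β) 𝔼*|γβ`. -/
noncomputable def EGam (k : ℕ) (γ : Sp n) : SiegelH n → ℂ :=
  betaAverage χ k (slash k (Estar n N k) γ)

theorem EGam_eq (γ : Sp n) : EGam χ k γ =
    ∑ c : BetaIndex n N, conj (chiG χ (betaRep c)) • slash k (Estar n N k) (γ * betaRep c) := by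
  simp only [EGam, betaAverage_apply, slash_slash]

theorem EGam_mul_left {κ : Sp n} (hκ : κ ∈ KGrp n N) (γ : Sp n) :
    EGam χ k (κ * γ) = EGam χ k γ := by
  rw [EGam, slash_Estar_mul_left hκ, EGam]

theorem EGam_gammaPM_mul (hn : 0 < n) (γ : Sp n) :
    EGam χ k (gammaPM n * γ) = (-1 : ℂ) ^ k • EGam χ k γ := by
  rw [EGam, slash_Estar_gammaPM_mul hn, map_smul, EGam]

/-- `Γ(N)` is normal, so left translation by `δ` permutes its cosets in `Γ_0(N)`. -/
theorem EGam_mul_right (γ : Sp n) {δ : Sp n} (hδ : δ ∈ Gamma0 n N) :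
    EGam χ k (γ * δ) = chiG χ δ • EGam χ k γ := by
  have h := sum_betaRep_mul_left
    (f := fun β => conj (chiG χ β) • slash k (Estar n N k) (γ * β)) (fun ν hν β => by
      have e : γ * (ν * β) = γ * ν * γ⁻¹ * (γ * β) := by group
      simp only [chiG_mul χ (GammaFull_le_Gamma0 hν), chiG_of_mem_GammaFull χ hν, one_mul]
      rw [e, slash_Estar_mul_left (GammaFull_le_KGrp (GammaFull_normal.conj_mem ν hν γ))]) hδ
  rw [← EGam_eq] at h
  simp only [chiG_mul χ hδ, map_mul, mul_smul, ← mul_assoc γ δ] at h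
  rw [← Finset.smul_sum, ← EGam_eq, conj_chiG χ hδ] at h
  rw [← h, smul_smul, mul_comm, chiG_inv_mul χ hδ, one_smul]

/-- It follows that `∑_β χ̄(β) 𝔼*|γβ` vanishes unless `χ(-1) = (-1)^k`. The identity holds because
`γ_± γ ∈ Γ_∞⁺ Γ(N) γ δ` for some `δ ∈ Γ_0(N)` with `χ(δ) = χ(-1)`. -/
theorem smul_EGam_eq (hn : 0 < n) (hN : 0 < N) (γ : Sp n) :
    (-1 : ℂ) ^ k • EGam χ k γ = χ (-1) • EGam χ k γ := by
  obtain ⟨δ, hδ, hdet, hK⟩ := exists_mem_Gamma0_gammaPM hn hN γ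
  have hχ : chiG χ δ = χ (-1) := by rw [chiG, hdet]
  have e : gammaPM n * γ * δ = gammaPM n * γ * δ * γ⁻¹ * γ := by group
  have h1 : EGam χ k (gammaPM n * γ * δ) = EGam χ k γ := by rw [e, EGam_mul_left χ hK]
  rw [EGam_mul_right χ _ hδ, EGam_gammaPM_mul χ hn, hχ] at h1
  have h2 : χ (-1) * χ (-1) = 1 := by rw [← map_mul]; simp
  calc _ = (χ (-1) * χ (-1)) • ((-1 : ℂ) ^ k • EGam χ k γ) := by rw [h2, one_smul]
    _ = χ (-1) • EGam χ k γ := by rw [mul_smul, h1]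

/-- On `Γ_γ⁺` right translation of `γ` is a left translation by `Γ_∞⁺ Γ(N)`, which has no effect. -/
theorem EGam_eq_zero_of_chiG_ne_one {γ δ : Sp n} (hδ : δ ∈ GammaStab N γ) (hχ : chiG χ δ ≠ 1) :
    EGam χ k γ = 0 := by
  obtain ⟨h0, hK⟩ := mem_GammaStab_iff.1 hδ
  have h1 := EGam_mul_right (k := k) χ γ h0
  have e : γ * δ = γ * δ * γ⁻¹ * γ := by group
  rw [e, EGam_mul_left χ hK] at h1
  have h2 : (1 - chiG χ δ) • EGam χ k γ = 0 := by
    rw [sub_smul, one_smul, ← h1, sub_self]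
  exact (smul_eq_zero.1 h2).resolve_left (sub_ne_zero.2 (Ne.symm hχ))

open Classical in
/-- The number of `β` in `Γ_γ⁺` is the index `[Γ_γ⁺ : Γ(N)]`. -/
theorem sum_betaRep_mem_GammaStab (γ : Sp n) :
    ∑ c : BetaIndex n N, (if betaRep c ∈ GammaStab N γ then (1 : ℂ) else 0) =
      (GammaFull n N).relIndex (GammaStab N γ) := by
  rw [Finset.sum_boole, Nat.cast_inj, ← Fintype.card_subtype, ← Nat.card_eq_fintype_card,
    Subgroup.relIndex, Subgroup.index, ← Nat.card_congr
      (QuotientGroup.quotientRightRelEquivQuotientLeftRel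
        ((GammaFull n N).subgroupOf (GammaStab N γ)))]
  let s : Quotient (QuotientGroup.rightRel ((GammaFull n N).subgroupOf (GammaStab N γ))) →
      BetaIndex n N := fun q => Quotient.mk _ ⟨q.out, GammaStab_le_Gamma0 γ q.out.2⟩
  have hs : ∀ q, betaRep (s q) ∈ GammaStab N γ := by
    intro q
    have h1 := out_mul_inv_mem ((GammaFull n N).subgroupOf (Gamma0 n N))
      ⟨q.out, GammaStab_le_Gamma0 γ q.out.2⟩
    rw [Subgroup.mem_subgroupOf] at h1
    have h2 := mul_mem (GammaFull_le_GammaStab γ h1) q.out.2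
    simpa [betaRep, s] using h2
  refine (Nat.card_congr (Equiv.ofBijective
    (fun q => (⟨s q, hs q⟩ : {c : BetaIndex n N // betaRep c ∈ GammaStab N γ}))
    ⟨fun q q' h => ?_, fun c => ?_⟩)).symm
  · have h1 := rightRel_mk_eq.1 (Subtype.ext_iff.1 h)
    rw [Subgroup.mem_subgroupOf] at h1
    rw [← q.out_eq, ← q'.out_eq, rightRel_mk_eq, Subgroup.mem_subgroupOf]
    exact h1
  · obtain ⟨c, hc⟩ := c
    refine ⟨Quotient.mk _ ⟨betaRep c, hc⟩, Subtype.ext ?_⟩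
    have h1 := out_mul_inv_mem ((GammaFull n N).subgroupOf (GammaStab N γ)) ⟨betaRep c, hc⟩
    change s _ = c
    conv_rhs => rw [← c.out_eq]
    rw [eq_comm, rightRel_mk_eq, Subgroup.mem_subgroupOf]
    exact h1

theorem relIndex_ne_zero (γ : Sp n) :
    ((GammaFull n N).relIndex (GammaStab N γ) : ℂ) ≠ 0 := by
  classical
  rw [← sum_betaRep_mem_GammaStab, Finset.sum_boole, Nat.cast_ne_zero]
  refine (Finset.card_pos.2 ⟨Quotient.mk _ 1, ?_⟩).ne'
  rw [Finset.mem_filter]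
  refine ⟨Finset.mem_univ _, GammaFull_le_GammaStab γ ?_⟩
  have h1 := out_mul_inv_mem ((GammaFull n N).subgroupOf (Gamma0 n N)) 1
  rw [inv_one, mul_one, Subgroup.mem_subgroupOf] at h1
  exact h1

/-- The coefficient function of `𝔼_γ`. If `χ` is trivial on `Γ_γ⁺`, its value is `χ̄(β)` at
`x ∈ Γ_∞⁺ Γ(N) γ β`, `β ∈ Γ_0(N)`, and `0` elsewhere. -/
noncomputable def coeffE (γ x : Sp n) : ℂ :=
  ((GammaFull n N).relIndex (GammaStab N γ) : ℂ)⁻¹ *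
    ∑ c : BetaIndex n N, conj (chiG χ (betaRep c)) * indK n N (x * (γ * betaRep c)⁻¹)

theorem leftInv_coeffE (γ : Sp n) : LeftInv (coeffE χ γ) := fun p hp x => by
  simp only [coeffE, mul_assoc p, leftInv_indK p hp]

theorem exists_norm_coeffE_le (γ : Sp n) : ∃ B : ℝ, ∀ x, ‖coeffE χ γ x‖ ≤ B := by
  refine ⟨‖((GammaFull n N).relIndex (GammaStab N γ) : ℂ)⁻¹‖ * ∑ _c : BetaIndex n N, 1 * 1,
    fun x => ?_⟩
  rw [coeffE, norm_mul]
  refine mul_le_mul_of_nonneg_left ((norm_sum_le _ _).trans (Finset.sum_le_sum fun c _ => ?_))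
    (norm_nonneg _)
  rw [norm_mul, RCLike.norm_conj]
  exact mul_le_mul (norm_chiG_le χ _) (norm_indK_le _) (norm_nonneg _) zero_le_one

theorem coeffE_of_mem {γ x β : Sp n} (htriv : ∀ δ ∈ GammaStab N γ, chiG χ δ = 1)
    (hβ : β ∈ Gamma0 n N) (hx : x * (γ * β)⁻¹ ∈ KGrp n N) :
    coeffE χ γ x = conj (chiG χ β) := by
  classical
  have h := sum_betaRep_mul_right
    (f := fun b => conj (chiG χ b) * indK n N (x * (γ * b)⁻¹)) (fun ν hν b => by
      simp only [chiG_mul χ (GammaFull_le_Gamma0 hν), chiG_of_mem_GammaFull χ hν, one_mul]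
      congr 1
      refine indK_congr ?_
      have e : x * (γ * (ν * b))⁻¹ = x * (γ * b)⁻¹ * (γ * ν * γ⁻¹)⁻¹ := by group
      rw [e]
      exact (KGrp n N).mul_mem_cancel_right
        (inv_mem (GammaFull_le_KGrp (GammaFull_normal.conj_mem ν hν γ)))) hβ
  rw [coeffE, ← h]
  have hterm : ∀ c : BetaIndex n N,
      conj (chiG χ (betaRep c * β)) * indK n N (x * (γ * (betaRep c * β))⁻¹) =
        conj (chiG χ β) * if betaRep c ∈ GammaStab N γ then 1 else 0 := by
    intro c
    have hiff : x * (γ * (betaRep c * β))⁻¹ ∈ KGrp n N ↔ betaRep c ∈ GammaStab N γ := by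
      have e : x * (γ * (betaRep c * β))⁻¹ = x * (γ * β)⁻¹ * (γ * betaRep c * γ⁻¹)⁻¹ := by group
      rw [e, (KGrp n N).mul_mem_cancel_left hx, inv_mem_iff, mem_GammaStab_iff]
      exact ⟨fun h => ⟨betaRep_mem c, h⟩, fun h => h.2⟩
    rw [chiG_mul χ (betaRep_mem c), map_mul]
    by_cases hc : betaRep c ∈ GammaStab N γ
    · rw [if_pos hc, indK_of_mem (hiff.2 hc), htriv _ hc]
      simp
    · rw [if_neg hc, indK_of_notMem fun h => hc (hiff.1 h)]
      simp
  rw [Finset.sum_congr rfl fun c _ => hterm c, ← Finset.mul_sum, sum_betaRep_mem_GammaStab,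
    mul_comm, mul_assoc, mul_inv_cancel₀ (relIndex_ne_zero γ), mul_one]

theorem exists_of_coeffE_ne_zero {γ x : Sp n} (h : coeffE χ γ x ≠ 0) :
    ∃ β ∈ Gamma0 n N, x * (γ * β)⁻¹ ∈ KGrp n N := by
  by_contra hne
  push Not at hne
  apply h
  rw [coeffE, Finset.sum_eq_zero, mul_zero]
  intro c _
  rw [indK_of_notMem (hne _ (betaRep_mem c)), mul_zero]

theorem smul_EGam_eq_cosetSum (hn : 0 < n) (hk : n + 1 < k) (γ : Sp n) :
    ((GammaFull n N).relIndex (GammaStab N γ) : ℂ)⁻¹ • EGam χ k γ = cosetSum k (coeffE χ γ) := by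
  funext τ
  simp only [EGam_eq, slash_Estar, Pi.smul_apply, Finset.sum_apply, cosetSum, smul_eq_mul, coeffE,
    Finset.mul_sum, Finset.sum_mul, ← tsum_mul_left]
  rw [Summable.tsum_finsetSum]
  · refine Finset.sum_congr rfl fun c _ => tsum_congr fun q => by ring
  · intro c _
    refine (((summable_cosetSum hn hk (a := fun x => indK n N (x * (γ * betaRep c)⁻¹))
      (fun x => norm_indK_le _) τ).mul_left (conj (chiG χ (betaRep c)))).mul_left
        (((GammaFull n N).relIndex (GammaStab N γ) : ℂ)⁻¹)).congr fun q => by ring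

/-- The two halves of `𝔼'_γ` coincide: the second is `χ(-1) (-1)^k` times the first, and the first
vanishes unless this sign is `1`. -/
theorem E_eq_smul_EGam (hn : 0 < n) (hN : 0 < N) (γ : Sp n) :
    E k χ γ = ((GammaFull n N).relIndex (GammaStab N γ) : ℂ)⁻¹ • EGam χ k γ := by
  have hpm : χ (-1) * χ (-1) = 1 := by rw [← map_mul]; simp
  have hreal : conj (χ (-1)) = χ (-1) := by
    rw [← chiG_gammaPM χ hn, conj_chiG χ gammaPM_mem_Gamma0, gammaPM_inv]
  have h1 : Eprime k χ γ = (2 : ℂ) • EGam χ k γ := by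
    have h2 : Eprime k χ γ = EGam χ k γ + χ (-1) • EGam χ k (gammaPM n * γ) := by
      funext τ
      simp only [Eprime, finsum_eq_sum_of_fintype, EGam_eq, Pi.add_apply, Pi.smul_apply,
        Finset.sum_apply, smul_eq_mul, Finset.mul_sum, chiG_mul χ gammaPM_mem_Gamma0,
        chiG_gammaPM χ hn, map_mul, hreal, mul_assoc]
    rw [h2, EGam_gammaPM_mul χ hn, smul_EGam_eq χ hn hN, smul_smul, hpm, one_smul, two_smul]
  rw [E, h1, smul_smul]
  congr 1
  rw [mul_inv]
  field_simp

theorem E_eq_cosetSum (hn : 0 < n) (hN : 0 < N) (hk : n + 1 < k) (γ : Sp n) :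
    E k χ γ = cosetSum k (coeffE χ γ) := by
  rw [E_eq_smul_EGam χ hn hN, smul_EGam_eq_cosetSum χ hn hk]

theorem EGam_eq_smul_E (hn : 0 < n) (hN : 0 < N) (γ : Sp n) :
    EGam χ k γ = ((GammaFull n N).relIndex (GammaStab N γ) : ℂ) • E k χ γ := by
  rw [E_eq_smul_EGam χ hn hN, smul_smul, mul_inv_cancel₀ (relIndex_ne_zero γ), one_smul]

end Averages


/-! ### Values at the cusps and nonvanishing -/

section Nonvanishing

/-- For `N ≤ 2` one has `-1 = 1` modulo `N`, so `χ(-1) = (-1)^k` forces `k` to be even. -/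
theorem two_lt_or_even {N k : ℕ} (χ : DirichletCharacter ℂ N) (hN : 0 < N)
    (hχ : χ (-1) = (-1) ^ k) : 2 < N ∨ Even k := by
  by_contra h
  push Not at h
  obtain ⟨h1, h2⟩ := h
  have e : (-1 : ZMod N) = 1 := by
    have : N = 1 ∨ N = 2 := by omega
    rcases this with rfl | rfl <;> decide
  rw [e, map_one, (Nat.not_even_iff_odd.1 h2).neg_one_pow] at hχ
  norm_num at hχ

variable {n N k : ℕ} (χ : DirichletCharacter ℂ N) [Fintype (BetaIndex n N)]

open Filter Topology in
/-- The value of `𝔼_γ` at the cusp of `γ'`. -/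
theorem tendsto_slash_E (hn : 0 < n) (hN : 0 < N) (hk : n + 1 < k) (γ γ' : Sp n) :
    Tendsto (fun m : ℕ => slash k (E k χ γ) γ'⁻¹ (iyPt n (m + 1) (by positivity))) atTop
      (𝓝 (coeffE χ γ γ' + (-1) ^ k * coeffE χ γ (gammaPM n * γ'))) := by
  obtain ⟨B, hB⟩ := exists_norm_coeffE_le χ γ
  have h := tendsto_cosetSum_iyPt hn hk
    ((leftInv_coeffE χ γ).comp_mul_right γ') (fun x => hB (x * γ'))
  rw [one_mul] at h
  rwa [E_eq_cosetSum χ hn hN hk, slash_cosetSum k (leftInv_coeffE χ γ), inv_inv]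

/-- The value of `𝔼_γ` at its own cusp is `2`. -/
theorem cusp_value_self (hn : 0 < n) (hN : 0 < N) {γ : Sp n} (hχ : χ (-1) = (-1) ^ k)
    (htriv : ∀ δ ∈ GammaStab N γ, chiG χ δ = 1) :
    coeffE χ γ γ + (-1) ^ k * coeffE χ γ (gammaPM n * γ) = 2 := by
  obtain ⟨δ, hδ, hdet, hK⟩ := exists_mem_Gamma0_gammaPM hn hN γ
  have h1 : coeffE χ γ γ = 1 := by
    rw [coeffE_of_mem χ htriv (one_mem _) (by simp), chiG_one, map_one]
  have h2 : coeffE χ γ (gammaPM n * γ) = (-1) ^ k := by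
    rw [coeffE_of_mem χ htriv (inv_mem hδ) (by simpa [mul_assoc] using hK),
      conj_chiG χ (inv_mem hδ), inv_inv, ← hχ, chiG, hdet]
  rw [h1, h2, ← mul_pow]
  norm_num

theorem E_ne_zero_of (hn : 0 < n) (hN : 0 < N) (hk : n + 1 < k) {γ : Sp n}
    (hχ : χ (-1) = (-1) ^ k) (htriv : ∀ δ ∈ GammaStab N γ, chiG χ δ = 1) : E k χ γ ≠ 0 := by
  intro h0
  have h := tendsto_slash_E χ hn hN hk γ γ
  have h1 : slash k (0 : SiegelH n → ℂ) γ⁻¹ = 0 := map_zero (slashLinear k γ⁻¹)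
  rw [cusp_value_self χ hn hN hχ htriv, h0, h1] at h
  exact two_ne_zero (tendsto_nhds_unique h tendsto_const_nhds)

theorem chi_neg_one_of_E_ne_zero (hn : 0 < n) (hN : 0 < N) {γ : Sp n} (h : E k χ γ ≠ 0) :
    χ (-1) = (-1) ^ k := by
  have h1 := smul_EGam_eq (k := k) χ hn hN γ
  have h2 : EGam χ k γ ≠ 0 := fun h0 => h (by rw [E_eq_smul_EGam χ hn hN, h0, smul_zero])
  exact (smul_left_injective ℂ h2 h1).symm

theorem chiG_eq_one_of_E_ne_zero (hn : 0 < n) (hN : 0 < N) {γ : Sp n} (h : E k χ γ ≠ 0) :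
    ∀ δ ∈ GammaStab N γ, chiG χ δ = 1 := by
  intro δ hδ
  by_contra hne
  exact h (by rw [E_eq_smul_EGam χ hn hN, EGam_eq_zero_of_chiG_ne_one χ hδ hne, smul_zero])

end Nonvanishing

/-! ### Expansion over an orbit -/

section OrbitSums

variable {n N k : ℕ} (χ : DirichletCharacter ℂ N) [Fintype (BetaIndex n N)]

/-- `𝔼_γ = ∑ χ̄(β_s) 1|γβ_s` over any family `β_s ∈ Γ_0(N)` such that the cosets `Γ_∞⁺ γ β_s` are
distinct and exhaust `Γ_∞⁺ γ Γ_0(N)`. -/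
theorem hasSum_E (hn : 0 < n) (hN : 0 < N) (hk : n + 1 < k) {γ : Sp n}
    (htriv : ∀ δ ∈ GammaStab N γ, chiG χ δ = 1) {S : Type*} (β : S → Sp n)
    (hβ : ∀ s, β s ∈ Gamma0 n N)
    (hinj : ∀ s t, γ * β s * (γ * β t)⁻¹ ∈ GammaInfPlus n → s = t)
    (hcov : ∀ b ∈ Gamma0 n N, ∃ s, γ * b * (γ * β s)⁻¹ ∈ GammaInfPlus n) (τ : SiegelH n) :
    HasSum (fun s => conj (chiG χ (β s)) * oneSlash k (γ * β s) τ) (E k χ γ τ) := by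
  obtain ⟨B, hB⟩ := exists_norm_coeffE_le χ γ
  have hsum := (summable_cosetSum hn hk hB τ).hasSum
  have hval : ∑' q : Cosets n, coeffE χ γ q.out * oneSlash k q.out τ = E k χ γ τ := by
    rw [E_eq_cosetSum χ hn hN hk]; rfl
  rw [hval] at hsum
  have hi : Function.Injective fun s => cosetMk (γ * β s) := fun s t h =>
    (hinj t s (rightRel_mk_eq.1 h)).symm
  have hsupp : ∀ q, q ∉ Set.range (fun s => cosetMk (γ * β s)) →
      coeffE χ γ q.out * oneSlash k q.out τ = 0 := by
    intro q hq
    by_contra hne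
    obtain ⟨b, hb, hK⟩ := exists_of_coeffE_ne_zero χ (left_ne_zero_of_mul hne)
    obtain ⟨p, hp, ν, hν, hpν⟩ := mem_KGrp.1 hK
    obtain ⟨s, hs⟩ := hcov (γ⁻¹ * ν * γ * b) (mul_mem (GammaFull_le_Gamma0
      (by simpa using GammaFull_normal.conj_mem ν hν γ⁻¹)) hb)
    refine hq ⟨s, ?_⟩
    rw [← q.out_eq]
    refine rightRel_mk_eq.2 ?_
    have e : q.out = p * (γ * (γ⁻¹ * ν * γ * b)) := by
      have : q.out = p * ν * (γ * b) := by rw [hpν]; group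
      rw [this]; group
    rw [e, mul_assoc]
    exact mul_mem hp hs
  convert (hi.hasSum_iff hsupp).2 hsum using 1
  funext s
  rw [Function.comp_apply, ((leftInv_coeffE χ γ).mul_oneSlash k τ).out,
    coeffE_of_mem χ htriv (hβ s) (by simp)]

theorem hasSum_of_isOrbitReps (hn : 0 < n) (hN : 0 < N) (hk : n + 1 < k) {γ : Sp n}
    (htriv : ∀ δ ∈ GammaStab N γ, chiG χ δ = 1) {S : Set (Sp n)} (hS : IsOrbitReps N γ S)
    (τ : SiegelH n) :
    HasSum (fun δ : S => conj (chiG χ δ.1) * oneSlash k (γ * δ.1) τ) (E k χ γ τ) := by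
  obtain ⟨h0, hU, hd⟩ := hS
  refine hasSum_E χ hn hN hk htriv (fun δ : S => δ.1) (fun δ => h0 δ.2) (fun s t h => ?_)
    (fun b hb => ?_) τ
  · by_contra hne
    have h1 := hd s.2 t.2 (fun h => hne (Subtype.ext h))
    refine Set.disjoint_left.1 h1 (show γ * s.1 ∈ _ from ?_) ?_
    · exact ⟨1, one_mem _, _, rfl, one_mul _⟩
    · exact ⟨_, h, _, rfl, inv_mul_cancel_right _ _⟩
  · have h1 : γ * b ∈ DoubleCoset.doubleCoset γ (GammaInfPlus n : Set (Sp n))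
        (Gamma0 n N : Set (Sp n)) :=
      DoubleCoset.mem_doubleCoset.2 ⟨1, one_mem _, b, hb, by rw [one_mul]⟩
    rw [hU] at h1
    simp only [Set.mem_iUnion] at h1
    obtain ⟨δ, hδ, p, hp, g, hg, hpg⟩ := h1
    rw [Set.mem_singleton_iff] at hg
    refine ⟨⟨δ, hδ⟩, ?_⟩
    simp only [hg] at hpg
    rw [← hpg, mul_inv_cancel_right]
    exact hp

end OrbitSums

/-! ### Coprime symmetric pairs -/

section Pairs

variable {n N k : ℕ}

theorem mem_slOrbit_self (p : IntPair n) : p ∈ slOrbit p := ⟨1, by simp⟩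

theorem mem_slOrbit_trans {p q r : IntPair n} (h : p ∈ slOrbit q) (h' : q ∈ slOrbit r) :
    p ∈ slOrbit r := by
  obtain ⟨U, rfl⟩ := h
  obtain ⟨V, rfl⟩ := h'
  exact ⟨U * V, by rw [Matrix.SpecialLinearGroup.coe_mul, Matrix.mul_assoc]⟩

theorem mem_slOrbit_symm {p q : IntPair n} (h : p ∈ slOrbit q) : q ∈ slOrbit p := by
  obtain ⟨U, rfl⟩ := h
  refine ⟨U⁻¹, ?_⟩
  rw [← Matrix.mul_assoc, ← Matrix.SpecialLinearGroup.coe_mul, inv_mul_cancel]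
  simp

theorem lowerPair_mul (γ δ : Sp n) :
    lowerPair γ * (δ : Matrix (Fin n ⊕ Fin n) (Fin n ⊕ Fin n) ℤ) = lowerPair (γ * δ) := by
  rw [lowerPair, lowerPair, coe_eq_fromBlocks δ, Matrix.fromCols_mul_fromBlocks, blkC_mul, blkD_mul]

theorem inOrbit_iff {γ δ : Sp n} {p : IntPair n} :
    InOrbit γ δ p ↔ p ∈ slOrbit (lowerPair (γ * δ)) := by
  rw [InOrbit, lowerPair_mul]

/-- Two symplectic matrices have the same bottom rows up to `SL_n(ℤ)` if and only if they lie in the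
same coset of `Γ_∞⁺`. -/
theorem lowerPair_mem_slOrbit_iff {x y : Sp n} :
    lowerPair x ∈ slOrbit (lowerPair y) ↔ x * y⁻¹ ∈ GammaInfPlus n := by
  constructor
  · rintro ⟨U, hU⟩
    have h1 : lowerPair (x * y⁻¹) = (U : Matrix (Fin n) (Fin n) ℤ) * lowerPair (1 : Sp n) := by
      rw [← lowerPair_mul, hU, Matrix.mul_assoc, lowerPair_mul, mul_inv_cancel]
    rw [lowerPair, lowerPair, Matrix.mul_fromCols, blkC_one, blkD_one, Matrix.mul_zero,
      Matrix.mul_one] at h1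
    have h2 := congrArg Matrix.toCols₁ h1
    have h3 := congrArg Matrix.toCols₂ h1
    simp only [Matrix.toCols₁_fromCols, Matrix.toCols₂_fromCols] at h2 h3
    exact mem_GammaInfPlus'.2 ⟨h2, by rw [h3, U.det_coe]⟩
  · intro h
    obtain ⟨hC, hD⟩ := mem_GammaInfPlus'.1 h
    refine ⟨⟨blkD (x * y⁻¹), hD⟩, ?_⟩
    have e : x = x * y⁻¹ * y := by group
    conv_lhs => rw [e]
    rw [lowerPair, lowerPair, Matrix.mul_fromCols, blkC_mul, blkD_mul _ y, hC, Matrix.zero_mul,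
      Matrix.zero_mul, zero_add, zero_add]

theorem pairDet_of_mem {p : IntPair n} {x : Sp n} (h : p ∈ slOrbit (lowerPair x)) (τ : SiegelH n) :
    pairDet p τ = jdet x τ := by
  obtain ⟨U, rfl⟩ := h
  have e : pairDet ((U : Matrix (Fin n) (Fin n) ℤ) * lowerPair x) τ =
      (toC (U : Matrix (Fin n) (Fin n) ℤ) * denom x τ.1).det := by
    rw [pairDet, lowerPair, Matrix.mul_fromCols, Matrix.toCols₁_fromCols, Matrix.toCols₂_fromCols,
      toC_mul, toC_mul, denom, Matrix.mul_add, Matrix.mul_assoc]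
  rw [e, Matrix.det_mul, det_toC, U.det_coe, Int.cast_one, one_mul]
  rfl

variable (χ : DirichletCharacter ℂ N)

theorem chiPair_eq {γ δ : Sp n} (htriv : ∀ δ ∈ GammaStab N γ, chiG χ δ = 1) {p : IntPair n}
    (hδ : δ ∈ Gamma0 n N) (h : InOrbit γ δ p) : chiPair χ γ p = chiG χ δ := by
  have hex : ∃ δ ∈ Gamma0 n N, InOrbit γ δ p := ⟨δ, hδ, h⟩
  obtain ⟨h1, h2⟩ := hex.choose_spec
  rw [chiPair, dif_pos hex]
  set ε := hex.choose
  have h3 := lowerPair_mem_slOrbit_iff.1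
    (mem_slOrbit_trans (mem_slOrbit_symm (inOrbit_iff.1 h2)) (inOrbit_iff.1 h))
  have h4 : ε * δ⁻¹ ∈ GammaStab N γ := by
    refine mem_GammaStab_iff.2 ⟨mul_mem h1 (inv_mem hδ), GammaInfPlus_le_KGrp ?_⟩
    simpa [mul_assoc] using h3
  have h5 := htriv _ h4
  have e : ε = ε * δ⁻¹ * δ := by group
  rw [e, chiG_mul χ (mul_mem h1 (inv_mem hδ)), h5, one_mul]

theorem hasSum_of_isPairReps [Fintype (BetaIndex n N)] (hn : 0 < n) (hN : 0 < N) (hk : n + 1 < k)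
    {γ : Sp n} (htriv : ∀ δ ∈ GammaStab N γ, chiG χ δ = 1) {P : Set (IntPair n)}
    (hP : IsPairReps N γ P) (τ : SiegelH n) :
    HasSum (fun p : P => conj (chiPair χ γ p.1) * pairDet p.1 τ ^ (-(k : ℤ))) (E k χ γ τ) := by
  obtain ⟨-, hU, hd⟩ := hP
  have hex : ∀ p : P, ∃ δ ∈ Gamma0 n N, InOrbit γ δ p.1 := by
    intro p
    have : p.1 ∈ ⋃ p ∈ P, slOrbit p :=
      Set.mem_iUnion₂.2 ⟨p.1, p.2, mem_slOrbit_self _⟩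
    rwa [← hU] at this
  choose β hβ hβo using hex
  have h := hasSum_E χ hn hN hk htriv β hβ (fun p q h => ?_) (fun b hb => ?_) τ
  · convert h using 2 with p
    rw [chiPair_eq χ htriv (hβ p) (hβo p), pairDet_of_mem (inOrbit_iff.1 (hβo p)), oneSlash_apply]
  · by_contra hne
    have h1 := hd p.2 q.2 (fun h => hne (Subtype.ext h))
    refine Set.disjoint_left.1 h1 (mem_slOrbit_self p.1) ?_
    exact mem_slOrbit_trans (inOrbit_iff.1 (hβo p)) (mem_slOrbit_trans
      (lowerPair_mem_slOrbit_iff.2 h) (mem_slOrbit_symm (inOrbit_iff.1 (hβo q))))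
  · have h1 : lowerPair (γ * b) ∈ ⋃ p ∈ P, slOrbit p := by
      rw [← hU]
      exact ⟨b, hb, inOrbit_iff.2 (mem_slOrbit_self _)⟩
    obtain ⟨p, hp, h2⟩ := Set.mem_iUnion₂.1 h1
    exact ⟨⟨p, hp⟩, lowerPair_mem_slOrbit_iff.1
      (mem_slOrbit_trans h2 (inOrbit_iff.1 (hβo ⟨p, hp⟩)))⟩

end Pairs

/-! ### The space of Eisenstein series -/

section Basis

variable {n N k : ℕ} (χ : DirichletCharacter ℂ N) [Fintype (BetaIndex n N)]

theorem slash_EGam (γ : Sp n) {δ : Sp n} (hδ : δ ∈ Gamma0 n N) :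
    slash k (EGam χ k γ) δ = chiG χ δ • EGam χ k γ := by
  have h := sum_betaRep_mul_right
    (f := fun β => conj (chiG χ β) • slash k (Estar n N k) (γ * β)) (fun ν hν β => by
      have e : γ * (ν * β) = γ * ν * γ⁻¹ * (γ * β) := by group
      simp only [chiG_mul χ (GammaFull_le_Gamma0 hν), chiG_of_mem_GammaFull χ hν, one_mul]
      rw [e, slash_Estar_mul_left (GammaFull_le_KGrp (GammaFull_normal.conj_mem ν hν γ))]) hδ
  rw [← EGam_eq] at h
  have h1 : slash k (EGam χ k γ) δ = ∑ c : BetaIndex n N,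
      conj (chiG χ (betaRep c)) • slash k (Estar n N k) (γ * (betaRep c * δ)) := by
    rw [EGam_eq, slash_sum]
    refine Finset.sum_congr rfl fun c _ => ?_
    rw [slash_smul, slash_slash, mul_assoc]
  rw [h1, ← h, Finset.smul_sum]
  refine Finset.sum_congr rfl fun c _ => ?_
  rw [chiG_mul χ (betaRep_mem c), map_mul, conj_chiG χ hδ, smul_smul]
  congr 1
  linear_combination (-conj (chiG χ (betaRep c))) * chiG_inv_mul χ hδ

theorem E_mem_modularForms (hn : 0 < n) (hN : 0 < N) (hk : n + 1 < k) (γ : Sp n) :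
    E k χ γ ∈ modularForms n N k χ := by
  obtain ⟨B, hB⟩ := exists_norm_coeffE_le χ γ
  refine ⟨?_, ?_, ?_⟩
  · rw [E_eq_cosetSum χ hn hN hk]
    exact isHolomorphic_cosetSum hn hk hB
  · intro δ hδ τ
    have h : slash k (E k χ γ) δ = chiG χ δ • E k χ γ := by
      rw [E_eq_smul_EGam χ hn hN, slash_smul, slash_EGam χ γ hδ, smul_comm]
    have h1 := congrFun h τ
    rw [slash, Pi.smul_apply, smul_eq_mul, zpow_neg, zpow_natCast,
      inv_mul_eq_iff_eq_mul₀ (pow_ne_zero _ (show (denom δ τ.1).det ≠ 0 from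
        jdet_ne_zero δ τ))] at h1
    rw [h1]; ring
  · rintro rfl γ'
    obtain ⟨c, hc⟩ := exists_norm_cosetSum_le (k := k) hk (a := fun x => coeffE χ γ (x * γ'⁻¹))
      (fun x => hB _)
    refine ⟨1, c, fun τ hτ => ?_⟩
    rw [E_eq_cosetSum χ hn hN hk, slash_cosetSum k (leftInv_coeffE χ γ)]
    exact hc τ (hτ 0)

theorem E_mem_Eis (hn : 0 < n) (hN : 0 < N) (hk : n + 1 < k) (γ : Sp n) :
    E k χ γ ∈ Eis n N k χ := by
  refine ⟨E_mem_modularForms χ hn hN hk γ, ?_⟩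
  rw [E_eq_smul_EGam χ hn hN, EGam_eq]
  exact Submodule.smul_mem _ _ (Submodule.sum_mem _ fun c _ => Submodule.smul_mem _ _
    (Submodule.subset_span ⟨_, rfl⟩))

/-- An element of `M_k(N, χ)` is fixed by the normalized average over `Γ(N) \ Γ_0(N)`. -/
theorem smul_betaAverage_eq {f : SiegelH n → ℂ}
    (hf : f ∈ modularForms n N k χ) :
    betaAverage χ k f = (Fintype.card (BetaIndex n N) : ℂ) • f := by
  rw [betaAverage_apply]
  have h : ∀ c : BetaIndex n N, conj (chiG χ (betaRep c)) • slash k f (betaRep c) = f := by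
    intro c
    funext τ
    have h1 := hf.2.1 _ (betaRep_mem c) τ
    have h2 := chiG_inv_mul χ (betaRep_mem c)
    have h3 : (denom (betaRep c) τ.1).det ^ k ≠ 0 := pow_ne_zero _ (jdet_ne_zero (betaRep c) τ)
    rw [Pi.smul_apply, slash, h1, conj_chiG χ (betaRep_mem c), smul_eq_mul, zpow_neg, zpow_natCast]
    field_simp
    rw [h2, one_mul]
  rw [Finset.sum_congr rfl fun c _ => h c, Finset.sum_const, Finset.card_univ,
    Nat.cast_smul_eq_nsmul]

variable {R : Set (Sp n)}

/-- Up to a scalar `∑_β χ̄(β) 𝔼*|gβ` depends only on the double coset of `g`. -/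
theorem EGam_mem_span (hn : 0 < n) (hN : 0 < N) (hR : IsDoubleCosetReps N R) (g : Sp n) :
    EGam χ k g ∈ Submodule.span ℂ
      (Set.range fun γ : {γ : Sp n // γ ∈ R ∧ E k χ γ ≠ 0} => E k χ γ.1) := by
  have hg : g ∈ ⋃ γ ∈ R, DoubleCoset.doubleCoset γ (GammaInf n : Set (Sp n))
      (Gamma0 n N : Set (Sp n)) := by rw [hR.1]; trivial
  obtain ⟨γ, hγ, hg⟩ := Set.mem_iUnion₂.1 hg
  obtain ⟨u, hu, δ, hδ, rfl⟩ := DoubleCoset.mem_doubleCoset.1 hg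
  have h1 : ∃ c : ℂ, EGam χ k (u * γ * δ) = c • EGam χ k γ := by
    rcases mem_GammaInf_cases hn hu with h | h
    · refine ⟨chiG χ δ, ?_⟩
      rw [EGam_mul_right χ _ hδ, EGam_mul_left χ (GammaInfPlus_le_KGrp h)]
    · refine ⟨chiG χ δ * (-1) ^ k, ?_⟩
      have e : u * γ = gammaPM n * (gammaPM n * u * γ) := by
        simp only [← mul_assoc, gammaPM_mul_self, one_mul]
      rw [EGam_mul_right χ _ hδ, e, EGam_gammaPM_mul χ hn, EGam_mul_left χ (GammaInfPlus_le_KGrp h),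
        smul_smul]
  obtain ⟨c, hc⟩ := h1
  rw [hc, EGam_eq_smul_E χ hn hN, smul_smul]
  by_cases h0 : E k χ γ = 0
  · rw [h0, smul_zero]; exact zero_mem _
  · exact Submodule.smul_mem _ _ (Submodule.subset_span ⟨⟨γ, hγ, h0⟩, rfl⟩)

/-- Averaging over `Γ(N) \ Γ_0(N)` fixes a modular form up to a nonzero factor and carries every
`𝔼*|g` into the span of the `𝔼_γ`. -/
theorem span_E_eq_Eis (hn : 0 < n) (hN : 0 < N) (hk : n + 1 < k) (hR : IsDoubleCosetReps N R) :
    Submodule.span ℂ (Set.range fun γ : {γ : Sp n // γ ∈ R ∧ E k χ γ ≠ 0} => E k χ γ.1) =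
      Eis n N k χ := by
  refine le_antisymm (Submodule.span_le.2 ?_) ?_
  · rintro _ ⟨γ, rfl⟩
    exact E_mem_Eis χ hn hN hk γ.1
  · rintro f ⟨hf, hspan⟩
    have h1 : betaAverage χ k f ∈ Submodule.span ℂ
        (Set.range fun γ : {γ : Sp n // γ ∈ R ∧ E k χ γ ≠ 0} => E k χ γ.1) := by
      have h2 : Submodule.span ℂ (Set.range fun γ : Sp n => slash k (Estar n N k) γ) ≤
          (Submodule.span ℂ (Set.range fun γ : {γ : Sp n // γ ∈ R ∧ E k χ γ ≠ 0} =>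
            E k χ γ.1)).comap (betaAverage χ k) := by
        refine Submodule.span_le.2 ?_
        rintro _ ⟨g, rfl⟩
        exact EGam_mem_span χ hn hN hR g
      exact h2 hspan
    have hcard : (Fintype.card (BetaIndex n N) : ℂ) ≠ 0 := by
      have : Nonempty (BetaIndex n N) := ⟨Quotient.mk _ 1⟩
      exact Nat.cast_ne_zero.2 Fintype.card_ne_zero
    rw [smul_betaAverage_eq χ hf] at h1
    exact (Submodule.smul_mem_iff _ hcard).1 h1

open Filter Topology in
theorem linearIndependent_E (hn : 0 < n) (hN : 0 < N) (hk : n + 1 < k)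
    (hR : IsDoubleCosetReps N R) :
    LinearIndependent ℂ fun γ : {γ : Sp n // γ ∈ R ∧ E k χ γ ≠ 0} => E k χ γ.1 := by
  -- The values at the cusps form twice the identity matrix.
  have hval : ∀ γ γ' : {γ : Sp n // γ ∈ R ∧ E k χ γ ≠ 0}, γ ≠ γ' →
      coeffE χ γ.1 γ'.1 + (-1) ^ k * coeffE χ γ.1 (gammaPM n * γ'.1) = 0 := by
    intro γ γ' hne
    have hz : ∀ u ∈ GammaInf n, coeffE χ γ.1 (u * γ'.1) = 0 := by
      intro u hu
      by_contra h0
      obtain ⟨β, hβ, hK⟩ := exists_of_coeffE_ne_zero χ h0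
      obtain ⟨p, hp, ν, hν, hpν⟩ := mem_KGrp.1 hK
      have hd := hR.2 γ.2.1 γ'.2.1 (fun h => hne (Subtype.ext h))
      refine Set.disjoint_left.1 hd (show γ'.1 ∈ _ from ?_)
        (DoubleCoset.mem_doubleCoset.2 ⟨1, one_mem _, 1, one_mem _, by simp⟩)
      refine DoubleCoset.mem_doubleCoset.2 ⟨u⁻¹ * p, mul_mem (inv_mem hu) (GammaInfPlus_le hp),
        γ.1⁻¹ * ν * γ.1 * β, mul_mem (GammaFull_le_Gamma0
          (by simpa using GammaFull_normal.conj_mem ν hν γ.1⁻¹)) hβ, ?_⟩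
      have e : u * γ'.1 = p * ν * (γ.1 * β) := by rw [hpν]; group
      have e2 : γ'.1 = u⁻¹ * (u * γ'.1) := by group
      rw [e2, e]; group
    have h1 := hz 1 (one_mem _)
    rw [one_mul] at h1
    rw [h1, hz _ gammaPM_mem_GammaInf, mul_zero, add_zero]
  rw [linearIndependent_iff']
  intro s g hg j hj
  have h1 : Tendsto (fun m : ℕ => slash k (∑ i ∈ s, g i • E k χ i.1) j.1⁻¹
      (iyPt n (m + 1) (by positivity))) atTop (𝓝 (∑ i ∈ s, g i *
        (coeffE χ i.1 j.1 + (-1) ^ k * coeffE χ i.1 (gammaPM n * j.1)))) := by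
    simp only [slash_sum, slash_smul, Finset.sum_apply, Pi.smul_apply, smul_eq_mul]
    exact tendsto_finsetSum _ fun i _ => (tendsto_slash_E χ hn hN hk i.1 j.1).const_mul (g i)
  rw [hg, Finset.sum_eq_single_of_mem j hj fun i _ hij => by rw [hval i j hij, mul_zero],
    cusp_value_self χ hn hN (chi_neg_one_of_E_ne_zero χ hn hN j.2.2)
      (chiG_eq_one_of_E_ne_zero χ hn hN j.2.2)] at h1
  have h2 : slash k (0 : SiegelH n → ℂ) j.1⁻¹ = 0 := map_zero (slashLinear k j.1⁻¹)
  rw [h2] at h1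
  have h3 : g j * 2 = 0 := tendsto_nhds_unique h1 tendsto_const_nhds
  exact (mul_eq_zero.1 h3).resolve_right two_ne_zero

end Basis

end SiegelEis

open SiegelEis in
theorem proposition3p1 (n N k : ℕ) (hn : 0 < n) (hN : 0 < N) (hk : n + 1 < k)
    (χ : DirichletCharacter ℂ N) :
    -- the series defining `𝔼*` converges absolutely on `𝔥_n`
    (∀ τ : SiegelH n, Summable fun c : StarIndex n N => ‖oneSlash k (starRep c) τ‖) ∧
    -- (a)
    (∀ γ : Sp n, E k χ γ ≠ 0 ↔
      χ (-1) = (-1) ^ k ∧ (∀ δ ∈ GammaStab N γ, chiG χ δ = 1) ∧ (2 < N ∨ Even k)) ∧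
    -- (b)
    (∀ γ : Sp n, E k χ γ ≠ 0 →
      (∀ S : Set (Sp n), IsOrbitReps N γ S → ∀ τ : SiegelH n,
        HasSum (fun δ : S => conj (chiG χ δ.1) * oneSlash k (γ * δ.1) τ) (E k χ γ τ)) ∧
      -- `χ(M, N)` is well defined
      (∀ p : IntPair n, ∀ δ ∈ Gamma0 n N, InOrbit γ δ p → chiPair χ γ p = chiG χ δ) ∧
      (∀ P : Set (IntPair n), IsPairReps N γ P → ∀ τ : SiegelH n,
        HasSum (fun p : P => conj (chiPair χ γ p.1) * pairDet p.1 τ ^ (-(k : ℤ)))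
          (E k χ γ τ))) ∧
    -- (c)
    (∀ R : Set (Sp n), IsDoubleCosetReps N R →
      LinearIndependent ℂ (fun γ : {γ : Sp n // γ ∈ R ∧ E k χ γ ≠ 0} => E k χ γ.1) ∧
      Submodule.span ℂ (Set.range fun γ : {γ : Sp n // γ ∈ R ∧ E k χ γ ≠ 0} => E k χ γ.1) =
        Eis n N k χ) := by
  have := finite_betaIndex (n := n) hN
  have := Fintype.ofFinite (BetaIndex n N)
  refine ⟨fun τ => ?_, fun γ => ⟨fun h => ?_, fun h => E_ne_zero_of χ hn hN hk h.1 h.2.1⟩,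
    fun γ h => ?_, fun R hR => ⟨linearIndependent_E χ hn hN hk hR, span_E_eq_Eis χ hn hN hk hR⟩⟩
  · simp only [oneSlash_starRep]
    exact (summable_norm_oneSlash hn hk τ).comp_injective starCoset_injective
  · have h1 := chi_neg_one_of_E_ne_zero χ hn hN h
    exact ⟨h1, chiG_eq_one_of_E_ne_zero χ hn hN h, two_lt_or_even χ hN h1⟩
  · have htriv := chiG_eq_one_of_E_ne_zero χ hn hN h
    exact ⟨fun S hS τ => hasSum_of_isOrbitReps χ hn hN hk htriv hS τ,
      fun p δ hδ h => chiPair_eq χ htriv hδ h,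
      fun P hP τ => hasSum_of_isPairReps χ hn hN hk htriv hP τ⟩
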